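/- Conventions. All vector bundles are smooth, real and of finite rank. A double vector bundle $(D;A,B;M)$ is a smooth manifold $D$ with vector bundle structures $\pi_A\colon D\to A$ and $\pi_B\colon D\to B$ over the total spaces of vector bundles $A,B\to M$, such that the square of projections commutes, $\pi_B$ is a vector bundle morphism over $A\to M$, and the addition $+_B$ and scalar multiplication of $D\to B$ are vector bundle morphisms over those of $A$. Its core $C=\ker\pi_A\cap\ker\pi_B$ is a vector bundle over $M$, with inclusion $c\mapsto\overline c$. The dual $D^*_A$ of $D\to A$ is a double vector bundle $(D^*_A;A,C^*;M)$ with core $B^*$, where $\langle\pi_{C^*}(\Phi),c\rangle=\Phi(0_a+_B\overline c)$ for $\Phi$ over $a$, $(\Phi_1+_{C^*}\Phi_2)(d_1+_Bd_2)=\Phi_1(d_1)+\Phi_2(d_2)$, and $\overline\beta(d)=\langle\beta,\pi_B(d)\rangle$ for $\beta\in B^*$; similarly for $D^*_B$. The canonical pairing of $D^*_A$ with $D^*_B$ over $C^*$ is $\langle\!\langle\Phi,\Psi\rangle\!\rangle=\langle\Phi,d\rangle_A-\langle\Psi,d\rangle_B$ for any $d\in D$ with $\pi_A(d)=\pi_A(\Phi)$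 and $\pi_B(d)=\pi_B(\Psi)$. Biduals of vector bundles are identified with the bundles. An involutive double vector bundle $(D;Q,Q;M)$ with core $B^*$ and projections $\pi_1,\pi_2\colon D\to Q$ is a double vector bundle with a smooth map $\mathcal I\colon D\to D$ such that $\mathcal I^2=\mathrm{id}$, $\pi_1\circ\mathcal I=\pi_2$, $\pi_2\circ\mathcal I=\pi_1$, $\mathcal I$ is a vector bundle morphism over $\mathrm{id}_Q$ from $\pi_1$ to $\pi_2$ and from $\pi_2$ to $\pi_1$, and $\mathcal I(\overline\beta)=\overline{-\beta}$ for $\beta\in B^*$. A metric double vector bundle $(\mathbb E,Q;B,M)$ is a double vector bundle with a linear metric: a smooth, symmetric, non-degenerate pairing $\langle\cdot,\cdot\rangle_{\mathbb E}\colon\mathbb E\times_B\mathbb E\to\mathbb R$, bilinear over $B$ and linear over $Q$, i.e. $\langle e_1+_Qe_2,f_1+_Qf_2\rangle_{\mathbb E}=\langle e_1,f_1\rangle_{\mathbb E}+\langle e_2,f_2\rangle_{\mathbb E}$ and $\langle r\cdot_Qe,r\cdot_Qf\rangle_{\mathbb E}=r\langle e,f\rangle_{\mathbb E}$ whenever $\pi_B(e_i)=\pi_B(f_i)$,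 $\pi_B(e)=\pi_B(f)$. Its core is identified with $Q^*$ through $\langle e,0_b+_Q\overline\tau\rangle_{\mathbb E}=\langle\tau,\pi_Q(e)\rangle$ for $e\in\mathbb E$ over $b\in B$ and $\tau\in Q^*$, and $\mathbb E\cong\mathbb E^*_B$ through $e\mapsto\langle e,\cdot\rangle_{\mathbb E}$. Proposition 3.11. Let $Q$ and $B$ be vector bundles over a smooth manifold $M$. (1) Let $(D;Q,Q;M)$ be an involutive double vector bundle with involution $\mathcal I$ and core $B^*$. Then the dual double vector bundle $(\mathbb E:=D^*_{\pi_1},Q;B,M)$ has a unique linear metric with $$\langle e_1,e_2\rangle_{\mathbb E}=\langle e_1,d\rangle_Q+\langle e_2,\mathcal I(d)\rangle_Q$$ for all $(e_1,e_2)\in\mathbb E\times_B\mathbb E$ and any $d\in D$ with $\pi_1(d)=\pi_Q(e_1)$ and $\pi_2(d)=\pi_Q(e_2)$; such $d$ always exist. The identification of the core of $\mathbb E$ with $Q^*$ given by this metric is that of the core of the dual $D^*_{\pi_1}$. (2) Let $(\mathbb E,Q;B,M)$ be a metric double vector bundle with core $Q^*$. Then the dual double vector bundle $D:=\mathbb E^*_Q$,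 with sides $\pi_1\colon D\to Q$ and $\pi_2\colon D\to Q^{**}\cong Q$ and with core $B^*$, is an involutive double vector bundle for a unique $\mathcal I\colon D\to D$ over these sides with $$\langle\mathcal I(d),e\rangle_Q=\langle\!\langle e,d\rangle\!\rangle$$ for all $d\in D$ and $e\in\mathbb E\cong\mathbb E^*_B$ with $\pi_2(d)=\pi_Q(e)$. (3) The two constructions are inverse to each other: applying (1) and then (2) to an involutive double vector bundle $D$, the canonical map $D\to D^{**}$ (bidual over $Q$ via $\pi_1$) is an isomorphism of double vector bundles over the identities of the sides and of the core that intertwines the involutions; applying (2) and then (1) to a metric double vector bundle $\mathbb E$, the canonical map $\mathbb E\to\mathbb E^{**}$ (bidual over $Q$) is an isomorphism of double vector bundles over the identities of the sides and of the core that preserves the metrics. -/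

import Mathlib

open Bundle Manifold
open scoped ContDiff

noncomputable section

/-- A smooth real vector bundle of finite rank over `M`: Mathlib's smooth vector bundles, bundled.
The two topological fields on the fibres follow from local triviality; they are recorded because
Mathlib asks for them as instances. -/
structure SmoothVB {EM : Type*} [NormedAddCommGroup EM] [NormedSpace ℝ EM]
    {HM : Type*} [TopologicalSpace HM] (I : ModelWithCorners ℝ EM HM)
    (M : Type*) [TopologicalSpace M] [ChartedSpace HM M] where
  /-- the model fibre -/
  F : Type*
  /-- the fibres -/
  E : M → Type*
  [normF : NormedAddCommGroup F]
  [spaceF : NormedSpace ℝ F]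
  [finF : FiniteDimensional ℝ F]
  [grpE : ∀ m, AddCommGroup (E m)]
  [modE : ∀ m, Module ℝ (E m)]
  [topE : ∀ m, TopologicalSpace (E m)]
  [topGrpE : ∀ m, IsTopologicalAddGroup (E m)]
  [contSMulE : ∀ m, ContinuousSMul ℝ (E m)]
  [topTot : TopologicalSpace (TotalSpace F E)]
  [fibE : FiberBundle F E]
  [vecE : VectorBundle ℝ F E]
  [smoothE : ContMDiffVectorBundle ∞ F E I]

namespace SmoothVB

attribute [instance] normF spaceF finF grpE modE topE topGrpE contSMulE topTot fibE vecE smoothE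

variable {EM : Type*} [NormedAddCommGroup EM] [NormedSpace ℝ EM]
    {HM : Type*} [TopologicalSpace HM] {I : ModelWithCorners ℝ EM HM}
    {M : Type*} [TopologicalSpace M] [ChartedSpace HM M]

/-- The total space. It is a smooth manifold modelled on `I.prod 𝓘(ℝ, V.F)`. -/
abbrev Tot (V : SmoothVB I M) := TotalSpace V.F V.E

/-- The model with corners of the total space. -/
abbrev model (V : SmoothVB I M) : ModelWithCorners ℝ (EM × V.F) (ModelProd HM V.F) :=
  I.prod 𝓘(ℝ, V.F)

/-- The dual vector bundle (Mathlib's bundle of continuous linear maps into the trivial line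
bundle). -/
abbrev dual (V : SmoothVB I M) : SmoothVB I M where
  F := V.F →L[ℝ] ℝ
  E := fun m => V.E m →L[ℝ] Bundle.Trivial M ℝ m

/-- The canonical map `V → V**` on fibres, `v ↦ (φ ↦ φ v)`. -/
def ev (V : SmoothVB I M) {m : M} (v : V.E m) : V.dual.dual.E m where
  toFun φ := φ v
  map_add' _ _ := rfl
  map_smul' _ _ := rfl
  cont := continuous_eval_const (F := V.E m →L[ℝ] ℝ) v

end SmoothVB

section

variable {EM : Type*} [NormedAddCommGroup EM] [NormedSpace ℝ EM]
    {HM : Type*} [TopologicalSpace HM] {I : ModelWithCorners ℝ EM HM}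
    {M : Type*} [TopologicalSpace M] [ChartedSpace HM M]

/-- A double vector bundle `(D; A, B; M)` with core `K*`.

The manifold `D.Tot` carries two vector bundle structures. The one over the total space `A.Tot` is
the given vector bundle `D` (operations `+`, `•`, `0` on its fibres `D.E ⟨m, a⟩`, `a ∈ A_m`). The
one over the total space `B.Tot` is given by the projection `(m, a, d) ↦ (m, prB d)`, the zero
section `zeroB`, the addition `addB` and the scalar multiplication `smulB`; local triviality
`locTriv`, through fibrewise linear diffeomorphisms, makes each of its fibres a vector space for
these operations. The typing of the operations says that the square of the four projections
commutes and that `zeroB`, `addB`, `smulB` cover the zero section, the addition and the scalar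
multiplication of `A`. -/
structure DVB (A B K : SmoothVB I M) (D : SmoothVB A.model A.Tot) where
  /-- the projection to `B`; it is linear on the fibres of `D → A`, i.e. it is a morphism of vector
  bundles from `D → A` to `B → M` over the projection `A → M` -/
  prB : ∀ {m : M} {a : A.E m}, D.E ⟨m, a⟩ →ₗ[ℝ] B.E m
  /-- the zero section of `D → B` -/
  zeroB : ∀ {m : M}, B.E m → D.E ⟨m, 0⟩
  /-- the addition of `D → B`, defined on `D ×_B D` -/
  addB : ∀ {m : M} {a a' : A.E m} (d : D.E ⟨m, a⟩) (d' : D.E ⟨m, a'⟩), prB d = prB d' →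
    D.E ⟨m, a + a'⟩
  /-- the scalar multiplication of `D → B` -/
  smulB : ∀ {m : M} {a : A.E m} (r : ℝ), D.E ⟨m, a⟩ → D.E ⟨m, r • a⟩
  prB_zeroB : ∀ {m : M} (b : B.E m), prB (zeroB b) = b
  prB_addB : ∀ {m : M} {a a' : A.E m} (d : D.E ⟨m, a⟩) (d' : D.E ⟨m, a'⟩) (h : prB d = prB d'),
    prB (addB d d' h) = prB d
  prB_smulB : ∀ {m : M} {a : A.E m} (r : ℝ) (d : D.E ⟨m, a⟩), prB (smulB r d) = prB d
  /-- `D → B` is a smooth vector bundle: around each point of `B` there is a smooth local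
  trivialization of `D.Tot → B.Tot` that is linear on the fibres. -/
  locTriv : ∀ b₀ : B.Tot, ∃ (k : ℕ)
    (e : Trivialization (EuclideanSpace ℝ (Fin k))
      (fun d : D.Tot => (⟨d.proj.proj, prB d.snd⟩ : B.Tot))),
    b₀ ∈ e.baseSet ∧
    ContMDiffOn D.model (B.model.prod (𝓡 k)) ∞ e e.source ∧
    ContMDiffOn (B.model.prod (𝓡 k)) D.model ∞ e.toOpenPartialHomeomorph.symm e.target ∧
    (∀ {m : M} (b : B.E m), (⟨m, b⟩ : B.Tot) ∈ e.baseSet →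
      (e ⟨⟨m, 0⟩, zeroB b⟩).2 = 0) ∧
    (∀ {m : M} {a a' : A.E m} (d : D.E ⟨m, a⟩) (d' : D.E ⟨m, a'⟩) (h : prB d = prB d'),
      (⟨m, prB d⟩ : B.Tot) ∈ e.baseSet →
      (e ⟨⟨m, a + a'⟩, addB d d' h⟩).2 = (e ⟨⟨m, a⟩, d⟩).2 + (e ⟨⟨m, a'⟩, d'⟩).2) ∧
    (∀ {m : M} {a : A.E m} (r : ℝ) (d : D.E ⟨m, a⟩), (⟨m, prB d⟩ : B.Tot) ∈ e.baseSet →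
      (e ⟨⟨m, r • a⟩, smulB r d⟩).2 = r • (e ⟨⟨m, a⟩, d⟩).2)
  /-- `+_B` is a morphism of vector bundles over the addition of `A`: the interchange law
  `(d₁ +_A d₂) +_B (d₃ +_A d₄) = (d₁ +_B d₃) +_A (d₂ +_B d₄)` -/
  addB_add : ∀ {m : M} {a a' : A.E m} (d₁ d₂ : D.E ⟨m, a⟩) (d₃ d₄ : D.E ⟨m, a'⟩)
    (h : prB d₁ = prB d₃) (h' : prB d₂ = prB d₄),
    addB (d₁ + d₂) (d₃ + d₄) (by rw [map_add, map_add, h, h']) = addB d₁ d₃ h + addB d₂ d₄ h'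
  /-- `(r ·_A d) +_B (r ·_A d') = r ·_A (d +_B d')` -/
  addB_smul : ∀ {m : M} {a a' : A.E m} (r : ℝ) (d : D.E ⟨m, a⟩) (d' : D.E ⟨m, a'⟩)
    (h : prB d = prB d'),
    addB (r • d) (r • d') (by rw [map_smul, map_smul, h]) = r • addB d d' h
  /-- `r ·_B (d +_A d') = (r ·_B d) +_A (r ·_B d')` -/
  smulB_add : ∀ {m : M} {a : A.E m} (r : ℝ) (d d' : D.E ⟨m, a⟩),
    smulB r (d + d') = smulB r d + smulB r d'
  /-- `r ·_B (s ·_A d) = s ·_A (r ·_B d)` -/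
  smulB_smul : ∀ {m : M} {a : A.E m} (r s : ℝ) (d : D.E ⟨m, a⟩),
    smulB r (s • d) = s • smulB r d
  /-- the identification `γ ↦ γ̄` of `K*` with the core, the set of elements of `D` that project to
  zero in `A` and to zero in `B` -/
  core : ∀ {m : M}, K.dual.E m →ₗ[ℝ] D.E ⟨m, 0⟩
  core_injective : ∀ m : M, Function.Injective (core (m := m))
  range_core : ∀ m : M, LinearMap.range (core (m := m)) = LinearMap.ker (prB (m := m) (a := 0))
  core_smooth : ContMDiff K.dual.model D.model ∞
    (fun γ : K.dual.Tot => (⟨⟨γ.proj, 0⟩, core γ.snd⟩ : D.Tot))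

namespace DVB

variable {A B K : SmoothVB I M} {D D' : SmoothVB A.model A.Tot}

theorem prB_core (S : DVB A B K D) {m : M} (γ : K.dual.E m) : S.prB (S.core γ) = 0 := by
  have h : S.core γ ∈ LinearMap.range (S.core (m := m)) := ⟨γ, rfl⟩
  rw [S.range_core m] at h
  exact h

/-- The element `0_a +_B γ̄` of the fibre of `D → A` over `a`. -/
def coreA (S : DVB A B K D) {m : M} (a : A.E m) (γ : K.dual.E m) : D.E ⟨m, a⟩ :=
  cast (by rw [add_zero])
    (S.addB (0 : D.E ⟨m, a⟩) (S.core γ) (by rw [map_zero, S.prB_core γ]))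

/-- The element `0_b +_A γ̄` of the fibre of `D → B` over `b`. -/
def coreB (S : DVB A B K D) {m : M} (b : B.E m) (γ : K.dual.E m) : D.E ⟨m, 0⟩ :=
  S.zeroB b + S.core γ

theorem prB_coreB (S : DVB A B K D) {m : M} (b : B.E m) (γ : K.dual.E m) :
    S.prB (S.coreB b γ) = b := by
  rw [coreB, map_add, S.prB_zeroB, S.prB_core, add_zero]

/-- `T` is the dual `D*_A` of the double vector bundle `S = (D; A, B; M)` with core `K*`. It has
sides `A` and `K ≅ (K*)*` and core `B*`; the vector bundle `D*_A → A` is the dual of `D → A`. -/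
structure IsDual (S : DVB A B K D) (T : DVB A K B D.dual) : Prop where
  /-- `⟨γ, π_K(Φ)⟩ = Φ(0_a +_B γ̄)` for `Φ` over `a` and all `γ ∈ K*` -/
  proj : ∀ {m : M} {a : A.E m} (Φ : D.dual.E ⟨m, a⟩) (γ : K.dual.E m),
    γ (T.prB Φ) = Φ (S.coreA a γ)
  /-- `(Φ +_K Φ')(d +_B d') = Φ(d) + Φ'(d')` -/
  add : ∀ {m : M} {a a' : A.E m} (Φ : D.dual.E ⟨m, a⟩) (Φ' : D.dual.E ⟨m, a'⟩)
    (hΦ : T.prB Φ = T.prB Φ') (d : D.E ⟨m, a⟩) (d' : D.E ⟨m, a'⟩) (hd : S.prB d = S.prB d'),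
    T.addB Φ Φ' hΦ (S.addB d d' hd) = Φ d + Φ' d'
  /-- `(r ·_K Φ)(r ·_B d) = r Φ(d)` -/
  smul : ∀ {m : M} {a : A.E m} (r : ℝ) (Φ : D.dual.E ⟨m, a⟩) (d : D.E ⟨m, a⟩),
    T.smulB r Φ (S.smulB r d) = r * Φ d
  /-- the core element defined by `β ∈ B*` is `d ↦ β(π_B(d))`, for `d` over `0` -/
  core : ∀ {m : M} (β : B.dual.E m) (d : D.E ⟨m, 0⟩), T.core β d = β (S.prB d)

/-- A linear functional on the fibre of `D → B` over `b`, i.e. an element of `D*_B` over `b`. -/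
structure FunctionalB (S : DVB A B K D) {m : M} (b : B.E m) where
  toFun : ∀ {a : A.E m} (d : D.E ⟨m, a⟩), S.prB d = b → ℝ
  map_add : ∀ {a a' : A.E m} (d : D.E ⟨m, a⟩) (d' : D.E ⟨m, a'⟩) (h : S.prB d = b)
    (h' : S.prB d' = b),
    toFun (S.addB d d' (h.trans h'.symm)) ((S.prB_addB d d' _).trans h) = toFun d h + toFun d' h'
  map_smul : ∀ {a : A.E m} (r : ℝ) (d : D.E ⟨m, a⟩) (h : S.prB d = b),
    toFun (S.smulB r d) ((S.prB_smulB r d).trans h) = r * toFun d h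

/-- `c` is the value `⟨⟨Ψ, Φ⟩⟩` of the canonical pairing of `D*_B` with `D*_A`, for `Ψ ∈ D*_B` over
`b` and `Φ ∈ D*_A` over `a`: `c = ⟨Ψ, d⟩_B - ⟨Φ, d⟩_A` for any `d ∈ D` over `a` and `b`. (The
pairing is defined for `Ψ` and `Φ` with the same projection to `K`.) -/
def IsCanonicalPairing (S : DVB A B K D) {m : M} {a : A.E m} {b : B.E m}
    (Ψ : S.FunctionalB b) (Φ : D.dual.E ⟨m, a⟩) (c : ℝ) : Prop :=
  (∃ d : D.E ⟨m, a⟩, S.prB d = b) ∧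
    ∀ (d : D.E ⟨m, a⟩) (h : S.prB d = b), c = Ψ.toFun d h - Φ d

/-- The fibrewise maps `f : D → D'` over the identity of `A` form an isomorphism of double vector
bundles over the identities of `A`, `B` and of the core. -/
structure IsIso (S : DVB A B K D) (S' : DVB A B K D')
    (f : ∀ {x : A.Tot}, D.E x → D'.E x) : Prop where
  /-- the total map is a diffeomorphism -/
  diffeo : ∃ φ : D.Tot ≃ₘ^∞⟮D.model, D'.model⟯ D'.Tot, ∀ d : D.Tot, φ d = ⟨d.proj, f d.snd⟩
  add : ∀ {x : A.Tot} (d d' : D.E x), f (d + d') = f d + f d'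
  smul : ∀ {x : A.Tot} (r : ℝ) (d : D.E x), f (r • d) = r • f d
  prB : ∀ {m : M} {a : A.E m} (d : D.E ⟨m, a⟩), S'.prB (f d) = S.prB d
  addB : ∀ {m : M} {a a' : A.E m} (d : D.E ⟨m, a⟩) (d' : D.E ⟨m, a'⟩) (h : S.prB d = S.prB d')
    (h' : S'.prB (f d) = S'.prB (f d')), f (S.addB d d' h) = S'.addB (f d) (f d') h'
  smulB : ∀ {m : M} {a : A.E m} (r : ℝ) (d : D.E ⟨m, a⟩), f (S.smulB r d) = S'.smulB r (f d)
  core : ∀ {m : M} (γ : K.dual.E m), f (S.core γ) = S'.core γ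

end DVB

/-- An involutive double vector bundle `(D; Q, Q; M)` with core `B*`; the first projection `π₁` is
that of the vector bundle `D → Q.Tot`, the second projection `π₂` is `prB`. -/
structure InvolutiveDVB (Q B : SmoothVB I M) (D : SmoothVB Q.model Q.Tot)
    extends DVB Q Q B D where
  /-- the involution; its typing says that `π₁ ∘ 𝓘 = π₂` -/
  inv : ∀ {m : M} {q : Q.E m} (d : D.E ⟨m, q⟩), D.E ⟨m, prB d⟩
  /-- `π₂ ∘ 𝓘 = π₁` -/
  prB_inv : ∀ {m : M} {q : Q.E m} (d : D.E ⟨m, q⟩), prB (inv d) = q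
  /-- `𝓘² = id` -/
  inv_inv : ∀ {m : M} {q : Q.E m} (d : D.E ⟨m, q⟩),
    (⟨⟨m, prB (inv d)⟩, inv (inv d)⟩ : D.Tot) = ⟨⟨m, q⟩, d⟩
  inv_smooth : ContMDiff D.model D.model ∞
    (fun d : D.Tot => (⟨⟨d.proj.proj, prB d.snd⟩, inv d.snd⟩ : D.Tot))
  /-- `𝓘(d +₁ d') = 𝓘(d) +₂ 𝓘(d')` -/
  inv_add : ∀ {m : M} {q : Q.E m} (d d' : D.E ⟨m, q⟩),
    (⟨⟨m, prB (d + d')⟩, inv (d + d')⟩ : D.Tot) =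
      ⟨⟨m, prB d + prB d'⟩, addB (inv d) (inv d') ((prB_inv d).trans (prB_inv d').symm)⟩
  /-- `𝓘(r ·₁ d) = r ·₂ 𝓘(d)` -/
  inv_smul : ∀ {m : M} {q : Q.E m} (r : ℝ) (d : D.E ⟨m, q⟩),
    (⟨⟨m, prB (r • d)⟩, inv (r • d)⟩ : D.Tot) = ⟨⟨m, r • prB d⟩, smulB r (inv d)⟩
  /-- `𝓘(d +₂ d') = 𝓘(d) +₁ 𝓘(d')`; here `x = 𝓘(d)` and `x' = 𝓘(d')` lie over the same point
  `p = π₂(d) = π₂(d')` of `Q` -/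
  inv_addB : ∀ {m : M} {q q' p : Q.E m} (d : D.E ⟨m, q⟩) (d' : D.E ⟨m, q'⟩)
    (h : prB d = prB d') (x x' : D.E ⟨m, p⟩),
    (⟨⟨m, prB d⟩, inv d⟩ : D.Tot) = ⟨⟨m, p⟩, x⟩ →
    (⟨⟨m, prB d'⟩, inv d'⟩ : D.Tot) = ⟨⟨m, p⟩, x'⟩ →
    (⟨⟨m, prB (addB d d' h)⟩, inv (addB d d' h)⟩ : D.Tot) = ⟨⟨m, p⟩, x + x'⟩
  /-- `𝓘(r ·₂ d) = r ·₁ 𝓘(d)` -/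
  inv_smulB : ∀ {m : M} {q : Q.E m} (r : ℝ) (d : D.E ⟨m, q⟩),
    (⟨⟨m, prB (smulB r d)⟩, inv (smulB r d)⟩ : D.Tot) = ⟨⟨m, prB d⟩, r • inv d⟩
  /-- the core morphism is `-id` -/
  inv_core : ∀ {m : M} (β : B.dual.E m),
    (⟨⟨m, prB (core β)⟩, inv (core β)⟩ : D.Tot) = ⟨⟨m, 0⟩, core (-β)⟩

/-- A metric double vector bundle `(E, Q; B, M)` with core `Q*`: a double vector bundle with a
smooth symmetric non-degenerate pairing `E ×_B E → ℝ`, bilinear on the fibres of `E → B`, that is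
linear over `Q`. The core is identified with `Q*` through the metric. -/
structure MetricDVB (Q B : SmoothVB I M) (E : SmoothVB Q.model Q.Tot)
    extends DVB Q B Q E where
  /-- the pairing, defined on `E ×_B E` -/
  pair : ∀ {m : M} {q q' : Q.E m} (e : E.E ⟨m, q⟩) (e' : E.E ⟨m, q'⟩), prB e = prB e' → ℝ
  /-- the pairing is smooth on the fibre product `E ×_B E ⊆ E × E` -/
  pair_smooth : ∃ P : E.Tot × E.Tot → ℝ,
    ContMDiffOn (E.model.prod E.model) 𝓘(ℝ, ℝ) ∞ P
      {z | (⟨z.1.proj.proj, prB z.1.snd⟩ : B.Tot) = ⟨z.2.proj.proj, prB z.2.snd⟩} ∧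
    ∀ {m : M} {q q' : Q.E m} (e : E.E ⟨m, q⟩) (e' : E.E ⟨m, q'⟩) (h : prB e = prB e'),
      P (⟨⟨m, q⟩, e⟩, ⟨⟨m, q'⟩, e'⟩) = pair e e' h
  pair_symm : ∀ {m : M} {q q' : Q.E m} (e : E.E ⟨m, q⟩) (e' : E.E ⟨m, q'⟩)
    (h : prB e = prB e'), pair e e' h = pair e' e h.symm
  /-- additivity on the fibres of `E → B` -/
  pair_addB : ∀ {m : M} {q₁ q₂ q' : Q.E m} (e₁ : E.E ⟨m, q₁⟩) (e₂ : E.E ⟨m, q₂⟩)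
    (e' : E.E ⟨m, q'⟩) (h₁ : prB e₁ = prB e') (h₂ : prB e₂ = prB e'),
    pair (addB e₁ e₂ (h₁.trans h₂.symm)) e' ((prB_addB e₁ e₂ _).trans h₁) =
      pair e₁ e' h₁ + pair e₂ e' h₂
  /-- homogeneity on the fibres of `E → B` -/
  pair_smulB : ∀ {m : M} {q q' : Q.E m} (r : ℝ) (e : E.E ⟨m, q⟩) (e' : E.E ⟨m, q'⟩)
    (h : prB e = prB e'), pair (smulB r e) e' ((prB_smulB r e).trans h) = r * pair e e' h
  /-- non-degeneracy on the fibres of `E → B` -/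
  pair_nondeg : ∀ {m : M} {q : Q.E m} (e : E.E ⟨m, q⟩),
    (∀ {q' : Q.E m} (e' : E.E ⟨m, q'⟩) (h : prB e = prB e'), pair e e' h = 0) →
    (⟨⟨m, q⟩, e⟩ : E.Tot) = ⟨⟨m, 0⟩, zeroB (prB e)⟩
  /-- linearity over `Q`: `⟨e₁ +_Q e₂, f₁ +_Q f₂⟩ = ⟨e₁, f₁⟩ + ⟨e₂, f₂⟩` -/
  pair_add : ∀ {m : M} {q q' : Q.E m} (e₁ e₂ : E.E ⟨m, q⟩) (f₁ f₂ : E.E ⟨m, q'⟩)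
    (h₁ : prB e₁ = prB f₁) (h₂ : prB e₂ = prB f₂),
    pair (e₁ + e₂) (f₁ + f₂) (by rw [map_add, map_add, h₁, h₂]) = pair e₁ f₁ h₁ + pair e₂ f₂ h₂
  /-- linearity over `Q`: `⟨r ·_Q e, r ·_Q f⟩ = r ⟨e, f⟩` -/
  pair_smul : ∀ {m : M} {q q' : Q.E m} (r : ℝ) (e : E.E ⟨m, q⟩) (f : E.E ⟨m, q'⟩)
    (h : prB e = prB f), pair (r • e) (r • f) (by rw [map_smul, map_smul, h]) = r * pair e f h
  /-- the identification of the core with `Q*` is the one given by the metric: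
  `⟨e, 0_b +_Q τ̄⟩ = ⟨τ, q⟩` for `e` over `q ∈ Q` and `b ∈ B` -/
  pair_core : ∀ {m : M} {q : Q.E m} (e : E.E ⟨m, q⟩) (τ : Q.dual.E m),
    pair e (toDVB.coreB (prB e) τ) (toDVB.prB_coreB (prB e) τ).symm = τ q

/-- The element `β(e) = ⟨e, ·⟩` of `E*_B` defined by `e ∈ E`. -/
def MetricDVB.flat {Q B : SmoothVB I M} {E : SmoothVB Q.model Q.Tot} (T : MetricDVB Q B E)
    {m : M} {q : Q.E m} (e : E.E ⟨m, q⟩) : T.toDVB.FunctionalB (T.prB e) where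
  toFun e' h := T.pair e e' h.symm
  map_add d d' h h' := by
    rw [T.pair_symm e, T.pair_addB d d' e h h', T.pair_symm d, T.pair_symm d']
  map_smul r d h := by
    rw [T.pair_symm e, T.pair_smulB r d e h, T.pair_symm d]

/-- `T` is the metric double vector bundle `D*_{π₁}` defined by the involutive double vector bundle
`S` on `D`: as a double vector bundle it is the dual of `S` over `π₁`, and
`⟨e₁, e₂⟩ = ⟨e₁, d⟩ + ⟨e₂, 𝓘(d)⟩` for any `d ∈ D` with `π₁(d) = π_Q(e₁)` and `π₂(d) = π_Q(e₂)`. -/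
structure InvolutiveDVB.IsDualMetric {Q B : SmoothVB I M} {D : SmoothVB Q.model Q.Tot}
    (S : InvolutiveDVB Q B D) (T : MetricDVB Q B D.dual) : Prop where
  isDual : S.toDVB.IsDual T.toDVB
  pair_eq : ∀ {m : M} {q : Q.E m} (d : D.E ⟨m, q⟩) (e₁ : D.dual.E ⟨m, q⟩)
    (e₂ : D.dual.E ⟨m, S.prB d⟩) (h : T.prB e₁ = T.prB e₂),
    T.pair e₁ e₂ h = e₁ d + e₂ (S.inv d)

/-- `S` is the involutive double vector bundle `E*_Q` defined by the metric double vector bundle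
`T` on `E`: as a double vector bundle it is the dual of `T` over `Q`, and
`⟨𝓘(d), e⟩ = ⟨⟨e, d⟩⟩` for `d ∈ E*_Q` and `e ∈ E ≅ E*_B` with `π₂(d) = π_Q(e)`. -/
structure MetricDVB.IsDualInvolutive {Q B : SmoothVB I M} {E : SmoothVB Q.model Q.Tot}
    (T : MetricDVB Q B E) (S : InvolutiveDVB Q B E.dual) : Prop where
  isDual : T.toDVB.IsDual S.toDVB
  inv_eq : ∀ {m : M} {q : Q.E m} (d : E.dual.E ⟨m, q⟩) (e : E.E ⟨m, S.prB d⟩),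
    T.toDVB.IsCanonicalPairing (T.flat e) d (S.inv d e)

end

end

/-! Locally over `M`, and over every single point, a double vector bundle splits: `D ≅ A ⊕ B ⊕ K*`,
where `+_A` adds the `B` and core components over a fixed `a`, and `+_B` adds the `A` and core
components over a fixed `b`. In such coordinates `D*_A` consists of triples `(a, κ, β)` with `(a, κ,
β)(a, b, γ) = β b + γ κ`, and the canonical map to the bidual is `(a, b, γ) ↦ (a, b, γ)`.

Both structures of the theorem then reduce to one symmetric bilinear form `ω : Q × Q → B*`. An
involution with core morphism `-id` must be `(q, p, γ) ↦ (p, q, ω(q, p) - γ)`, and `𝓘² = id` says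
exactly that `ω` is symmetric (`InvolutiveDVB.invTo_pt`, `InvolutiveDVB.form_symm`). A linear metric
must be `⟨(q, b, t), (q', b, t')⟩ = t q' + t' q + ω(q, q')(b)` (`MetricDVB.pair_pt`). The defining
formulas of (1) and (2) carry the form of one structure to the same form for the other; the
auxiliary element in each formula drops out because its core component occurs twice with opposite
signs. Uniqueness holds because the formulas prescribe all values, and (3) follows by inserting one
formula into the other.

The analytic part is the existence of splittings that are smooth near a given point
(`DVB.exists_smooth_splitting`). A trivialization of `D → B` near `0_m` carries `0_a` to an element
over `b` with the same coordinate, its lift. The lift is linear in `a` for `+_B`, but it lies over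
the right point of `A` only at `b = 0`. Its derivative in `b` along the zero section, the limit of
`s⁻¹ ·_A lift a (s b)`, lies over `a` and `b`. It is linear in `b` as a derivative, and linear in
`a` because `·_A` commutes with the operations over `B`.

A family of pointwise splittings, chosen without regard to smoothness, defines the algebraic
structure of the dual. That structure does not depend on the choice, so its smoothness can be
checked locally with smooth splittings (`DVB.exists_dual_locTriv`). -/

noncomputable section

/-! ### Smooth vector bundles in coordinates; duals and biduals -/

namespace SmoothVB

open Filter Topology

variable {EM : Type*} [NormedAddCommGroup EM] [NormedSpace ℝ EM]
    {HM : Type*} [TopologicalSpace HM] {I : ModelWithCorners ℝ EM HM}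
    {M : Type*} [TopologicalSpace M] [ChartedSpace HM M]
    {EN : Type*} [NormedAddCommGroup EN] [NormedSpace ℝ EN]
    {HN : Type*} [TopologicalSpace HN] {J : ModelWithCorners ℝ EN HN}
    {N : Type*} [TopologicalSpace N] [ChartedSpace HN N]

/-- The domain of the preferred trivialization at `x₀`. -/
abbrev base (V : SmoothVB I M) (x₀ : M) : Set M := (trivializationAt V.F V.E x₀).baseSet

/-- Coordinates on the fibres in the preferred trivialization at `x₀`. -/
def co (V : SmoothVB I M) (x₀ x : M) : V.E x →L[ℝ] V.F :=
  (trivializationAt V.F V.E x₀).continuousLinearMapAt ℝ x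

/-- The inverse of `co` on the domain of the trivialization. -/
def coSymm (V : SmoothVB I M) (x₀ x : M) : V.F →L[ℝ] V.E x :=
  (trivializationAt V.F V.E x₀).symmL ℝ x

variable (V : SmoothVB I M)

theorem base_mem_nhds (x₀ : M) : V.base x₀ ∈ 𝓝 x₀ :=
  (trivializationAt V.F V.E x₀).open_baseSet.mem_nhds (mem_baseSet_trivializationAt V.F V.E x₀)

theorem mem_base (x₀ : M) : x₀ ∈ V.base x₀ := mem_baseSet_trivializationAt V.F V.E x₀

variable {V}

theorem co_coSymm {x₀ x : M} (h : x ∈ V.base x₀) (v : V.F) : V.co x₀ x (V.coSymm x₀ x v) = v :=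
  (trivializationAt V.F V.E x₀).continuousLinearMapAt_symmL h v

theorem coSymm_co {x₀ x : M} (h : x ∈ V.base x₀) (v : V.E x) : V.coSymm x₀ x (V.co x₀ x v) = v :=
  (trivializationAt V.F V.E x₀).symmL_continuousLinearMapAt h v

theorem co_eq {x₀ x : M} (h : x ∈ V.base x₀) (v : V.E x) :
    V.co x₀ x v = (trivializationAt V.F V.E x₀ ⟨x, v⟩).2 :=
  (trivializationAt V.F V.E x₀).continuousLinearMapAt_apply_of_mem ℝ h v

/-- `co` is a linear map at every point of the base and agrees with the trivialization only on its
domain. Continuity of the projection keeps nearby points in that domain. -/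
theorem contMDiffWithinAt_iff_co {f : N → V.Tot} {s : Set N} {y₀ : N} {x₀ : M}
    (h : (f y₀).proj ∈ V.base x₀) :
    ContMDiffWithinAt J V.model ∞ f s y₀ ↔
      ContMDiffWithinAt J I ∞ (fun y => (f y).proj) s y₀ ∧
      ContMDiffWithinAt J 𝓘(ℝ, V.F) ∞ (fun y => V.co x₀ (f y).proj (f y).snd) s y₀ := by
  have hs : f y₀ ∈ (trivializationAt V.F V.E x₀).source := by
    rw [Trivialization.mem_source]; exact h
  rw [Trivialization.contMDiffWithinAt_iff (e := trivializationAt V.F V.E x₀) hs]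
  refine and_congr_right fun hp => ?_
  have hev : ∀ᶠ y in 𝓝[s] y₀, (f y).proj ∈ V.base x₀ :=
    hp.continuousWithinAt.eventually_mem
      ((trivializationAt V.F V.E x₀).open_baseSet.mem_nhds h)
  have heq : (fun y => V.co x₀ (f y).proj (f y).snd) =ᶠ[𝓝[s] y₀]
      fun y => (trivializationAt V.F V.E x₀ (f y)).2 :=
    hev.mono fun y hy => co_eq hy _
  exact ⟨fun H => H.congr_of_eventuallyEq heq (co_eq h _),
    fun H => H.congr_of_eventuallyEq heq.symm (co_eq h _).symm⟩

theorem base_dual (x₀ : M) : V.dual.base x₀ = V.base x₀ := by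
  have : V.dual.base x₀ = V.base x₀ ∩ (trivializationAt ℝ (Bundle.Trivial M ℝ) x₀).baseSet :=
    hom_trivializationAt_baseSet (F₁ := V.F) (E₁ := V.E) (RingHom.id ℝ) x₀
  rw [this]
  simp

theorem co_dual {x₀ x : M} (h : x ∈ V.base x₀) (φ : V.dual.E x) (v : V.F) :
    V.dual.co x₀ x φ v = φ (V.coSymm x₀ x v) := by
  rw [co_eq (by rw [base_dual]; exact h)]
  have := hom_trivializationAt_apply (F₁ := V.F) (E₁ := V.E) (F₂ := ℝ) (E₂ := Bundle.Trivial M ℝ)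
    (RingHom.id ℝ) x₀ ⟨x, φ⟩
  erw [this]
  change ContinuousLinearMap.inCoordinates V.F V.E ℝ (Trivial M ℝ) x₀ x x₀ x φ v = _
  change (trivializationAt ℝ (Trivial M ℝ) x₀).continuousLinearMapAt ℝ x
    (φ (V.coSymm x₀ x v)) = _
  simp

theorem coSymm_dual {x₀ x : M} (h : x ∈ V.base x₀) (φ : V.dual.F) (v : V.E x) :
    V.dual.coSymm x₀ x φ v = φ (V.co x₀ x v) := by
  have h' : x ∈ V.dual.base x₀ := by rw [base_dual]; exact h
  conv_rhs => rw [← co_coSymm h' φ]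
  rw [co_dual h, coSymm_co h]

instance (x : M) : FiniteDimensional ℝ (V.E x) :=
  ((trivializationAt V.F V.E x).continuousLinearEquivAt ℝ x
    (mem_baseSet_trivializationAt V.F V.E x)).symm.toLinearEquiv.finiteDimensional

instance (x : M) : T2Space (V.E x) :=
  ((trivializationAt V.F V.E x).continuousLinearEquivAt ℝ x
    (mem_baseSet_trivializationAt V.F V.E x)).toHomeomorph.isEmbedding.t2Space

/-- In finite dimension a linear map is the finite sum of its values on a basis times the coordinate
functionals. -/
theorem _root_.ContMDiffWithinAt.clm_of_apply {W F : Type*} [NormedAddCommGroup W] [NormedSpace ℝ W]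
    [FiniteDimensional ℝ W] [NormedAddCommGroup F] [NormedSpace ℝ F] {L : N → W →L[ℝ] F}
    {s : Set N} {y₀ : N} (h : ∀ w, ContMDiffWithinAt J 𝓘(ℝ, F) ∞ (fun y => L y w) s y₀) :
    ContMDiffWithinAt J 𝓘(ℝ, W →L[ℝ] F) ∞ L s y₀ := by
  have key : ∀ y, L y = ∑ i, ContinuousLinearMap.smulRightL ℝ W F
      (((Module.finBasis ℝ W).coord i).toContinuousLinearMap) (L y (Module.finBasis ℝ W i)) := by
    intro y
    ext w
    conv_lhs => rw [← (Module.finBasis ℝ W).sum_repr w]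
    simp [-Module.Basis.sum_repr]
  rw [funext key]
  refine ContMDiffWithinAt.sum fun i _ => ?_
  exact (ContinuousLinearMap.contMDiff _).contMDiffAt.comp_contMDiffWithinAt y₀ (h _)

/-- Smoothness of the evaluation of a functional on a vector. -/
theorem contMDiffWithinAt_dual_apply {Φ : N → V.dual.Tot} {u : N → V.Tot} {g : N → ℝ} {s : Set N}
    {y₀ : N} (hy₀ : y₀ ∈ s) (hΦ : ContMDiffWithinAt J V.dual.model ∞ Φ s y₀)
    (hu : ContMDiffWithinAt J V.model ∞ u s y₀)
    (hg : ∀ y ∈ s, ∃ (x : M) (φ : V.dual.E x) (v : V.E x), Φ y = ⟨x, φ⟩ ∧ u y = ⟨x, v⟩ ∧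
      g y = φ v) :
    ContMDiffWithinAt J 𝓘(ℝ, ℝ) ∞ g s y₀ := by
  have hb : (u y₀).proj ∈ V.base (u y₀).proj := V.mem_base _
  have hb' : (Φ y₀).proj ∈ V.dual.base (u y₀).proj := by
    obtain ⟨x, φ, v, h₁, h₂, -⟩ := hg y₀ hy₀
    rw [base_dual, h₁, h₂]; exact V.mem_base _
  obtain ⟨hu₁, hu₂⟩ := (contMDiffWithinAt_iff_co hb).1 hu
  obtain ⟨-, hΦ₂⟩ := (contMDiffWithinAt_iff_co hb').1 hΦ
  have hev : ∀ᶠ y in 𝓝[s] y₀, (u y).proj ∈ V.base (u y₀).proj :=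
    hu₁.continuousWithinAt.eventually_mem
      ((trivializationAt V.F V.E _).open_baseSet.mem_nhds hb)
  refine (hΦ₂.clm_apply hu₂).congr_of_eventuallyEq_of_mem ?_ hy₀
  filter_upwards [hev, self_mem_nhdsWithin] with y hy hys
  obtain ⟨x, φ, v, h₁, h₂, h₃⟩ := hg y hys
  rw [h₁, h₂, h₃]
  rw [h₂] at hy
  change _ = V.dual.co _ x φ (V.co _ x v)
  rw [co_dual hy, coSymm_co hy]

/-- A family of functionals is smooth when its values on a smooth frame are. -/
theorem contMDiffWithinAt_dual_of_frame {W : Type*} [NormedAddCommGroup W] [NormedSpace ℝ W]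
    [FiniteDimensional ℝ W] {Φ : N → V.dual.Tot} {s : Set N} {y₀ : N} (hy₀ : y₀ ∈ s)
    (hp : ContMDiffWithinAt J I ∞ (fun y => (Φ y).proj) s y₀)
    (Θ : ∀ y, W →ₗ[ℝ] V.E (Φ y).proj) (hΘ₀ : Function.Bijective (Θ y₀))
    (hΘ : ∀ w, ContMDiffWithinAt J V.model ∞ (fun y => (⟨(Φ y).proj, Θ y w⟩ : V.Tot)) s y₀)
    (hΦ : ∀ w, ContMDiffWithinAt J 𝓘(ℝ, ℝ) ∞ (fun y => (Φ y).snd (Θ y w)) s y₀) :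
    ContMDiffWithinAt J V.dual.model ∞ Φ s y₀ := by
  set x₀ := (Φ y₀).proj with hx₀
  have hb : (Φ y₀).proj ∈ V.base x₀ := V.mem_base _
  refine (contMDiffWithinAt_iff_co (x₀ := x₀) (by rw [base_dual]; exact hb)).2 ⟨hp, ?_⟩
  -- In coordinates `τ` is the frame and `lam` the values of the functional on it, so the functional
  -- is `lam ∘ τ⁻¹`. Bijectivity at `y₀` suffices, since invertibility is an open condition and
  -- inversion is smooth.
  set τ : N → W →L[ℝ] V.F := fun y =>
    (V.co x₀ (Φ y).proj).comp (Θ y).toContinuousLinearMap with hτ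
  set lam : N → W →L[ℝ] ℝ := fun y => ((Φ y).snd.toLinearMap.comp (Θ y)).toContinuousLinearMap
  have hτs : ContMDiffWithinAt J 𝓘(ℝ, W →L[ℝ] V.F) ∞ τ s y₀ :=
    ContMDiffWithinAt.clm_of_apply fun w => ((contMDiffWithinAt_iff_co hb).1 (hΘ w)).2
  have hlam : ContMDiffWithinAt J 𝓘(ℝ, W →L[ℝ] ℝ) ∞ lam s y₀ :=
    ContMDiffWithinAt.clm_of_apply hΦ
  have hbij : Function.Bijective (τ y₀) := by
    have : Function.Bijective (V.co x₀ (Φ y₀).proj) :=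
      ⟨(Function.LeftInverse.injective (coSymm_co hb)),
        (Function.RightInverse.surjective (co_coSymm hb))⟩
    exact this.comp hΘ₀
  obtain ⟨E, hE⟩ : ∃ E : W ≃L[ℝ] V.F, (E : W →L[ℝ] V.F) = τ y₀ :=
    ⟨(LinearEquiv.ofBijective (τ y₀).toLinearMap hbij).toContinuousLinearEquiv, by ext; rfl⟩
  have hinv : ContMDiffWithinAt J 𝓘(ℝ, V.F →L[ℝ] W) ∞
      (fun y => ContinuousLinearMap.inverse (τ y)) s y₀ := by
    have h1 : ContMDiffAt 𝓘(ℝ, W →L[ℝ] V.F) 𝓘(ℝ, V.F →L[ℝ] W) ∞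
        ContinuousLinearMap.inverse (τ y₀) := by
      rw [← hE]
      have := FiniteDimensional.complete ℝ W
      exact (contDiffAt_map_inverse E).contMDiffAt
    exact h1.comp_contMDiffWithinAt y₀ hτs
  have hinvertible : ∀ᶠ y in 𝓝[s] y₀, ∃ E : W ≃L[ℝ] V.F, (E : W →L[ℝ] V.F) = τ y := by
    have := FiniteDimensional.complete ℝ W
    have h2 : ∀ᶠ T in 𝓝 (τ y₀), ∃ E : W ≃L[ℝ] V.F, (E : W →L[ℝ] V.F) = T := by
      rw [← hE]
      exact ContinuousLinearEquiv.nhds E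
    exact hτs.continuousWithinAt.eventually h2
  have hev : ∀ᶠ y in 𝓝[s] y₀, (Φ y).proj ∈ V.base x₀ :=
    hp.continuousWithinAt.eventually_mem
      ((trivializationAt V.F V.E _).open_baseSet.mem_nhds hb)
  refine (hlam.clm_comp hinv).congr_of_eventuallyEq_of_mem ?_ hy₀
  filter_upwards [hev, hinvertible] with y hy hE'
  obtain ⟨E', hE'⟩ := hE'
  rw [← hE', ContinuousLinearMap.inverse_equiv]
  refine ContinuousLinearMap.ext fun v => ?_
  rw [co_dual hy]
  change _ = (Φ y).snd (Θ y (E'.symm v))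
  congr 1
  have h3 : V.co x₀ (Φ y).proj (Θ y (E'.symm v)) = v := by
    have : τ y (E'.symm v) = v := by rw [← hE']; simp
    exact this
  rw [← h3, coSymm_co hy, h3]

theorem contMDiffWithinAt_frame_apply {W : Type*} [NormedAddCommGroup W] [NormedSpace ℝ W]
    [FiniteDimensional ℝ W] {b : N → M} {w : N → W} {s : Set N} {y₀ : N}
    (hb : ContMDiffWithinAt J I ∞ b s y₀) (hw : ContMDiffWithinAt J 𝓘(ℝ, W) ∞ w s y₀)
    (Θ : ∀ y, W →ₗ[ℝ] V.E (b y))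
    (hΘ : ∀ w, ContMDiffWithinAt J V.model ∞ (fun y => (⟨b y, Θ y w⟩ : V.Tot)) s y₀) :
    ContMDiffWithinAt J V.model ∞ (fun y => (⟨b y, Θ y (w y)⟩ : V.Tot)) s y₀ := by
  refine (contMDiffWithinAt_iff_co (x₀ := b y₀) (V.mem_base _)).2 ⟨hb, ?_⟩
  have hτ : ContMDiffWithinAt J 𝓘(ℝ, W →L[ℝ] V.F) ∞
      (fun y => (V.co (b y₀) (b y)).comp (Θ y).toContinuousLinearMap) s y₀ :=
    ContMDiffWithinAt.clm_of_apply fun w =>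
      ((contMDiffWithinAt_iff_co (x₀ := b y₀) (V.mem_base _)).1 (hΘ w)).2
  exact hτ.clm_apply hw

theorem coSymm_bijective {x₀ x : M} (h : x ∈ V.base x₀) : Function.Bijective (V.coSymm x₀ x) :=
  ⟨Function.LeftInverse.injective (co_coSymm h), Function.RightInverse.surjective (coSymm_co h)⟩

theorem contMDiffWithinAt_coSymm {b : N → M} {s : Set N} {y₀ : N} {x₀ : M} (v : V.F)
    (h : b y₀ ∈ V.base x₀) (hb : ContMDiffWithinAt J I ∞ b s y₀) :
    ContMDiffWithinAt J V.model ∞ (fun y => (⟨b y, V.coSymm x₀ (b y) v⟩ : V.Tot)) s y₀ := by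
  refine (contMDiffWithinAt_iff_co h).2 ⟨hb, ?_⟩
  have hev : ∀ᶠ y in 𝓝[s] y₀, b y ∈ V.base x₀ :=
    hb.continuousWithinAt.eventually_mem
      ((trivializationAt V.F V.E _).open_baseSet.mem_nhds h)
  exact (contMDiffWithinAt_const (c := v)).congr_of_eventuallyEq
    (hev.mono fun y hy => co_coSymm hy v) (co_coSymm h v)

theorem ext_dual {x : M} {v w : V.E x} (h : ∀ φ : V.dual.E x, φ v = φ w) : v = w :=
  (Module.evalEquiv ℝ (V.E x)).injective <| LinearMap.ext fun f =>
    h (LinearMap.toContinuousLinearMap (F' := ℝ) f)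

theorem exists_dual_apply_eq {x : M} (f : V.dual.E x →ₗ[ℝ] ℝ) :
    ∃ v : V.E x, ∀ φ : V.dual.E x, φ v = f φ := by
  let c : (V.E x →ₗ[ℝ] ℝ) →ₗ[ℝ] V.dual.E x :=
    (LinearMap.toContinuousLinearMap (𝕜 := ℝ) (E := V.E x) (F' := ℝ)).toLinearMap
  refine ⟨(Module.evalEquiv ℝ (V.E x)).symm (f ∘ₗ c), fun φ => ?_⟩
  exact Module.apply_evalEquiv_symm_apply ℝ (V.E x) φ.toLinearMap (f ∘ₗ c)

theorem ev_bijective (x : M) : Function.Bijective (V.ev (m := x)) := by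
  refine ⟨fun v w h => ext_dual fun φ => DFunLike.congr_fun h φ, fun Ψ => ?_⟩
  obtain ⟨v, hv⟩ := exists_dual_apply_eq (V := V) (x := x) Ψ.toLinearMap
  exact ⟨v, ContinuousLinearMap.ext hv⟩

/-- Tested on the local frame of the dual bundle, where the value of `ev v` is the evaluation of a
smooth functional at `v`. -/
theorem contMDiff_ev :
    ContMDiff V.model V.dual.dual.model ∞ (fun v : V.Tot => (⟨v.proj, V.ev v.snd⟩ : V.dual.dual.Tot)) := by
  intro v₀
  have hp : ContMDiffAt V.model I ∞ (fun v : V.Tot => v.proj) v₀ := contMDiffAt_proj V.E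
  have hb : v₀.proj ∈ V.dual.base v₀.proj := V.dual.mem_base _
  refine contMDiffWithinAt_dual_of_frame (V := V.dual) (W := V.dual.F) (Set.mem_univ _) hp
    (fun v => (V.dual.coSymm v₀.proj v.proj).toLinearMap) (coSymm_bijective hb)
    (fun w => contMDiffWithinAt_coSymm w hb hp) fun w => ?_
  refine contMDiffWithinAt_dual_apply (V := V)
    (Φ := fun v : V.Tot => ⟨v.proj, V.dual.coSymm v₀.proj v.proj w⟩) (u := fun v => v)
    (Set.mem_univ _) (contMDiffWithinAt_coSymm w hb hp) contMDiffWithinAt_id fun v _ => ?_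
  exact ⟨v.proj, _, v.snd, rfl, rfl, rfl⟩

theorem contMDiffWithinAt_of_dual_apply {F : Type*} [NormedAddCommGroup F] [NormedSpace ℝ F]
    [FiniteDimensional ℝ F] {f : N → F} {s : Set N} {y₀ : N}
    (h : ∀ φ : F →L[ℝ] ℝ, ContMDiffWithinAt J 𝓘(ℝ, ℝ) ∞ (fun y => φ (f y)) s y₀) :
    ContMDiffWithinAt J 𝓘(ℝ, F) ∞ f s y₀ := by
  have key : ∀ y, f y = ∑ i, ((Module.finBasis ℝ F).coord i).toContinuousLinearMap (f y) •
      Module.finBasis ℝ F i := fun y => ((Module.finBasis ℝ F).sum_repr (f y)).symm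
  rw [funext key]
  exact ContMDiffWithinAt.sum fun i _ => (h _).smul contMDiffWithinAt_const

/-- A map into the total space is smooth when its pairings with a smooth dual frame are. -/
theorem contMDiffWithinAt_of_coSymm_dual_apply {f : N → V.Tot} {s : Set N} {y₀ : N} {x₀ : M}
    (h : (f y₀).proj ∈ V.base x₀)
    (hp : ContMDiffWithinAt J I ∞ (fun y => (f y).proj) s y₀)
    (hf : ∀ φ : V.dual.F, ContMDiffWithinAt J 𝓘(ℝ, ℝ) ∞
      (fun y => V.dual.coSymm x₀ (f y).proj φ (f y).snd) s y₀) :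
    ContMDiffWithinAt J V.model ∞ f s y₀ := by
  refine (contMDiffWithinAt_iff_co h).2 ⟨hp, contMDiffWithinAt_of_dual_apply fun φ => ?_⟩
  have hev : ∀ᶠ y in 𝓝[s] y₀, (f y).proj ∈ V.base x₀ :=
    hp.continuousWithinAt.eventually_mem
      ((trivializationAt V.F V.E _).open_baseSet.mem_nhds h)
  exact (hf φ).congr_of_eventuallyEq (hev.mono fun y hy => (coSymm_dual hy φ _).symm)
    (coSymm_dual h φ _).symm

/-- The canonical map to the bidual is a diffeomorphism. -/
theorem exists_diffeomorph_ev :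
    ∃ φ : V.Tot ≃ₘ^∞⟮V.model, V.dual.dual.model⟯ V.dual.dual.Tot,
      ∀ v : V.Tot, φ v = ⟨v.proj, V.ev v.snd⟩ := by
  let e : ∀ x, V.E x ≃ V.dual.dual.E x := fun x => Equiv.ofBijective _ (V.ev_bijective x)
  have he : ∀ {x : M} (Ψ : V.dual.dual.E x) (φ : V.dual.E x), φ ((e x).symm Ψ) = Ψ φ :=
    fun {x} Ψ φ => DFunLike.congr_fun ((e x).apply_symm_apply Ψ) φ
  refine ⟨⟨⟨fun v => ⟨v.proj, V.ev v.snd⟩, fun Ψ => ⟨Ψ.proj, (e _).symm Ψ.snd⟩,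
    fun v => ?_, fun Ψ => ?_⟩, contMDiff_ev, fun Ψ₀ => ?_⟩, fun v => rfl⟩
  · exact congrArg (TotalSpace.mk v.proj) ((e v.proj).symm_apply_apply v.snd)
  · exact congrArg (TotalSpace.mk Ψ.proj) ((e Ψ.proj).apply_symm_apply Ψ.snd)
  -- The inverse is smooth because pairing it with a dual frame vector `φ` gives back `Ψ φ`.
  · have hp : ContMDiffAt V.dual.dual.model I ∞ (fun Ψ : V.dual.dual.Tot => Ψ.proj) Ψ₀ :=
      contMDiffAt_proj V.dual.dual.E
    refine contMDiffWithinAt_of_coSymm_dual_apply (V := V) (x₀ := Ψ₀.proj) (V.mem_base _) hp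
      fun φ => ?_
    refine contMDiffWithinAt_dual_apply (V := V.dual) (Φ := fun Ψ => Ψ)
      (u := fun Ψ => ⟨Ψ.proj, V.dual.coSymm Ψ₀.proj Ψ.proj φ⟩) (Set.mem_univ _)
      contMDiffWithinAt_id (contMDiffWithinAt_coSymm φ (V.dual.mem_base _) hp) fun Ψ _ => ?_
    exact ⟨Ψ.proj, Ψ.snd, _, rfl, rfl, he _ _⟩

theorem ev_add {x : M} (v w : V.E x) : V.ev (v + w) = V.ev v + V.ev w :=
  ContinuousLinearMap.ext fun φ => φ.map_add v w

theorem ev_smul {x : M} (r : ℝ) (v : V.E x) : V.ev (r • v) = r • V.ev v :=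
  ContinuousLinearMap.ext fun φ => φ.map_smul r v

end SmoothVB

/-! ### The fibres of `D → B` and the translates of the core -/

namespace DVB

open Filter Topology

variable {EM : Type*} [NormedAddCommGroup EM] [NormedSpace ℝ EM]
    {HM : Type*} [TopologicalSpace HM] {I : ModelWithCorners ℝ EM HM}
    {M : Type*} [TopologicalSpace M] [ChartedSpace HM M]
    {A B K : SmoothVB I M} {D : SmoothVB A.model A.Tot}

/-- Linear coordinates on the fibre of `D → B` over `b`. -/
structure CoordB (S : DVB A B K D) {m : M} (b : B.E m) where
  dim : ℕ
  co : ∀ {a : A.E m}, D.E ⟨m, a⟩ → EuclideanSpace ℝ (Fin dim)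
  inj : ∀ {a : A.E m} {d d' : D.E ⟨m, a⟩}, S.prB d = b → S.prB d' = b → co d = co d' → d = d'
  zero : co (S.zeroB b) = 0
  add : ∀ {a a' : A.E m} (d : D.E ⟨m, a⟩) (d' : D.E ⟨m, a'⟩) (h : S.prB d = S.prB d'),
    S.prB d = b → co (S.addB d d' h) = co d + co d'
  smul : ∀ {a : A.E m} (r : ℝ) (d : D.E ⟨m, a⟩), S.prB d = b → co (S.smulB r d) = r • co d
  cont : ∀ {a : A.E m} (f : ℝ → D.E ⟨m, a⟩), Continuous f → (∀ t, S.prB (f t) = b) →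
    Continuous fun t => co (f t)

theorem totalSpace_fiber_continuous {m : M} (a : A.E m) :
    Continuous fun d : D.E ⟨m, a⟩ => (⟨⟨m, a⟩, d⟩ : D.Tot) :=
  FiberBundle.continuous_totalSpaceMk D.F D.E ⟨m, a⟩

variable (S : DVB A B K D)

/-- A trivialization restricted to one fibre. Elements of `D` over different points of `A`, such as
`a + 0` and `a`, become vectors of one space, so identities for `+_B` can be checked without
transport between fibres. -/
theorem nonempty_coordB {m : M} (b : B.E m) : Nonempty (S.CoordB b) := by
  obtain ⟨k, e, hb, hs, -, h0, hadd, hsmul⟩ := S.locTriv ⟨m, b⟩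
  refine ⟨⟨k, fun {a} d => (e ⟨⟨m, a⟩, d⟩).2, ?_, h0 b hb, ?_, ?_, ?_⟩⟩
  · intro a d d' h h' hd
    have h1 : ∀ x : D.E ⟨m, a⟩, S.prB x = b → (⟨⟨m, a⟩, x⟩ : D.Tot) ∈ e.source := fun x hx => by
      rw [e.mem_source]; change (⟨m, S.prB x⟩ : B.Tot) ∈ _; rw [hx]; exact hb
    have h2 : e ⟨⟨m, a⟩, d⟩ = e ⟨⟨m, a⟩, d'⟩ := by
      refine Prod.ext ?_ hd
      rw [e.coe_fst (h1 d h), e.coe_fst (h1 d' h')]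
      change (⟨m, S.prB d⟩ : B.Tot) = ⟨m, S.prB d'⟩
      rw [h, h']
    exact TotalSpace.mk_inj.1 (e.toOpenPartialHomeomorph.injOn (h1 d h) (h1 d' h') h2)
  · intro a a' d d' h hd
    exact hadd d d' h (by rw [hd]; exact hb)
  · intro a r d hd
    exact hsmul r d (by rw [hd]; exact hb)
  · intro a f hf hfb
    have h1 : ∀ t, (⟨⟨m, a⟩, f t⟩ : D.Tot) ∈ e.source := fun t => by
      rw [e.mem_source]; change (⟨m, S.prB (f t)⟩ : B.Tot) ∈ _; rw [hfb]; exact hb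
    exact continuous_snd.comp
      (hs.continuousOn.comp_continuous ((totalSpace_fiber_continuous a).comp hf) h1)

variable {S}

theorem addB_congr {m : M} {a a' : A.E m} {d₁ d₂ : D.E ⟨m, a⟩} {d₁' d₂' : D.E ⟨m, a'⟩}
    (hd : d₁ = d₂) (hd' : d₁' = d₂') (h₁ : S.prB d₁ = S.prB d₁') (h₂ : S.prB d₂ = S.prB d₂') :
    S.addB d₁ d₁' h₁ = S.addB d₂ d₂' h₂ := by
  subst hd hd'; rfl

/-- The case of scalar `0` in `addB_smul`. -/
theorem addB_zero {m : M} {a a' : A.E m} (h : S.prB (0 : D.E ⟨m, a⟩) = S.prB (0 : D.E ⟨m, a'⟩)) :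
    S.addB (0 : D.E ⟨m, a⟩) (0 : D.E ⟨m, a'⟩) h = 0 := by
  have := S.addB_smul 0 (0 : D.E ⟨m, a⟩) (0 : D.E ⟨m, a'⟩) h
  exact (addB_congr (zero_smul ℝ _).symm (zero_smul ℝ _).symm h _).trans
    (this.trans (zero_smul ℝ _))

theorem smulB_zero {m : M} {a : A.E m} (r : ℝ) : S.smulB r (0 : D.E ⟨m, a⟩) = 0 := by
  have := S.smulB_smul r 0 (0 : D.E ⟨m, a⟩)
  rwa [zero_smul, zero_smul] at this

namespace CoordB

variable {m : M} {b : B.E m} (ε : S.CoordB b)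

theorem co_cast {a a' : A.E m} (h : a = a') (hc : D.E ⟨m, a⟩ = D.E ⟨m, a'⟩) (d : D.E ⟨m, a⟩) :
    ε.co (cast hc d) = ε.co d := by
  subst h; rfl

theorem co_zero_zero (ε : S.CoordB (0 : B.E m)) : ε.co (0 : D.E ⟨m, 0⟩) = 0 := by
  have h : ∀ {a : A.E m}, a = 0 → ε.co (0 : D.E ⟨m, a⟩) = ε.co (0 : D.E ⟨m, 0⟩) := by
    rintro a rfl; rfl
  have h1 := ε.add (0 : D.E ⟨m, 0⟩) (0 : D.E ⟨m, 0⟩) rfl (map_zero _)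
  rw [addB_zero, h (add_zero _)] at h1
  simpa using h1

theorem co_coreA (ε : S.CoordB (0 : B.E m)) (a : A.E m) (γ : K.dual.E m) :
    ε.co (S.coreA a γ) = ε.co (0 : D.E ⟨m, a⟩) + ε.co (S.core γ) := by
  rw [coreA, ε.co_cast (add_zero a), ε.add _ _ _ (map_zero _)]

theorem co_zero_add (ε : S.CoordB (0 : B.E m)) (a a' : A.E m) :
    ε.co (0 : D.E ⟨m, a + a'⟩) = ε.co (0 : D.E ⟨m, a⟩) + ε.co (0 : D.E ⟨m, a'⟩) := by
  rw [← ε.add _ _ (by rw [map_zero, map_zero]) (map_zero _), addB_zero]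

theorem co_zero_smul (ε : S.CoordB (0 : B.E m)) (r : ℝ) (a : A.E m) :
    ε.co (0 : D.E ⟨m, r • a⟩) = r • ε.co (0 : D.E ⟨m, a⟩) := by
  rw [← ε.smul _ _ (map_zero _), smulB_zero]

/-- The Eckmann–Hilton argument: on the core, the interchange law applied to `(γ +_A 0) +_B (0 +_A
γ')` identifies the two additions. -/
theorem co_core_add (ε : S.CoordB (0 : B.E m)) (γ γ' : K.dual.E m) :
    ε.co (S.core (γ + γ')) = ε.co (S.core γ) + ε.co (S.core γ') := by
  have key : ∀ {a : A.E m} (_ : a = 0) (x y : D.E ⟨m, a⟩) (c c' : D.E ⟨m, 0⟩), S.prB x = 0 →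
      S.prB y = 0 → S.prB c = 0 → S.prB c' = 0 → ε.co x = ε.co c → ε.co y = ε.co c' →
      ε.co (x + y) = ε.co (c + c') := by
    rintro a rfl x y c c' h1 h2 h3 h4 h5 h6
    rw [ε.inj h1 h3 h5, ε.inj h2 h4 h6]
  have hc : S.prB (S.core γ) = S.prB (0 : D.E ⟨m, 0⟩) := by rw [S.prB_core, map_zero]
  have hc' : S.prB (0 : D.E ⟨m, 0⟩) = S.prB (S.core γ') := by rw [S.prB_core, map_zero]
  have h1 := S.addB_add (S.core γ) 0 0 (S.core γ') hc hc'
  have h2 := congrArg ε.co h1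
  rw [ε.add _ _ _ (by rw [add_zero, S.prB_core]), key (add_zero _) _ _ (S.core γ) (S.core γ')
    (by rw [S.prB_addB, S.prB_core]) (by rw [S.prB_addB, map_zero]) (S.prB_core _) (S.prB_core _)
    (by rw [ε.add _ _ _ (S.prB_core _), ε.co_zero_zero, add_zero])
    (by rw [ε.add _ _ _ (map_zero _), ε.co_zero_zero, zero_add]), add_zero, zero_add] at h2
  rw [map_add, h2]

/-- The two scalar multiplications on the core are compared by continuity: with the additions
identified, `t ↦ t • γ` read in coordinates over `B` is additive and continuous, hence real-linear.
-/
theorem co_core_smul (ε : S.CoordB (0 : B.E m)) (r : ℝ) (γ : K.dual.E m) :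
    ε.co (S.core (r • γ)) = r • ε.co (S.core γ) := by
  have hf : Continuous fun t : ℝ => ε.co (S.core (t • γ)) := by
    refine ε.cont (fun t => S.core (t • γ)) ?_ fun t => S.prB_core _
    simp_rw [map_smul]
    exact continuous_id.smul continuous_const
  let f : ℝ →+ EuclideanSpace ℝ (Fin ε.dim) :=
    { toFun := fun t => ε.co (S.core (t • γ))
      map_zero' := by rw [zero_smul, map_zero, ε.co_zero_zero]
      map_add' := fun s t => by rw [add_smul, ε.co_core_add] }
  have := map_real_smul f hf r 1
  simpa [f] using this

end CoordB

theorem prB_coreA {m : M} (a : A.E m) (γ : K.dual.E m) : S.prB (S.coreA a γ) = 0 := by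
  have key : ∀ {a a' : A.E m} (_ : a = a') (hc : D.E ⟨m, a⟩ = D.E ⟨m, a'⟩) (d : D.E ⟨m, a⟩),
      S.prB (cast hc d) = S.prB d := by
    rintro a _ rfl hc d; rfl
  rw [coreA, key (add_zero a), S.prB_addB, map_zero]

theorem coreA_zero {m : M} (γ : K.dual.E m) : S.coreA 0 γ = S.core γ := by
  obtain ⟨ε⟩ := S.nonempty_coordB (0 : B.E m)
  exact ε.inj (prB_coreA _ _) (S.prB_core _) (by rw [ε.co_coreA, ε.co_zero_zero, zero_add])

theorem addB_coreA {m : M} (a a' : A.E m) (γ γ' : K.dual.E m)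
    (h : S.prB (S.coreA a γ) = S.prB (S.coreA a' γ')) :
    S.addB (S.coreA a γ) (S.coreA a' γ') h = S.coreA (a + a') (γ + γ') := by
  obtain ⟨ε⟩ := S.nonempty_coordB (0 : B.E m)
  refine ε.inj (by rw [S.prB_addB, prB_coreA]) (prB_coreA _ _) ?_
  rw [ε.add _ _ _ (prB_coreA _ _), ε.co_coreA, ε.co_coreA, ε.co_coreA, ε.co_zero_add,
    ε.co_core_add]
  abel

theorem smulB_coreA {m : M} (a : A.E m) (r : ℝ) (γ : K.dual.E m) :
    S.smulB r (S.coreA a γ) = S.coreA (r • a) (r • γ) := by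
  obtain ⟨ε⟩ := S.nonempty_coordB (0 : B.E m)
  refine ε.inj (by rw [S.prB_smulB, prB_coreA]) (prB_coreA _ _) ?_
  rw [ε.smul _ _ (prB_coreA _ _), ε.co_coreA, ε.co_coreA, ε.co_zero_smul, ε.co_core_smul,
    smul_add]

theorem coreA_add {m : M} (a : A.E m) (γ γ' : K.dual.E m) :
    S.coreA a (γ + γ') = S.coreA a γ + S.coreA a γ' := by
  have key : ∀ {a a' : A.E m} (_ : a = a') (hc : D.E ⟨m, a⟩ = D.E ⟨m, a'⟩) (d d' : D.E ⟨m, a⟩),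
      cast hc (d + d') = cast hc d + cast hc d' := by
    rintro a _ rfl hc d d'; rfl
  unfold coreA
  rw [← key (add_zero a), ← S.addB_add]
  congr 2 <;> simp

theorem coreA_smul {m : M} (a : A.E m) (r : ℝ) (γ : K.dual.E m) :
    S.coreA a (r • γ) = r • S.coreA a γ := by
  have key : ∀ {a a' : A.E m} (_ : a = a') (hc : D.E ⟨m, a⟩ = D.E ⟨m, a'⟩) (d : D.E ⟨m, a⟩),
      cast hc (r • d) = r • cast hc d := by
    rintro a _ rfl hc d; rfl
  unfold coreA
  rw [← key (add_zero a), ← S.addB_smul]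
  congr 2 <;> simp

theorem coreA_injective {m : M} (a : A.E m) : Function.Injective (S.coreA (a := a)) := by
  obtain ⟨ε⟩ := S.nonempty_coordB (0 : B.E m)
  intro γ γ' h
  have := congrArg ε.co h
  rw [ε.co_coreA, ε.co_coreA] at this
  exact S.core_injective m (ε.inj (S.prB_core _) (S.prB_core _) (add_left_cancel this))

theorem exists_coreA_eq {m : M} {a : A.E m} (d : D.E ⟨m, a⟩) (h : S.prB d = 0) :
    ∃ γ, S.coreA a γ = d := by
  obtain ⟨ε⟩ := S.nonempty_coordB (0 : B.E m)
  have key : ∀ {a : A.E m} (_ : a = 0) (x : D.E ⟨m, a⟩), S.prB x = 0 →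
      ∃ γ, ε.co (S.core γ) = ε.co x := by
    rintro a rfl x hx
    have : x ∈ LinearMap.range (S.core (m := m)) := by rw [S.range_core]; exact hx
    obtain ⟨γ, rfl⟩ := this
    exact ⟨γ, rfl⟩
  -- Subtracting `0_a` with respect to `+_B` moves `d` to the zero of `A` and keeps it over the zero
  -- of `B`, so that a core element is left.
  have h0 : S.prB d = S.prB (S.smulB (-1) (0 : D.E ⟨m, a⟩)) := by rw [h, S.prB_smulB, map_zero]
  obtain ⟨γ, hγ⟩ := key (by rw [neg_smul, one_smul, add_neg_cancel]) (S.addB d _ h0)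
    (by rw [S.prB_addB, h])
  refine ⟨γ, ε.inj (prB_coreA _ _) h ?_⟩
  rw [ε.co_coreA, hγ, ε.add _ _ _ h, ε.smul _ _ (map_zero _)]
  simp

end DVB

/-! ### Linear splittings at a point, and the dual in their coordinates -/

namespace DVB

open Filter Topology

variable {EM : Type*} [NormedAddCommGroup EM] [NormedSpace ℝ EM]
    {HM : Type*} [TopologicalSpace HM] {I : ModelWithCorners ℝ EM HM}
    {M : Type*} [TopologicalSpace M] [ChartedSpace HM M]
    {A B K : SmoothVB I M} {D : SmoothVB A.model A.Tot}

/-- A linear splitting of a double vector bundle over the point `m`: a map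
`A_m × B_m → D` over the identity that is linear in both arguments. -/
structure Splitting (S : DVB A B K D) (m : M) where
  sec : ∀ a : A.E m, B.E m →ₗ[ℝ] D.E ⟨m, a⟩
  prB_sec : ∀ (a : A.E m) (b : B.E m), S.prB (sec a b) = b
  sec_add : ∀ (a a' : A.E m) (b : B.E m), sec (a + a') b =
    S.addB (sec a b) (sec a' b) ((prB_sec a b).trans (prB_sec a' b).symm)
  sec_smul : ∀ (r : ℝ) (a : A.E m) (b : B.E m), sec (r • a) b = S.smulB r (sec a b)

namespace Splitting

variable {S : DVB A B K D} {m : M} (σ : S.Splitting m)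

/-- The element of `D` over `a` and `b` with core component `γ` in the splitting `σ`. -/
def pt (a : A.E m) (b : B.E m) (γ : K.dual.E m) : D.E ⟨m, a⟩ := σ.sec a b + S.coreA a γ

theorem prB_pt (a : A.E m) (b : B.E m) (γ : K.dual.E m) : S.prB (σ.pt a b γ) = b := by
  rw [pt, map_add, σ.prB_sec, prB_coreA, add_zero]

theorem pt_add (a : A.E m) (b b' : B.E m) (γ γ' : K.dual.E m) :
    σ.pt a (b + b') (γ + γ') = σ.pt a b γ + σ.pt a b' γ' := by
  rw [pt, pt, pt, map_add, coreA_add]; abel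

theorem pt_smul (a : A.E m) (r : ℝ) (b : B.E m) (γ : K.dual.E m) :
    σ.pt a (r • b) (r • γ) = r • σ.pt a b γ := by
  rw [pt, pt, map_smul, coreA_smul, smul_add]

theorem addB_pt (a a' : A.E m) (b : B.E m) (γ γ' : K.dual.E m)
    (h : S.prB (σ.pt a b γ) = S.prB (σ.pt a' b γ')) :
    S.addB (σ.pt a b γ) (σ.pt a' b γ') h = σ.pt (a + a') b (γ + γ') := by
  unfold pt
  rw [σ.sec_add, ← addB_coreA _ _ _ _ (by rw [prB_coreA, prB_coreA]), ← S.addB_add]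

theorem smulB_pt (r : ℝ) (a : A.E m) (b : B.E m) (γ : K.dual.E m) :
    S.smulB r (σ.pt a b γ) = σ.pt (r • a) b (r • γ) := by
  rw [pt, pt, S.smulB_add, σ.sec_smul, smulB_coreA]

theorem pt_zero_right (a : A.E m) (γ : K.dual.E m) : σ.pt a 0 γ = S.coreA a γ := by
  rw [pt, map_zero, zero_add]

theorem pt_zero_core (a : A.E m) (b : B.E m) : σ.pt a b 0 = σ.sec a b := by
  have : S.coreA a (0 : K.dual.E m) = 0 := by
    simpa using coreA_smul (S := S) a 0 (0 : K.dual.E m)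
  rw [pt, this, add_zero]

theorem core_eq (γ : K.dual.E m) : S.core γ = σ.pt 0 0 γ := by
  rw [pt_zero_right, coreA_zero]

/-- The element `σ.pt 0 b 0` is its own double for `+_B`, so its coordinate in the fibre over `b`
vanishes. -/
theorem zeroB_eq (b : B.E m) : S.zeroB b = σ.pt 0 b 0 := by
  obtain ⟨ε⟩ := S.nonempty_coordB b
  refine ε.inj (S.prB_zeroB b) (σ.prB_pt _ _ _) ?_
  have h := ε.add (σ.pt 0 b 0) (σ.pt 0 b 0) rfl (σ.prB_pt _ _ _)
  have h' : ∀ a : A.E m, a = 0 → ε.co (σ.pt a b 0) = ε.co (σ.pt 0 b 0) := by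
    rintro a rfl; rfl
  rw [addB_pt, add_zero (0 : K.dual.E m), h' _ (add_zero _)] at h
  have h2 : ε.co (σ.pt 0 b 0) = 0 := by simpa using h
  rw [ε.zero, h2]

theorem coreB_eq (b : B.E m) (γ : K.dual.E m) : S.coreB b γ = σ.pt 0 b γ := by
  rw [coreB, σ.zeroB_eq, σ.core_eq, ← pt_add, add_zero, zero_add]

theorem pt_inj {a : A.E m} {b b' : B.E m} {γ γ' : K.dual.E m} (h : σ.pt a b γ = σ.pt a b' γ') :
    b = b' ∧ γ = γ' := by
  have h1 : b = b' := by rw [← σ.prB_pt a b γ, h, σ.prB_pt]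
  subst h1
  exact ⟨rfl, coreA_injective a (add_left_cancel h)⟩

theorem exists_pt {a : A.E m} (d : D.E ⟨m, a⟩) : ∃ γ, σ.pt a (S.prB d) γ = d := by
  obtain ⟨γ, hγ⟩ := exists_coreA_eq (S := S) (d - σ.sec a (S.prB d))
    (by rw [map_sub, σ.prB_sec, sub_self])
  exact ⟨γ, by rw [pt, hγ, add_sub_cancel]⟩

theorem exists_pt_of_prB {a : A.E m} {b : B.E m} (d : D.E ⟨m, a⟩) (h : S.prB d = b) :
    ∃ γ, d = σ.pt a b γ := by
  subst h
  obtain ⟨γ, h⟩ := σ.exists_pt d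
  exact ⟨γ, h.symm⟩

theorem exists_eq_pt {a : A.E m} (d : D.E ⟨m, a⟩) : ∃ b γ, d = σ.pt a b γ := by
  obtain ⟨γ, h⟩ := σ.exists_pt d
  exact ⟨_, γ, h.symm⟩

/-- The coordinates on `D_a` given by a splitting. -/
def ptEquiv (a : A.E m) : (B.E m × K.dual.E m) ≃ₗ[ℝ] D.E ⟨m, a⟩ :=
  LinearEquiv.ofBijective
    { toFun := fun p => σ.pt a p.1 p.2
      map_add' := fun p q => σ.pt_add a _ _ _ _
      map_smul' := fun r p => σ.pt_smul a r _ _ }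
    ⟨fun p q h => Prod.ext (σ.pt_inj h).1 (σ.pt_inj h).2, fun d => by
      obtain ⟨γ, h⟩ := σ.exists_pt d
      exact ⟨(S.prB d, γ), h⟩⟩

/-- The functional on `D_a` with components `κ` and `β` in the splitting `σ`. -/
def dpt (a : A.E m) (κ : K.E m) (β : B.dual.E m) : D.dual.E ⟨m, a⟩ :=
  LinearMap.toContinuousLinearMap (F' := ℝ)
    ((β.toLinearMap.coprod (K.ev κ).toLinearMap).comp (σ.ptEquiv a).symm.toLinearMap)

theorem dpt_pt (a : A.E m) (κ : K.E m) (β : B.dual.E m) (b : B.E m) (γ : K.dual.E m) :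
    σ.dpt a κ β (σ.pt a b γ) = β b + γ κ := by
  have h : (σ.ptEquiv a).symm (σ.pt a b γ) = (b, γ) :=
    (σ.ptEquiv a).symm_apply_apply (b, γ)
  change (β.toLinearMap.coprod (K.ev κ).toLinearMap) ((σ.ptEquiv a).symm (σ.pt a b γ)) = _
  rw [h]
  rfl

theorem dual_ext {a : A.E m} {Φ Ψ : D.dual.E ⟨m, a⟩}
    (h : ∀ b γ, Φ (σ.pt a b γ) = Ψ (σ.pt a b γ)) : Φ = Ψ := by
  refine ContinuousLinearMap.ext fun d => ?_
  obtain ⟨γ, hγ⟩ := σ.exists_pt d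
  rw [← hγ, h]

theorem exists_dpt {a : A.E m} (Φ : D.dual.E ⟨m, a⟩) : ∃ κ β, Φ = σ.dpt a κ β := by
  obtain ⟨κ, hκ⟩ := SmoothVB.exists_dual_apply_eq (V := K) (x := m)
    { toFun := fun γ => Φ (S.coreA a γ)
      map_add' := fun γ γ' => by rw [coreA_add, map_add]
      map_smul' := fun r γ => by rw [coreA_smul, map_smul]; rfl }
  refine ⟨κ, LinearMap.toContinuousLinearMap (F' := ℝ) (Φ.toLinearMap.comp (σ.sec a)), ?_⟩
  refine σ.dual_ext fun b γ => ?_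
  rw [dpt_pt, hκ, pt, map_add]
  rfl

theorem dpt_add (a : A.E m) (κ κ' : K.E m) (β β' : B.dual.E m) :
    σ.dpt a (κ + κ') (β + β') = σ.dpt a κ β + σ.dpt a κ' β' := by
  refine σ.dual_ext fun b γ => ?_
  rw [add_apply, dpt_pt, dpt_pt, dpt_pt, map_add, add_apply]
  abel

theorem dpt_smul (a : A.E m) (r : ℝ) (κ : K.E m) (β : B.dual.E m) :
    σ.dpt a (r • κ) (r • β) = r • σ.dpt a κ β := by
  refine σ.dual_ext fun b γ => ?_
  rw [smul_apply, dpt_pt, dpt_pt, map_smul, smul_apply, smul_add]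

theorem dpt_inj {a : A.E m} {κ κ' : K.E m} {β β' : B.dual.E m} (h : σ.dpt a κ β = σ.dpt a κ' β') :
    κ = κ' ∧ β = β' := by
  have h' : ∀ (b : B.E m) (γ : K.dual.E m), β b + γ κ = β' b + γ κ' := fun b γ => by
    rw [← σ.dpt_pt a, h, dpt_pt]
  refine ⟨SmoothVB.ext_dual fun γ => ?_, ContinuousLinearMap.ext fun b => ?_⟩
  · simpa using h' 0 γ
  · simpa using h' b 0

section Dual

variable {T : DVB A K B D.dual}

theorem prB_dpt (hT : S.IsDual T) (a : A.E m) (κ : K.E m) (β : B.dual.E m) : T.prB (σ.dpt a κ β) = κ := by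
  refine SmoothVB.ext_dual fun γ => ?_
  rw [hT.proj, ← σ.pt_zero_right, dpt_pt, map_zero, zero_add]

theorem addB_dpt (hT : S.IsDual T) (a a' : A.E m) (κ : K.E m) (β β' : B.dual.E m)
    (h : T.prB (σ.dpt a κ β) = T.prB (σ.dpt a' κ β')) :
    T.addB (σ.dpt a κ β) (σ.dpt a' κ β') h = σ.dpt (a + a') κ (β + β') := by
  refine σ.dual_ext fun b γ => ?_
  have hp : S.prB (σ.pt a b γ) = S.prB (σ.pt a' b 0) := by rw [prB_pt, prB_pt]
  have h1 : σ.pt (a + a') b γ = S.addB (σ.pt a b γ) (σ.pt a' b 0) hp := by rw [addB_pt, add_zero]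
  rw [dpt_pt, h1, hT.add, dpt_pt, dpt_pt, add_apply, zero_apply]
  abel

theorem smulB_dpt (hT : S.IsDual T) (r : ℝ) (a : A.E m) (κ : K.E m) (β : B.dual.E m) :
    T.smulB r (σ.dpt a κ β) = σ.dpt (r • a) κ (r • β) := by
  refine σ.dual_ext fun b γ => ?_
  -- For `r = 0` not every element over `r • a` is of the form `r ·_B d`. The core part is therefore
  -- split off and evaluated through the projection to `K`.
  have h1 : σ.pt (r • a) b γ = S.smulB r (σ.pt a b 0) + S.coreA (r • a) γ := by
    rw [smulB_pt, ← pt_zero_right, ← pt_add, add_zero, smul_zero, zero_add]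
  rw [dpt_pt, h1, map_add, hT.smul, ← hT.proj, T.prB_smulB, σ.prB_dpt hT, dpt_pt]
  simp

theorem core_dual_eq (hT : S.IsDual T) (β : B.dual.E m) : T.core β = σ.dpt 0 0 β := by
  refine σ.dual_ext fun b γ => ?_
  rw [hT.core, dpt_pt, prB_pt, map_zero, add_zero]

/-- The splitting of the dual double vector bundle defined by a splitting. -/
def dual (hT : S.IsDual T) : T.Splitting m where
  sec a :=
    { toFun := fun κ => σ.dpt a κ 0
      map_add' := fun κ κ' => by rw [← dpt_add, add_zero]
      map_smul' := fun r κ => by rw [RingHom.id_apply, ← dpt_smul, smul_zero] }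
  prB_sec a κ := σ.prB_dpt hT a κ 0
  sec_add a a' κ := by
    refine (?_ : _ = T.addB (σ.dpt a κ 0) (σ.dpt a' κ 0) _)
    rw [σ.addB_dpt hT]
    exact congrArg (σ.dpt (a + a') κ) (add_zero 0).symm
  sec_smul r a κ := by
    refine (?_ : _ = T.smulB r (σ.dpt a κ 0))
    rw [σ.smulB_dpt hT]
    exact congrArg (σ.dpt (r • a) κ) (smul_zero r).symm

theorem coreA_dual_eq (hT : S.IsDual T) (a : A.E m) (β : B.dual.E m) :
    T.coreA a β = σ.dpt a 0 β := by
  have key : ∀ {a a' : A.E m} (_ : a = a') (hc : D.dual.E ⟨m, a⟩ = D.dual.E ⟨m, a'⟩)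
      (κ : K.E m) (β : B.dual.E m), cast hc (σ.dpt a κ β) = σ.dpt a' κ β := by
    rintro a _ rfl hc κ β; rfl
  have h0 : (0 : D.dual.E ⟨m, a⟩) = σ.dpt a 0 0 := σ.dual_ext fun b γ => by
    rw [dpt_pt, map_zero]; simp
  have h1 : T.addB (0 : D.dual.E ⟨m, a⟩) (T.core β) (by rw [map_zero, T.prB_core]) =
      σ.dpt (a + 0) 0 β :=
    (addB_congr h0 (σ.core_dual_eq hT β) _ (by rw [σ.prB_dpt hT, σ.prB_dpt hT])).trans
      (by rw [σ.addB_dpt hT, zero_add])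
  rw [coreA, h1, key (add_zero a)]

theorem dual_pt (hT : S.IsDual T) (a : A.E m) (κ : K.E m) (β : B.dual.E m) :
    (σ.dual hT).pt a κ β = σ.dpt a κ β := by
  have : (σ.dual hT).pt a κ β = σ.dpt a κ 0 + T.coreA a β := rfl
  rw [this, σ.coreA_dual_eq hT, ← dpt_add, add_zero, zero_add]

/-- The pairing `β b + γ κ` treats `(b, γ)` and `(κ, β)` alike, so dualizing a splitting twice
restores the original coordinates. -/
theorem ev_pt (hT : S.IsDual T) (a : A.E m) (b : B.E m) (γ : K.dual.E m) :
    D.ev (σ.pt a b γ) = (σ.dual hT).dpt a b γ := by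
  refine (σ.dual hT).dual_ext fun κ β => ?_
  rw [dpt_pt, dual_pt]
  refine (σ.dpt_pt a κ β b γ).trans ?_
  rw [add_comm]

end Dual

end Splitting

/-- The dual double vector bundle is determined by its defining properties. -/
theorem IsDual.unique {S : DVB A B K D} (σ : ∀ m, S.Splitting m) {T T' : DVB A K B D.dual}
    (hT : S.IsDual T) (hT' : S.IsDual T') : T = T' := by
  have h1 : @T.prB = @T'.prB := by
    funext m a
    refine LinearMap.ext fun Φ => ?_
    obtain ⟨κ, β, rfl⟩ := (σ m).exists_dpt Φ
    rw [(σ m).prB_dpt hT, (σ m).prB_dpt hT']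
  have h2 : @T.zeroB = @T'.zeroB := by
    funext m κ
    rw [((σ m).dual hT).zeroB_eq, ((σ m).dual hT').zeroB_eq, (σ m).dual_pt, (σ m).dual_pt]
  -- The domain of `addB` is cut out by the projection, so the two additions are compared with
  -- separate proofs until the projections have been identified.
  have h3 : ∀ {m : M} {a a' : A.E m} (d : D.dual.E ⟨m, a⟩) (d' : D.dual.E ⟨m, a'⟩) (h h'),
      T.addB d d' h = T'.addB d d' h' := by
    intro m a a' Φ Φ' h h'
    obtain ⟨κ, β, rfl⟩ := (σ m).exists_dpt Φ
    obtain ⟨κ', β', rfl⟩ := (σ m).exists_dpt Φ'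
    have hκ : κ = κ' := by rwa [(σ m).prB_dpt hT, (σ m).prB_dpt hT] at h
    subst hκ
    rw [(σ m).addB_dpt hT, (σ m).addB_dpt hT']
  have h4 : @T.smulB = @T'.smulB := by
    funext m a r Φ
    obtain ⟨κ, β, rfl⟩ := (σ m).exists_dpt Φ
    rw [(σ m).smulB_dpt hT, (σ m).smulB_dpt hT']
  have h5 : @T.core = @T'.core := by
    funext m
    refine LinearMap.ext fun β => ?_
    rw [(σ m).core_dual_eq hT, (σ m).core_dual_eq hT']
  cases T
  cases T'
  dsimp only at h1 h2 h3 h4 h5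
  subst h1 h2 h4 h5
  congr 1
  funext m a a' d d' h
  exact h3 d d' h h

end DVB

/-! ### Vertical derivatives as rescaled limits -/

namespace SmoothVB

open Filter Topology

variable {EM : Type*} [NormedAddCommGroup EM] [NormedSpace ℝ EM]
    {HM : Type*} [TopologicalSpace HM] {I : ModelWithCorners ℝ EM HM}
    {M : Type*} [TopologicalSpace M] [ChartedSpace HM M]
    {EN : Type*} [NormedAddCommGroup EN] [NormedSpace ℝ EN]
    {HN : Type*} [TopologicalSpace HN] {J : ModelWithCorners ℝ EN HN}
    {N : Type*} [TopologicalSpace N] [ChartedSpace HN N]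
    {V : SmoothVB I M}

/-- Fibrewise scalar multiplication on the total space. -/
def smulTot (V : SmoothVB I M) (r : ℝ) (x : V.Tot) : V.Tot := ⟨x.proj, r • x.snd⟩

/-- The rescaled limit at a zero vector of a curve in the total space is its vertical derivative. -/
theorem tendsto_smulTot_inv_iff {γ : ℝ → V.Tot} {x x₀ : M} {c : V.F} (hx : x ∈ V.base x₀)
    (h0 : γ 0 = ⟨x, 0⟩) (hp : ContinuousAt (fun s => (γ s).proj) 0)
    (hd : HasDerivAt (fun s => V.co x₀ (γ s).proj (γ s).snd) c 0) (w : V.E x) :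
    Tendsto (fun s => V.smulTot s⁻¹ (γ s)) (𝓝[≠] 0) (𝓝 ⟨x, w⟩) ↔ V.co x₀ x w = c := by
  have hw : (⟨x, w⟩ : V.Tot) ∈ (trivializationAt V.F V.E x₀).source := by
    rw [Trivialization.mem_source]; exact hx
  have hp' : Tendsto (fun s => (γ s).proj) (𝓝[≠] 0) (𝓝 x) := by
    have := hp.tendsto
    rw [h0] at this
    exact this.mono_left nhdsWithin_le_nhds
  have hlim : Tendsto (fun s => (trivializationAt V.F V.E x₀ (V.smulTot s⁻¹ (γ s))).2) (𝓝[≠] 0)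
      (𝓝 c) := by
    -- Since `γ 0` is a zero vector, the difference quotient of the coordinate at `0` is the
    -- coordinate of `s⁻¹ • γ s`.
    have h1 := hasDerivAt_iff_tendsto_slope.1 hd
    refine h1.congr' ?_
    have hev : ∀ᶠ s in 𝓝[≠] (0 : ℝ), (γ s).proj ∈ V.base x₀ :=
      hp' ((trivializationAt V.F V.E x₀).open_baseSet.mem_nhds hx)
    filter_upwards [hev] with s hs
    rw [slope_def_module, h0]
    change _ = (trivializationAt V.F V.E x₀ ⟨(γ s).proj, s⁻¹ • (γ s).snd⟩).2
    rw [← co_eq hs, map_smul]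
    simp
  rw [(trivializationAt V.F V.E x₀).tendsto_nhds_iff hw, ← co_eq hx]
  refine ⟨fun h => tendsto_nhds_unique h.2 hlim, fun h => ⟨hp', ?_⟩⟩
  rw [h]; exact hlim

/-- The partial derivative at a point of a smooth family of maps between vector spaces is smooth. -/
theorem _root_.ContMDiffAt.fderiv_param {F F' : Type*} [NormedAddCommGroup F] [NormedSpace ℝ F]
    [NormedAddCommGroup F'] [NormedSpace ℝ F'] [IsManifold J ∞ N] {f : N → F → F'} {y₀ : N} {v₀ : F}
    (hf : ContMDiffAt (J.prod 𝓘(ℝ, F)) 𝓘(ℝ, F') ∞ (Function.uncurry f) (y₀, v₀)) :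
    ContMDiffAt J 𝓘(ℝ, F →L[ℝ] F') ∞ (fun y => fderiv ℝ (f y) v₀) y₀ := by
  have := ContMDiffAt.mfderiv (m := ∞) f (fun _ => v₀) hf contMDiffAt_const le_rfl
  simpa only [inTangentCoordinates_model_space, mfderiv_eq_fderiv] using! this

end SmoothVB

/-! ### Local trivializations of `D → B` -/

namespace DVB

open Filter Topology

variable {EM : Type*} [NormedAddCommGroup EM] [NormedSpace ℝ EM]
    {HM : Type*} [TopologicalSpace HM] {I : ModelWithCorners ℝ EM HM}
    {M : Type*} [TopologicalSpace M] [ChartedSpace HM M]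
    {A B K : SmoothVB I M} {D : SmoothVB A.model A.Tot}

/-- The projection `D → B` on total spaces. -/
def prTot (S : DVB A B K D) (d : D.Tot) : B.Tot := ⟨d.proj.proj, S.prB d.snd⟩

/-- A smooth local trivialization of `D → B`, linear on the fibres. -/
structure LocTriv (S : DVB A B K D) where
  dim : ℕ
  triv : Trivialization (EuclideanSpace ℝ (Fin dim)) S.prTot
  smooth : ContMDiffOn D.model (B.model.prod (𝓡 dim)) ∞ triv triv.source
  smooth_symm : ContMDiffOn (B.model.prod (𝓡 dim)) D.model ∞ triv.toOpenPartialHomeomorph.symm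
    triv.target
  zero : ∀ {m : M} (b : B.E m), (⟨m, b⟩ : B.Tot) ∈ triv.baseSet →
    (triv ⟨⟨m, 0⟩, S.zeroB b⟩).2 = 0
  add : ∀ {m : M} {a a' : A.E m} (d : D.E ⟨m, a⟩) (d' : D.E ⟨m, a'⟩) (h : S.prB d = S.prB d'),
    (⟨m, S.prB d⟩ : B.Tot) ∈ triv.baseSet →
    (triv ⟨⟨m, a + a'⟩, S.addB d d' h⟩).2 = (triv ⟨⟨m, a⟩, d⟩).2 + (triv ⟨⟨m, a'⟩, d'⟩).2
  smul : ∀ {m : M} {a : A.E m} (r : ℝ) (d : D.E ⟨m, a⟩), (⟨m, S.prB d⟩ : B.Tot) ∈ triv.baseSet →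
    (triv ⟨⟨m, r • a⟩, S.smulB r d⟩).2 = r • (triv ⟨⟨m, a⟩, d⟩).2

theorem exists_locTriv (S : DVB A B K D) (b : B.Tot) : ∃ t : S.LocTriv, b ∈ t.triv.baseSet := by
  obtain ⟨k, e, hb, h1, h2, h3, h4, h5⟩ := S.locTriv b
  exact ⟨⟨k, e, h1, h2, h3, h4, h5⟩, hb⟩

variable {S : DVB A B K D}

/-- Locally the projection is the first component of a smooth trivialization. -/
theorem contMDiff_prTot : ContMDiff D.model B.model ∞ S.prTot := by
  intro d
  obtain ⟨t, ht⟩ := S.exists_locTriv (S.prTot d)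
  have hd : d ∈ t.triv.source := by rw [t.triv.mem_source]; exact ht
  have h1 : ContMDiffAt D.model (B.model.prod (𝓡 t.dim)) ∞ t.triv d :=
    t.smooth.contMDiffAt (t.triv.open_source.mem_nhds hd)
  refine (contMDiffAt_fst.comp d h1).congr_of_eventuallyEq ?_
  filter_upwards [t.triv.open_source.mem_nhds hd] with x hx
  exact (t.triv.coe_fst hx).symm

namespace LocTriv

variable (t : S.LocTriv)

theorem mem_source {m : M} {a : A.E m} {d : D.E ⟨m, a⟩}
    (h : (⟨m, S.prB d⟩ : B.Tot) ∈ t.triv.baseSet) : (⟨⟨m, a⟩, d⟩ : D.Tot) ∈ t.triv.source := by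
  rw [t.triv.mem_source]; exact h

theorem exists_symm_eq {m : M} {b : B.E m} (hb : (⟨m, b⟩ : B.Tot) ∈ t.triv.baseSet)
    (u : EuclideanSpace ℝ (Fin t.dim)) : ∃ (a : A.E m) (d : D.E ⟨m, a⟩),
      t.triv.toOpenPartialHomeomorph.symm (⟨m, b⟩, u) = ⟨⟨m, a⟩, d⟩ ∧ S.prB d = b ∧
      (t.triv ⟨⟨m, a⟩, d⟩).2 = u := by
  have hmem : ((⟨m, b⟩ : B.Tot), u) ∈ t.triv.target := t.triv.mem_target.2 hb
  have h1 := t.triv.proj_symm_apply hmem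
  have h2 := t.triv.apply_symm_apply hmem
  -- The base point in `M` of this element equals `m` only by `h1`; once the element is a variable,
  -- that equation can be substituted.
  generalize t.triv.toOpenPartialHomeomorph.symm (⟨m, b⟩, u) = x at h1 h2
  obtain ⟨⟨m', a⟩, d⟩ := x
  obtain ⟨h3, h4⟩ := TotalSpace.mk.inj h1
  dsimp only at h3
  subst h3
  exact ⟨a, d, rfl, eq_of_heq h4, congrArg Prod.snd h2⟩

theorem eq_symm {m : M} {a : A.E m} {d : D.E ⟨m, a⟩}
    (h : (⟨m, S.prB d⟩ : B.Tot) ∈ t.triv.baseSet) :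
    t.triv.toOpenPartialHomeomorph.symm (⟨m, S.prB d⟩, (t.triv ⟨⟨m, a⟩, d⟩).2) = ⟨⟨m, a⟩, d⟩ := by
  have h1 := t.mem_source h
  have h2 : t.triv ⟨⟨m, a⟩, d⟩ = (⟨m, S.prB d⟩, (t.triv ⟨⟨m, a⟩, d⟩).2) :=
    Prod.ext (t.triv.coe_fst h1) rfl
  rw [← h2]
  exact t.triv.toOpenPartialHomeomorph.left_inv h1

end LocTriv

end DVB

/-! ### Linearizing a trivialization of `D → B` along the zero section -/

namespace DVB

open Filter Topology

variable {EM : Type*} [NormedAddCommGroup EM] [NormedSpace ℝ EM]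
    {HM : Type*} [TopologicalSpace HM] {I : ModelWithCorners ℝ EM HM}
    {M : Type*} [TopologicalSpace M] [ChartedSpace HM M]
    {A B K : SmoothVB I M} {D : SmoothVB A.model A.Tot} {S : DVB A B K D}

namespace LocTriv

variable (t : S.LocTriv)

theorem inj {m : M} {a : A.E m} {d d' : D.E ⟨m, a⟩} (h : (⟨m, S.prB d⟩ : B.Tot) ∈ t.triv.baseSet)
    (hd : S.prB d = S.prB d') (ht : (t.triv ⟨⟨m, a⟩, d⟩).2 = (t.triv ⟨⟨m, a⟩, d'⟩).2) : d = d' := by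
  have h1 := t.eq_symm h
  rw [ht] at h1
  have h2 := t.eq_symm (d := d') (by rw [← hd]; exact h)
  rw [← hd, h1] at h2
  exact TotalSpace.mk_inj.1 h2

theorem continuousAt_triv_snd {m : M} {a : A.E m} {d : D.E ⟨m, a⟩}
    (h : (⟨m, S.prB d⟩ : B.Tot) ∈ t.triv.baseSet) :
    ContinuousAt (fun x => (t.triv x).2) ⟨⟨m, a⟩, d⟩ :=
  continuousAt_snd.comp (t.triv.continuousAt (t.mem_source h))

theorem zero_mem {m : M} {a : A.E m} (h0 : (⟨m, 0⟩ : B.Tot) ∈ t.triv.baseSet) :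
    (⟨m, S.prB (0 : D.E ⟨m, a⟩)⟩ : B.Tot) ∈ t.triv.baseSet := by
  rw [map_zero]; exact h0

/-- The vector of `D` over `b` with the same coordinate in the trivialization `t` as `0_a`. -/
def lift {m : M} (a : A.E m) (b : B.E m) : D.Tot :=
  t.triv.toOpenPartialHomeomorph.symm (⟨m, b⟩, (t.triv ⟨⟨m, a⟩, 0⟩).2)

theorem lift_zero {m : M} (h0 : (⟨m, 0⟩ : B.Tot) ∈ t.triv.baseSet) (a : A.E m) :
    t.lift a 0 = ⟨⟨m, a⟩, 0⟩ := by
  have := t.eq_symm (t.zero_mem (a := a) h0)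
  rwa [map_zero] at this

/-- Additivity in `a` holds because `a ↦ 0_a` is additive for `+_B`. The points `c`, `c'` of `A`
need not be `a`, `a'`: the lift is only known to lie over `a` at `b = 0`. -/
theorem lift_add {m : M} (h0 : (⟨m, 0⟩ : B.Tot) ∈ t.triv.baseSet) (a a' : A.E m) {b : B.E m}
    (hb : (⟨m, b⟩ : B.Tot) ∈ t.triv.baseSet) :
    ∃ (c c' : A.E m) (d : D.E ⟨m, c⟩) (d' : D.E ⟨m, c'⟩) (h : S.prB d = b) (h' : S.prB d' = b),
      t.lift a b = ⟨⟨m, c⟩, d⟩ ∧ t.lift a' b = ⟨⟨m, c'⟩, d'⟩ ∧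
      t.lift (a + a') b = ⟨⟨m, c + c'⟩, S.addB d d' (h.trans h'.symm)⟩ := by
  obtain ⟨c, d, h1, h2, h3⟩ := t.exists_symm_eq hb (t.triv ⟨⟨m, a⟩, 0⟩).2
  obtain ⟨c', d', h1', h2', h3'⟩ := t.exists_symm_eq hb (t.triv ⟨⟨m, a'⟩, 0⟩).2
  refine ⟨c, c', d, d', h2, h2', h1, h1', ?_⟩
  have hz : (t.triv ⟨⟨m, a + a'⟩, 0⟩).2 = (t.triv ⟨⟨m, a⟩, 0⟩).2 + (t.triv ⟨⟨m, a'⟩, 0⟩).2 := by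
    rw [← t.add _ _ (by rw [map_zero, map_zero]) (t.zero_mem h0), addB_zero]
  have hp : S.prB (S.addB d d' (h2.trans h2'.symm)) = b := by rw [S.prB_addB, h2]
  have := t.eq_symm (d := S.addB d d' (h2.trans h2'.symm)) (by rw [hp]; exact hb)
  rw [hp, t.add _ _ _ (by rw [h2]; exact hb), h3, h3', ← hz] at this
  exact this

theorem lift_smul {m : M} (h0 : (⟨m, 0⟩ : B.Tot) ∈ t.triv.baseSet) (r : ℝ) (a : A.E m) {b : B.E m}
    (hb : (⟨m, b⟩ : B.Tot) ∈ t.triv.baseSet) :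
    ∃ (c : A.E m) (d : D.E ⟨m, c⟩), S.prB d = b ∧ t.lift a b = ⟨⟨m, c⟩, d⟩ ∧
      t.lift (r • a) b = ⟨⟨m, r • c⟩, S.smulB r d⟩ := by
  obtain ⟨c, d, h1, h2, h3⟩ := t.exists_symm_eq hb (t.triv ⟨⟨m, a⟩, 0⟩).2
  refine ⟨c, d, h2, h1, ?_⟩
  have hz : (t.triv ⟨⟨m, r • a⟩, 0⟩).2 = r • (t.triv ⟨⟨m, a⟩, 0⟩).2 := by
    rw [← t.smul _ _ (t.zero_mem h0), smulB_zero]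
  have hp : S.prB (S.smulB r d) = b := by rw [S.prB_smulB, h2]
  have := t.eq_symm (d := S.smulB r d) (by rw [hp]; exact hb)
  rw [hp, t.smul _ _ (by rw [h2]; exact hb), h3, ← hz] at this
  exact this

/-- `w` is the derivative at `0` of the curve `s ↦ t.lift a (s • b)`, as a rescaled limit. -/
def IsLin {m : M} (a : A.E m) (b : B.E m) (w : D.E ⟨m, a⟩) : Prop :=
  Tendsto (fun s : ℝ => D.smulTot s⁻¹ (t.lift a (s • b))) (𝓝[≠] 0) (𝓝 ⟨⟨m, a⟩, w⟩)

theorem eventually_mem {m : M} (h0 : (⟨m, 0⟩ : B.Tot) ∈ t.triv.baseSet) (b : B.E m) :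
    ∀ᶠ s : ℝ in 𝓝[≠] 0, (⟨m, s • b⟩ : B.Tot) ∈ t.triv.baseSet ∧ s ≠ 0 := by
  have hc : Continuous fun s : ℝ => (⟨m, s • b⟩ : B.Tot) :=
    (FiberBundle.continuous_totalSpaceMk B.F B.E m).comp (continuous_id.smul continuous_const)
  have h1 : ∀ᶠ s : ℝ in 𝓝 0, (⟨m, s • b⟩ : B.Tot) ∈ t.triv.baseSet := by
    refine hc.continuousAt.eventually_mem (t.triv.open_baseSet.mem_nhds ?_)
    simpa only [zero_smul] using h0
  exact (h1.filter_mono nhdsWithin_le_nhds).and self_mem_nhdsWithin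

variable {t}

/-- As `prB` is linear on the fibres of `D → A`, each rescaled point with `s ≠ 0` small lies over
`s⁻¹ • (s • b) = b`, and so does the limit. -/
theorem IsLin.prB_eq {m : M} (h0 : (⟨m, 0⟩ : B.Tot) ∈ t.triv.baseSet) {a : A.E m} {b : B.E m}
    {w : D.E ⟨m, a⟩} (h : t.IsLin a b w) : S.prB w = b := by
  have h1 := (contMDiff_prTot (S := S)).continuous.continuousAt.tendsto.comp h
  have h2 : Tendsto (fun _ : ℝ => (⟨m, b⟩ : B.Tot)) (𝓝[≠] 0) (𝓝 ⟨m, S.prB w⟩) := by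
    refine h1.congr' ?_
    filter_upwards [t.eventually_mem h0 b] with s hs
    obtain ⟨c, d, hd1, hd2, -⟩ := t.exists_symm_eq hs.1 (t.triv ⟨⟨m, a⟩, 0⟩).2
    change S.prTot (D.smulTot s⁻¹ (t.triv.toOpenPartialHomeomorph.symm _)) = _
    rw [hd1]
    change (⟨m, S.prB (s⁻¹ • d)⟩ : B.Tot) = _
    rw [map_smul, hd2, inv_smul_smul₀ hs.2]
  have h3 : Tendsto (fun _ : ℝ => b) (𝓝[≠] 0) (𝓝 (S.prB w)) :=
    (FiberBundle.totalSpaceMk_isInducing B.F B.E m).tendsto_nhds_iff.2 h2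
  exact (tendsto_const_nhds_iff.1 h3).symm

/-- The lifts add up over `B`, and `s⁻¹ ·_A` distributes over `+_B` by `addB_smul`; the identity
passes to the limit. -/
theorem IsLin.add {m : M} (h0 : (⟨m, 0⟩ : B.Tot) ∈ t.triv.baseSet) {a a' : A.E m} {b : B.E m}
    {w : D.E ⟨m, a⟩} {w' : D.E ⟨m, a'⟩} {w'' : D.E ⟨m, a + a'⟩} (h : t.IsLin a b w)
    (h' : t.IsLin a' b w') (h'' : t.IsLin (a + a') b w'') :
    w'' = S.addB w w' ((h.prB_eq h0).trans (h'.prB_eq h0).symm) := by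
  -- The rescaled points lie over `b`, which may be outside the domain of `t`; a second
  -- trivialization around `b` compares the limits.
  obtain ⟨t', ht'⟩ := S.exists_locTriv ⟨m, b⟩
  have hw : (⟨m, S.prB w⟩ : B.Tot) ∈ t'.triv.baseSet := by rw [h.prB_eq h0]; exact ht'
  have hw' : (⟨m, S.prB w'⟩ : B.Tot) ∈ t'.triv.baseSet := by rw [h'.prB_eq h0]; exact ht'
  have hw'' : (⟨m, S.prB w''⟩ : B.Tot) ∈ t'.triv.baseSet := by rw [h''.prB_eq h0]; exact ht'
  refine t'.inj hw'' (by rw [S.prB_addB, h.prB_eq h0, h''.prB_eq h0]) ?_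
  rw [t'.add _ _ _ hw]
  have e1 := (t'.continuousAt_triv_snd hw).tendsto.comp h
  have e2 := (t'.continuousAt_triv_snd hw').tendsto.comp h'
  have e3 := (t'.continuousAt_triv_snd hw'').tendsto.comp h''
  refine tendsto_nhds_unique e3 ((e1.add e2).congr' ?_)
  filter_upwards [t.eventually_mem h0 b] with s hs
  obtain ⟨c, c', d, d', k, k', l1, l2, l3⟩ := t.lift_add h0 a a' hs.1
  simp only [Function.comp_apply]
  rw [l1, l2, l3]
  have hd : S.prB (s⁻¹ • d) = b := by rw [map_smul, k, inv_smul_smul₀ hs.2]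
  have hd' : S.prB (s⁻¹ • d') = b := by rw [map_smul, k', inv_smul_smul₀ hs.2]
  have hadd := t'.add (s⁻¹ • d) (s⁻¹ • d') (hd.trans hd'.symm) (by rw [hd]; exact ht')
  rw [S.addB_smul _ _ _ (k.trans k'.symm)] at hadd
  exact hadd.symm

theorem IsLin.smul {m : M} (h0 : (⟨m, 0⟩ : B.Tot) ∈ t.triv.baseSet) (r : ℝ) {a : A.E m} {b : B.E m}
    {w : D.E ⟨m, a⟩} {w' : D.E ⟨m, r • a⟩} (h : t.IsLin a b w) (h' : t.IsLin (r • a) b w') :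
    w' = S.smulB r w := by
  obtain ⟨t', ht'⟩ := S.exists_locTriv ⟨m, b⟩
  have hw : (⟨m, S.prB w⟩ : B.Tot) ∈ t'.triv.baseSet := by rw [h.prB_eq h0]; exact ht'
  have hw' : (⟨m, S.prB w'⟩ : B.Tot) ∈ t'.triv.baseSet := by rw [h'.prB_eq h0]; exact ht'
  refine t'.inj hw' (by rw [S.prB_smulB, h.prB_eq h0, h'.prB_eq h0]) ?_
  rw [t'.smul _ _ hw]
  have e1 := (t'.continuousAt_triv_snd hw).tendsto.comp h
  have e2 := (t'.continuousAt_triv_snd hw').tendsto.comp h'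
  refine tendsto_nhds_unique e2 ((e1.const_smul r).congr' ?_)
  filter_upwards [t.eventually_mem h0 b] with s hs
  obtain ⟨c, d, k, l1, l2⟩ := t.lift_smul h0 r a hs.1
  simp only [Function.comp_apply]
  rw [l1, l2]
  have hd : S.prB (s⁻¹ • d) = b := by rw [map_smul, k, inv_smul_smul₀ hs.2]
  have hsm := t'.smul r (s⁻¹ • d) (by rw [hd]; exact ht')
  rw [S.smulB_smul] at hsm
  exact hsm.symm

theorem contMDiffAt_lift (m₀ : M) {a : A.Tot} (h0 : (⟨a.proj, 0⟩ : B.Tot) ∈ t.triv.baseSet)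
    (ha : a.proj ∈ B.base m₀) :
    ContMDiffAt (A.model.prod 𝓘(ℝ, B.F)) D.model ∞
      (fun p : A.Tot × B.F => t.lift p.1.snd (B.coSymm m₀ p.1.proj p.2)) (a, 0) := by
  have hz : ContMDiffAt (A.model.prod 𝓘(ℝ, B.F)) D.model ∞
      (fun p : A.Tot × B.F => (⟨p.1, 0⟩ : D.Tot)) (a, 0) :=
    (contMDiff_zeroSection (n := ∞) ℝ D.E).contMDiffAt.comp (a, (0 : B.F)) contMDiffAt_fst
  have hz' : ContMDiffAt (A.model.prod 𝓘(ℝ, B.F)) (𝓡 t.dim) ∞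
      (fun p : A.Tot × B.F => (t.triv ⟨p.1, 0⟩).2) (a, 0) :=
    contMDiffAt_snd.comp (a, (0 : B.F)) (ContMDiffAt.comp (a, (0 : B.F)) (t.smooth.contMDiffAt
      (t.triv.open_source.mem_nhds (t.mem_source (t.zero_mem (a := a.snd) h0)))) hz)
  have hp : ContMDiffAt (A.model.prod 𝓘(ℝ, B.F)) I ∞ (fun p : A.Tot × B.F => p.1.proj) (a, 0) :=
    (contMDiffAt_proj A.E).comp (a, (0 : B.F)) contMDiffAt_fst
  have hb : ContMDiffAt (A.model.prod 𝓘(ℝ, B.F)) B.model ∞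
      (fun p : A.Tot × B.F => (⟨p.1.proj, B.coSymm m₀ p.1.proj p.2⟩ : B.Tot)) (a, 0) :=
    SmoothVB.contMDiffWithinAt_frame_apply hp contMDiffAt_snd
      (fun p => (B.coSymm m₀ p.1.proj).toLinearMap)
      fun w => SmoothVB.contMDiffWithinAt_coSymm w ha hp
  have hmem : ((⟨a.proj, B.coSymm m₀ a.proj 0⟩ : B.Tot), (t.triv ⟨a, 0⟩).2) ∈ t.triv.target := by
    rw [t.triv.mem_target, map_zero]; exact h0
  exact ContMDiffAt.comp (a, (0 : B.F)) (t.smooth_symm.contMDiffAt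
    (t.triv.open_target.mem_nhds hmem)) (hb.prodMk hz')

end LocTriv

end DVB

/-! ### Existence of smooth linear splittings -/

namespace DVB

open Filter Topology

variable {EM : Type*} [NormedAddCommGroup EM] [NormedSpace ℝ EM]
    {HM : Type*} [TopologicalSpace HM] {I : ModelWithCorners ℝ EM HM}
    {M : Type*} [TopologicalSpace M] [ChartedSpace HM M]
    {A B K : SmoothVB I M} {D : SmoothVB A.model A.Tot} {S : DVB A B K D}

namespace LocTriv

variable (t : S.LocTriv)

/-- The coordinate of `t.lift` in the trivialization of `D → A` at `x₀`. -/
def liftCo (m₀ : M) (x₀ a : A.Tot) (v : B.F) : D.F :=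
  D.co x₀ (t.lift a.snd (B.coSymm m₀ a.proj v)).proj (t.lift a.snd (B.coSymm m₀ a.proj v)).snd

variable {t}

theorem contMDiffAt_liftCo (m₀ : M) {x₀ a : A.Tot} (h0 : (⟨a.proj, 0⟩ : B.Tot) ∈ t.triv.baseSet)
    (ha : a.proj ∈ B.base m₀) (hx : a ∈ D.base x₀) :
    ContMDiffAt (A.model.prod 𝓘(ℝ, B.F)) 𝓘(ℝ, D.F) ∞ (Function.uncurry (t.liftCo m₀ x₀)) (a, 0) := by
  have hl : t.lift a.snd (B.coSymm m₀ a.proj 0) = ⟨a, 0⟩ := by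
    rw [map_zero, t.lift_zero h0]
  exact ((SmoothVB.contMDiffWithinAt_iff_co (x₀ := x₀) (by rw [hl]; exact hx)).1
    (contMDiffAt_lift m₀ h0 ha)).2

/-- The curve `s ↦ t.lift a (s • b)` starts at the zero vector `0_a`, so its rescaled limit is a
vertical derivative, given by the chain rule. The left side does not involve the trivialization of
`D → A`, so the right side may be computed in any of them. -/
theorem isLin_iff (m₀ : M) {x₀ : A.Tot} {m : M} (h0 : (⟨m, 0⟩ : B.Tot) ∈ t.triv.baseSet)
    (hm : m ∈ B.base m₀) {a : A.E m} (hx : (⟨m, a⟩ : A.Tot) ∈ D.base x₀) (b : B.E m)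
    (w : D.E ⟨m, a⟩) :
    t.IsLin a b w ↔ D.co x₀ ⟨m, a⟩ w = fderiv ℝ (t.liftCo m₀ x₀ ⟨m, a⟩) 0 (B.co m₀ m b) := by
  have hs : ∀ s : ℝ, s • b = B.coSymm m₀ m (s • B.co m₀ m b) := fun s => by
    rw [map_smul, SmoothVB.coSymm_co hm]
  have hc : ContMDiffAt 𝓘(ℝ, B.F) (A.model.prod 𝓘(ℝ, B.F)) ∞
      (fun v : B.F => ((⟨m, a⟩ : A.Tot), v)) 0 := contMDiffAt_const.prodMk contMDiffAt_id
  have hline : ContMDiffAt 𝓘(ℝ, ℝ) 𝓘(ℝ, B.F) ∞ (fun s : ℝ => s • B.co m₀ m b) 0 :=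
    (contDiff_id.smul contDiff_const).contMDiff.contMDiffAt
  refine SmoothVB.tendsto_smulTot_inv_iff hx (by rw [zero_smul, t.lift_zero h0]) ?_ ?_ w
  · have h1 := ContMDiffAt.comp_of_eq (contMDiffAt_lift (t := t) m₀ (a := ⟨m, a⟩) h0 hm)
      ((contMDiffAt_const (c := (⟨m, a⟩ : A.Tot))).prodMk hline) (by simp)
    have h2 := (FiberBundle.continuous_proj D.F D.E).continuousAt.comp h1.continuousAt
    refine h2.congr (Eventually.of_forall fun s => ?_)
    simp only [Function.comp_apply, hs]
  · have hd : DifferentiableAt ℝ (t.liftCo m₀ x₀ ⟨m, a⟩) 0 :=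
      (ContMDiffAt.comp (0 : B.F) (contMDiffAt_liftCo (t := t) m₀ (a := ⟨m, a⟩) h0 hm hx)
        hc).contDiffAt.differentiableAt (by simp)
    have hd' : HasFDerivAt (t.liftCo m₀ x₀ ⟨m, a⟩) (fderiv ℝ (t.liftCo m₀ x₀ ⟨m, a⟩) 0)
        ((0 : ℝ) • B.co m₀ m b) := by rw [zero_smul]; exact hd.hasFDerivAt
    have hl : HasDerivAt (fun s : ℝ => s • B.co m₀ m b) (B.co m₀ m b) 0 := by
      simpa using (hasDerivAt_id (0 : ℝ)).smul_const (B.co m₀ m b)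
    have h1 := hd'.comp_hasDerivAt (0 : ℝ) hl
    refine h1.congr_of_eventuallyEq (Eventually.of_forall fun s => ?_)
    exact congrArg (fun b' => D.co x₀ (t.lift a b').proj (t.lift a b').snd) (hs s)

variable (t)

/-- The linear part of `t.lift` along the zero section of `B`. -/
def linSec (m₀ : M) {m : M} (a : A.E m) : B.E m →ₗ[ℝ] D.E ⟨m, a⟩ :=
  ((D.coSymm ⟨m, a⟩ ⟨m, a⟩).comp ((fderiv ℝ (t.liftCo m₀ ⟨m, a⟩ ⟨m, a⟩) 0).comp
    (B.co m₀ m))).toLinearMap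

variable {t}

theorem isLin_linSec (m₀ : M) {m : M} (h0 : (⟨m, 0⟩ : B.Tot) ∈ t.triv.baseSet)
    (hm : m ∈ B.base m₀) (a : A.E m) (b : B.E m) : t.IsLin a b (t.linSec m₀ a b) :=
  (isLin_iff m₀ h0 hm (D.mem_base _) b _).2 (SmoothVB.co_coSymm (D.mem_base _) _)

variable (t)

/-- The linear splitting defined by a trivialization of `D → B` around the zero section. -/
def splitting (m₀ : M) {m : M} (h0 : (⟨m, 0⟩ : B.Tot) ∈ t.triv.baseSet) (hm : m ∈ B.base m₀) :
    S.Splitting m where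
  sec a := t.linSec m₀ a
  prB_sec a b := (isLin_linSec m₀ h0 hm a b).prB_eq h0
  sec_add a a' b := (isLin_linSec m₀ h0 hm a b).add h0 (isLin_linSec m₀ h0 hm a' b)
    (isLin_linSec m₀ h0 hm (a + a') b)
  sec_smul r a b := (isLin_linSec m₀ h0 hm a b).smul h0 r (isLin_linSec m₀ h0 hm (r • a) b)

variable {t}

/-- `linSec` is written in the trivialization at the point itself, which varies. By `isLin_iff` it
can be read near `a` in the single trivialization at `a`, where it is a partial derivative of a
smooth map. -/
theorem contMDiffAt_linSec [IsManifold I ∞ M] (m₀ : M) {a : A.Tot}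
    (h0 : (⟨a.proj, 0⟩ : B.Tot) ∈ t.triv.baseSet) (ha : a.proj ∈ B.base m₀) (v : B.F) :
    ContMDiffAt A.model D.model ∞
      (fun x : A.Tot => (⟨x, t.linSec m₀ x.snd (B.coSymm m₀ x.proj v)⟩ : D.Tot)) a := by
  refine (SmoothVB.contMDiffWithinAt_iff_co (x₀ := a) (D.mem_base _)).2 ⟨contMDiffWithinAt_id, ?_⟩
  have hfd := (contMDiffAt_liftCo (t := t) m₀ h0 ha (D.mem_base a)).fderiv_param
  have hp : ContinuousAt (fun x : A.Tot => x.proj) a :=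
    (FiberBundle.continuous_proj A.F A.E).continuousAt
  have hz : ContinuousAt (fun x : A.Tot => (⟨x.proj, 0⟩ : B.Tot)) a :=
    (contMDiff_zeroSection (n := ∞) (IB := I) ℝ B.E).continuous.continuousAt.comp hp
  have hev : ∀ᶠ x in 𝓝 a, x ∈ D.base a ∧ x.proj ∈ B.base m₀ ∧
      (⟨x.proj, 0⟩ : B.Tot) ∈ t.triv.baseSet :=
    Filter.Eventually.and (D.base_mem_nhds a) (Filter.Eventually.and
      (hp.eventually_mem ((trivializationAt B.F B.E m₀).open_baseSet.mem_nhds ha))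
      (hz.eventually_mem (t.triv.open_baseSet.mem_nhds h0)))
  refine ContMDiffAt.congr_of_eventuallyEq
    (hfd.clm_apply (contMDiffAt_const (c := v))) ?_
  filter_upwards [hev] with x hx
  rw [(isLin_iff m₀ hx.2.2 hx.2.1 hx.1 _ _).1 (isLin_linSec m₀ hx.2.2 hx.2.1 _ _),
    SmoothVB.co_coSymm hx.2.1]

end LocTriv

/-- Around each point of `M` there is a smooth linear splitting. -/
theorem exists_smooth_splitting [IsManifold I ∞ M] (S : DVB A B K D) (m₀ : M) :
    ∃ (σ : ∀ m, S.Splitting m) (U : Set M), IsOpen U ∧ m₀ ∈ U ∧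
      U ⊆ A.base m₀ ∩ B.base m₀ ∩ K.base m₀ ∧
      ∀ a : A.Tot, a.proj ∈ U → ∀ v, ContMDiffAt A.model D.model ∞
        (fun x : A.Tot => (⟨x, (σ x.proj).sec x.snd (B.coSymm m₀ x.proj v)⟩ : D.Tot)) a := by
  classical
  obtain ⟨t, ht⟩ := S.exists_locTriv ⟨m₀, 0⟩
  have hpt : ∀ m, Nonempty (S.Splitting m) := fun m => by
    obtain ⟨t', ht'⟩ := S.exists_locTriv ⟨m, 0⟩
    exact ⟨t'.splitting m ht' (B.mem_base m)⟩
  let U₁ : Set M := {m | (⟨m, 0⟩ : B.Tot) ∈ t.triv.baseSet}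
  have hU₁ : IsOpen U₁ := t.triv.open_baseSet.preimage
    (contMDiff_zeroSection (n := ∞) (IB := I) ℝ B.E).continuous
  let U : Set M := U₁ ∩ (A.base m₀ ∩ B.base m₀ ∩ K.base m₀)
  have hU : IsOpen U := hU₁.inter (((trivializationAt A.F A.E m₀).open_baseSet.inter
    (trivializationAt B.F B.E m₀).open_baseSet).inter (trivializationAt K.F K.E m₀).open_baseSet)
  -- Arbitrary pointwise splittings fill in outside `U`, where nothing is claimed.
  let σ : ∀ m, S.Splitting m := fun m =>
    if h : m ∈ U then t.splitting m₀ h.1 h.2.1.2 else (hpt m).some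
  refine ⟨σ, U, hU, ⟨ht, ⟨A.mem_base _, B.mem_base _⟩, K.mem_base _⟩, Set.inter_subset_right,
    fun a ha v => ?_⟩
  refine (LocTriv.contMDiffAt_linSec m₀ ha.1 ha.2.1.2 v).congr_of_eventuallyEq ?_
  have hev : ∀ᶠ x : A.Tot in 𝓝 a, x.proj ∈ U :=
    (FiberBundle.continuous_proj A.F A.E).continuousAt.eventually_mem (hU.mem_nhds ha)
  filter_upwards [hev] with x hx
  have : σ x.proj = t.splitting m₀ hx.1 hx.2.1.2 := dif_pos hx
  rw [this]
  rfl

/-- Smooth sections of the core of `D` define smooth sections of `D → A`. -/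
theorem contMDiffAt_coreA (S : DVB A B K D) {m₀ : M} {a : A.Tot} (ha : a.proj ∈ K.base m₀)
    (φ : K.dual.F) : ContMDiffAt A.model D.model ∞
      (fun x : A.Tot => (⟨x, S.coreA x.snd (K.dual.coSymm m₀ x.proj φ)⟩ : D.Tot)) a := by
  obtain ⟨t, ht⟩ := S.exists_locTriv ⟨a.proj, 0⟩
  have ha' : a.proj ∈ K.dual.base m₀ := by rw [SmoothVB.base_dual]; exact ha
  have hp : ContMDiffAt A.model I ∞ (fun x : A.Tot => x.proj) a := contMDiffAt_proj A.E
  have hz : ContMDiffAt A.model B.model ∞ (fun x : A.Tot => (⟨x.proj, 0⟩ : B.Tot)) a :=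
    (contMDiff_zeroSection (n := ∞) (IB := I) ℝ B.E).contMDiffAt.comp a hp
  have h1 : ContMDiffAt A.model (𝓡 t.dim) ∞ (fun x : A.Tot => (t.triv ⟨x, 0⟩).2) a :=
    contMDiffAt_snd.comp a (ContMDiffAt.comp a (t.smooth.contMDiffAt
      (t.triv.open_source.mem_nhds (t.mem_source (t.zero_mem (a := a.snd) ht))))
      (contMDiff_zeroSection (n := ∞) ℝ D.E).contMDiffAt)
  have hc : ContMDiffAt A.model D.model ∞
      (fun x : A.Tot => (⟨⟨x.proj, 0⟩, S.core (K.dual.coSymm m₀ x.proj φ)⟩ : D.Tot)) a :=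
    ContMDiffAt.comp a (S.core_smooth _) (SmoothVB.contMDiffWithinAt_coSymm φ ha' hp)
  have h2 : ContMDiffAt A.model (𝓡 t.dim) ∞
      (fun x : A.Tot => (t.triv ⟨⟨x.proj, 0⟩, S.core (K.dual.coSymm m₀ x.proj φ)⟩).2) a :=
    contMDiffAt_snd.comp a (ContMDiffAt.comp a (t.smooth.contMDiffAt
      (t.triv.open_source.mem_nhds (t.mem_source (by rw [S.prB_core]; exact ht)))) hc)
  have hmem : ((⟨a.proj, 0⟩ : B.Tot), (t.triv ⟨a, 0⟩).2 +
      (t.triv ⟨⟨a.proj, 0⟩, S.core (K.dual.coSymm m₀ a.proj φ)⟩).2) ∈ t.triv.target := by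
    rw [t.triv.mem_target]; exact ht
  -- In the trivialization `t` the element `0_a +_B γ̄` is the sum of the coordinates of `0_a` and
  -- `γ̄`, both smooth in the base point.
  refine (ContMDiffAt.comp a (t.smooth_symm.contMDiffAt (t.triv.open_target.mem_nhds hmem))
    (hz.prodMk (h1.add h2))).congr_of_eventuallyEq ?_
  have hev : ∀ᶠ x : A.Tot in 𝓝 a, (⟨x.proj, 0⟩ : B.Tot) ∈ t.triv.baseSet :=
    hz.continuousAt.eventually_mem (t.triv.open_baseSet.mem_nhds ht)
  filter_upwards [hev] with x hx
  have key : ∀ {a a' : A.E x.proj} (_ : a = a') (hc : D.E ⟨x.proj, a⟩ = D.E ⟨x.proj, a'⟩)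
      (d : D.E ⟨x.proj, a⟩), (t.triv ⟨⟨x.proj, a'⟩, cast hc d⟩).2 = (t.triv ⟨⟨x.proj, a⟩, d⟩).2 := by
    rintro a _ rfl hc d; rfl
  have h3 := t.eq_symm (d := S.coreA x.snd (K.dual.coSymm m₀ x.proj φ))
    (by rw [prB_coreA]; exact hx)
  rw [prB_coreA] at h3
  refine h3.symm.trans ?_
  simp only [Function.comp_apply]
  congr 2
  rw [coreA, key (add_zero _), t.add _ _ _ (t.zero_mem hx)]
  rfl

end DVB

/-! ### Operations on functionals over `K`, and smooth frames of `D → A` -/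

namespace DVB

open Filter Topology

variable {EM : Type*} [NormedAddCommGroup EM] [NormedSpace ℝ EM]
    {HM : Type*} [TopologicalSpace HM] {I : ModelWithCorners ℝ EM HM}
    {M : Type*} [TopologicalSpace M] [ChartedSpace HM M]
    {EN : Type*} [NormedAddCommGroup EN] [NormedSpace ℝ EN]
    {HN : Type*} [TopologicalSpace HN] {J : ModelWithCorners ℝ EN HN}
    {N : Type*} [TopologicalSpace N] [ChartedSpace HN N]
    {A B K : SmoothVB I M} {D : SmoothVB A.model A.Tot} {S : DVB A B K D}

namespace Splitting

variable {m : M} (σ : S.Splitting m)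

/-- The coordinates on the dual fibre given by a splitting, as a linear map. -/
def dptLin (a : A.E m) : (K.E m × B.dual.E m) →ₗ[ℝ] D.dual.E ⟨m, a⟩ where
  toFun p := σ.dpt a p.1 p.2
  map_add' p q := σ.dpt_add a p.1 q.1 p.2 q.2
  map_smul' r p := σ.dpt_smul a r p.1 p.2

/-- The coordinates on the dual fibre given by a splitting. -/
def dptEquiv (a : A.E m) : (K.E m × B.dual.E m) ≃ₗ[ℝ] D.dual.E ⟨m, a⟩ :=
  LinearEquiv.ofBijective (σ.dptLin a)
    ⟨fun p q h => Prod.ext (σ.dpt_inj (κ := p.1) (κ' := q.1) (β := p.2) (β' := q.2) h).1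
      (σ.dpt_inj (κ := p.1) (κ' := q.1) (β := p.2) (β' := q.2) h).2, fun Φ => by
      obtain ⟨κ, β, h⟩ := σ.exists_dpt Φ
      exact ⟨(κ, β), h.symm⟩⟩

/-- The projection of a functional to `K`. -/
def dualK {a : A.E m} : D.dual.E ⟨m, a⟩ →ₗ[ℝ] K.E m :=
  LinearMap.fst ℝ _ _ ∘ₗ (σ.dptEquiv a).symm.toLinearMap

/-- The component of a functional in `B*`. -/
def dualB {a : A.E m} : D.dual.E ⟨m, a⟩ →ₗ[ℝ] B.dual.E m :=
  LinearMap.snd ℝ _ _ ∘ₗ (σ.dptEquiv a).symm.toLinearMap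

theorem dptEquiv_symm (a : A.E m) (κ : K.E m) (β : B.dual.E m) :
    (σ.dptEquiv a).symm (σ.dpt a κ β) = (κ, β) := (σ.dptEquiv a).symm_apply_apply (κ, β)

theorem dualK_dpt (a : A.E m) (κ : K.E m) (β : B.dual.E m) : σ.dualK (σ.dpt a κ β) = κ :=
  congrArg Prod.fst (σ.dptEquiv_symm a κ β)

theorem dualB_dpt (a : A.E m) (κ : K.E m) (β : B.dual.E m) : σ.dualB (σ.dpt a κ β) = β :=
  congrArg Prod.snd (σ.dptEquiv_symm a κ β)

theorem dualK_apply {a : A.E m} (Φ : D.dual.E ⟨m, a⟩) (γ : K.dual.E m) :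
    γ (σ.dualK Φ) = Φ (S.coreA a γ) := by
  obtain ⟨κ, β, rfl⟩ := σ.exists_dpt Φ
  rw [dualK_dpt, ← σ.pt_zero_right, dpt_pt, map_zero, zero_add]

/-- `dualK_apply` characterizes the projection without the splitting. Independence allows a global
choice of splittings to be replaced locally by a smooth one. -/
theorem dualK_eq (σ' : S.Splitting m) {a : A.E m} (Φ : D.dual.E ⟨m, a⟩) :
    σ.dualK Φ = σ'.dualK Φ :=
  SmoothVB.ext_dual fun γ => by rw [dualK_apply, dualK_apply]

theorem dualB_apply {a : A.E m} (Φ : D.dual.E ⟨m, a⟩) (b : B.E m) :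
    σ.dualB Φ b = Φ (σ.sec a b) := by
  obtain ⟨κ, β, rfl⟩ := σ.exists_dpt Φ
  rw [dualB_dpt, ← σ.pt_zero_core, dpt_pt, zero_apply, add_zero]

theorem dpt_dual {a : A.E m} (Φ : D.dual.E ⟨m, a⟩) : σ.dpt a (σ.dualK Φ) (σ.dualB Φ) = Φ := by
  obtain ⟨κ, β, rfl⟩ := σ.exists_dpt Φ
  rw [dualK_dpt, dualB_dpt]

/-- The addition of functionals over `K`. -/
def dualAdd {a a' : A.E m} (Φ : D.dual.E ⟨m, a⟩) (Φ' : D.dual.E ⟨m, a'⟩) :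
    D.dual.E ⟨m, a + a'⟩ := σ.dpt (a + a') (σ.dualK Φ) (σ.dualB Φ + σ.dualB Φ')

/-- The scalar multiplication of functionals over `K`. -/
def dualSMul {a : A.E m} (r : ℝ) (Φ : D.dual.E ⟨m, a⟩) : D.dual.E ⟨m, r • a⟩ :=
  σ.dpt (r • a) (σ.dualK Φ) (r • σ.dualB Φ)

theorem dualAdd_apply {a a' : A.E m} (Φ : D.dual.E ⟨m, a⟩) (Φ' : D.dual.E ⟨m, a'⟩)
    (h : σ.dualK Φ = σ.dualK Φ') (d : D.E ⟨m, a⟩) (d' : D.E ⟨m, a'⟩) (hd : S.prB d = S.prB d') :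
    σ.dualAdd Φ Φ' (S.addB d d' hd) = Φ d + Φ' d' := by
  obtain ⟨κ, β, rfl⟩ := σ.exists_dpt Φ
  obtain ⟨κ', β', rfl⟩ := σ.exists_dpt Φ'
  rw [dualK_dpt, dualK_dpt] at h
  subst h
  obtain ⟨b, γ, rfl⟩ := σ.exists_eq_pt d
  obtain ⟨b', γ', rfl⟩ := σ.exists_eq_pt d'
  have hb : b = b' := by rwa [prB_pt, prB_pt] at hd
  subst hb
  rw [addB_pt, dualAdd, dpt_pt, dpt_pt, dpt_pt, dualK_dpt, dualB_dpt, dualB_dpt, add_apply,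
    add_apply]
  abel

theorem dualSMul_apply {a : A.E m} (r : ℝ) (Φ : D.dual.E ⟨m, a⟩) (d : D.E ⟨m, a⟩) :
    σ.dualSMul r Φ (S.smulB r d) = r * Φ d := by
  obtain ⟨κ, β, rfl⟩ := σ.exists_dpt Φ
  obtain ⟨b, γ, rfl⟩ := σ.exists_eq_pt d
  rw [smulB_pt, dualSMul, dpt_pt, dpt_pt, dualK_dpt, dualB_dpt, smul_apply, smul_apply, mul_add]
  rfl

/-- The values on sums `d +_B d'` do not involve the splitting, and every element over `a + a'` is
such a sum. -/
theorem dualAdd_eq (σ' : S.Splitting m) {a a' : A.E m} (Φ : D.dual.E ⟨m, a⟩)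
    (Φ' : D.dual.E ⟨m, a'⟩) (h : σ.dualK Φ = σ.dualK Φ') : σ.dualAdd Φ Φ' = σ'.dualAdd Φ Φ' := by
  refine σ.dual_ext fun b γ => ?_
  have hp : S.prB (σ.pt a b γ) = S.prB (σ.pt a' b 0) := by rw [prB_pt, prB_pt]
  have h1 : σ.pt (a + a') b γ = S.addB (σ.pt a b γ) (σ.pt a' b 0) hp := by rw [addB_pt, add_zero]
  rw [h1, σ.dualAdd_apply _ _ h, σ'.dualAdd_apply _ _ (by rwa [σ'.dualK_eq σ, σ'.dualK_eq σ])]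

theorem dualSMul_eq (σ' : S.Splitting m) {a : A.E m} (r : ℝ) (Φ : D.dual.E ⟨m, a⟩) :
    σ.dualSMul r Φ = σ'.dualSMul r Φ := by
  refine σ.dual_ext fun b γ => ?_
  have h1 : σ.pt (r • a) b γ = S.smulB r (σ.pt a b 0) + S.coreA (r • a) γ := by
    rw [smulB_pt, ← pt_zero_right, ← pt_add, add_zero, smul_zero, zero_add]
  rw [h1, map_add, map_add, σ.dualSMul_apply, σ'.dualSMul_apply, ← σ.dualK_apply,
    ← σ'.dualK_apply, dualSMul, dualSMul, dualK_dpt, dualK_dpt, σ.dualK_eq σ']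

theorem dpt_zero_zero_apply (β : B.dual.E m) {a : A.E m} (d : D.E ⟨m, a⟩) :
    σ.dpt a 0 β d = β (S.prB d) := by
  obtain ⟨b, γ, rfl⟩ := σ.exists_eq_pt d
  rw [dpt_pt, prB_pt, map_zero, add_zero]

end Splitting

/-- A smooth linear splitting around the point `m₀`. -/
structure SmoothSplitting (S : DVB A B K D) (m₀ : M) where
  spl : ∀ m, S.Splitting m
  dom : Set M
  isOpen : IsOpen dom
  mem : m₀ ∈ dom
  sub : dom ⊆ A.base m₀ ∩ B.base m₀ ∩ K.base m₀
  smooth : ∀ a : A.Tot, a.proj ∈ dom → ∀ v, ContMDiffAt A.model D.model ∞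
    (fun x : A.Tot => (⟨x, (spl x.proj).sec x.snd (B.coSymm m₀ x.proj v)⟩ : D.Tot)) a

theorem nonempty_smoothSplitting [IsManifold I ∞ M] (S : DVB A B K D) (m₀ : M) :
    Nonempty (S.SmoothSplitting m₀) := by
  obtain ⟨σ, U, h1, h2, h3, h4⟩ := S.exists_smooth_splitting m₀
  exact ⟨⟨σ, U, h1, h2, h3, h4⟩⟩

namespace SmoothSplitting

variable {m₀ : M} (s : S.SmoothSplitting m₀)

theorem memA {m : M} (h : m ∈ s.dom) : m ∈ A.base m₀ := (s.sub h).1.1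
theorem memB {m : M} (h : m ∈ s.dom) : m ∈ B.base m₀ := (s.sub h).1.2
theorem memK {m : M} (h : m ∈ s.dom) : m ∈ K.base m₀ := (s.sub h).2

/-- The frame of `D → A` given by a smooth splitting. -/
def frame (a : A.Tot) : (B.F × K.dual.F) →ₗ[ℝ] D.E a :=
  ((s.spl a.proj).ptEquiv a.snd).toLinearMap ∘ₗ
    (B.coSymm m₀ a.proj).toLinearMap.prodMap (K.dual.coSymm m₀ a.proj).toLinearMap

theorem frame_apply (a : A.Tot) (v : B.F) (φ : K.dual.F) : s.frame a (v, φ) =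
    (s.spl a.proj).pt a.snd (B.coSymm m₀ a.proj v) (K.dual.coSymm m₀ a.proj φ) := rfl

theorem frame_bijective {a : A.Tot} (h : a.proj ∈ s.dom) : Function.Bijective (s.frame a) := by
  have h1 := SmoothVB.coSymm_bijective (s.memB h)
  have h2 : Function.Bijective (K.dual.coSymm m₀ a.proj) :=
    SmoothVB.coSymm_bijective (by rw [SmoothVB.base_dual]; exact s.memK h)
  exact ((s.spl a.proj).ptEquiv a.snd).bijective.comp
    ⟨h1.1.prodMap h2.1, h1.2.prodMap h2.2⟩

theorem contMDiffAt_frame {a : A.Tot} (h : a.proj ∈ s.dom) (w : B.F × K.dual.F) :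
    ContMDiffAt A.model D.model ∞ (fun x : A.Tot => (⟨x, s.frame x w⟩ : D.Tot)) a := by
  have h1 := ((SmoothVB.contMDiffWithinAt_iff_co (x₀ := a) (D.mem_base _)).1
    (s.smooth a h w.1)).2
  have h2 := ((SmoothVB.contMDiffWithinAt_iff_co (x₀ := a) (D.mem_base _)).1
    (S.contMDiffAt_coreA (s.memK h) w.2)).2
  refine (SmoothVB.contMDiffWithinAt_iff_co (x₀ := a) (D.mem_base _)).2
    ⟨contMDiffWithinAt_id, (h1.add h2).congr (fun x _ => ?_) ?_⟩
  · exact map_add (D.co a x) _ _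
  · exact map_add (D.co a a) _ _

theorem contMDiffWithinAt_frame {b : N → A.Tot} {t : Set N} {y₀ : N}
    (hb : ContMDiffWithinAt J A.model ∞ b t y₀) (h : (b y₀).proj ∈ s.dom) (w : B.F × K.dual.F) :
    ContMDiffWithinAt J D.model ∞ (fun y => (⟨b y, s.frame (b y) w⟩ : D.Tot)) t y₀ :=
  (s.contMDiffAt_frame h w).comp_contMDiffWithinAt y₀ hb

end SmoothSplitting

end DVB

/-! ### Smooth trivializations of `D*_A → K` -/

namespace DVB

open Filter Topology

variable {EM : Type*} [NormedAddCommGroup EM] [NormedSpace ℝ EM]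
    {HM : Type*} [TopologicalSpace HM] {I : ModelWithCorners ℝ EM HM}
    {M : Type*} [TopologicalSpace M] [ChartedSpace HM M]
    {EN : Type*} [NormedAddCommGroup EN] [NormedSpace ℝ EN]
    {HN : Type*} [TopologicalSpace HN] {J : ModelWithCorners ℝ EN HN}
    {N : Type*} [TopologicalSpace N] [ChartedSpace HN N]
    {A B K : SmoothVB I M} {D : SmoothVB A.model A.Tot} {S : DVB A B K D}

namespace SmoothSplitting

variable {m₀ : M} (s : S.SmoothSplitting m₀)

theorem contMDiffAt_proj_proj (Φ₀ : D.Tot) :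
    ContMDiffAt D.model I ∞ (fun Φ : D.Tot => Φ.proj.proj) Φ₀ :=
  (contMDiffAt_proj A.E).comp Φ₀ (contMDiffAt_proj D.E)

theorem eventually_mem {f : N → M} {y₀ : N} (hf : ContinuousAt f y₀) (h : f y₀ ∈ s.dom) :
    ∀ᶠ y in 𝓝 y₀, f y ∈ s.dom := hf.eventually_mem (s.isOpen.mem_nhds h)

theorem contMDiffAt_apply_frame {Φ₀ : D.dual.Tot} (h : Φ₀.proj.proj ∈ s.dom) (w : B.F × K.dual.F) :
    ContMDiffAt D.dual.model 𝓘(ℝ, ℝ) ∞ (fun Φ : D.dual.Tot => Φ.snd (s.frame Φ.proj w)) Φ₀ :=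
  SmoothVB.contMDiffWithinAt_dual_apply (V := D) (Φ := fun Φ => Φ)
    (u := fun Φ => ⟨Φ.proj, s.frame Φ.proj w⟩) (Set.mem_univ _) contMDiffWithinAt_id
    (s.contMDiffWithinAt_frame (contMDiffAt_proj D.dual.E) h w)
    fun Φ _ => ⟨Φ.proj, Φ.snd, _, rfl, rfl, rfl⟩

/-- No smoothness of `τ` is needed: the pairings with the frame of `K*` are the values of `Φ` on
core translates, which do not involve `τ`. -/
theorem contMDiffAt_dualK (τ : ∀ m, S.Splitting m) {Φ₀ : D.dual.Tot} (h : Φ₀.proj.proj ∈ s.dom) :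
    ContMDiffAt D.dual.model K.model ∞
      (fun Φ : D.dual.Tot => (⟨Φ.proj.proj, (τ Φ.proj.proj).dualK Φ.snd⟩ : K.Tot)) Φ₀ := by
  refine SmoothVB.contMDiffWithinAt_of_coSymm_dual_apply (V := K) (x₀ := m₀) (s.memK h)
    (contMDiffAt_proj_proj (D := D.dual) Φ₀) fun φ => ?_
  refine (s.contMDiffAt_apply_frame h (0, φ)).congr_of_eventuallyEq (.of_forall fun Φ => ?_)
  refine ((τ Φ.proj.proj).dualK_apply Φ.snd _).trans (congrArg Φ.snd ?_)
  rw [frame_apply, map_zero, Splitting.pt_zero_right]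

theorem contMDiffAt_dualB {Φ₀ : D.dual.Tot} (h : Φ₀.proj.proj ∈ s.dom) :
    ContMDiffAt D.dual.model 𝓘(ℝ, B.dual.F) ∞
      (fun Φ : D.dual.Tot => B.dual.co m₀ Φ.proj.proj ((s.spl Φ.proj.proj).dualB Φ.snd)) Φ₀ := by
  refine ContMDiffWithinAt.clm_of_apply fun v => ?_
  refine ContMDiffAt.congr_of_eventuallyEq (s.contMDiffAt_apply_frame h (v, 0)) ?_
  filter_upwards [s.eventually_mem (contMDiffAt_proj_proj (D := D.dual) Φ₀).continuousAt h]
    with Φ hΦ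
  refine (SmoothVB.co_dual (s.memB hΦ) _ _).trans ?_
  refine ((s.spl Φ.proj.proj).dualB_apply Φ.snd _).trans ?_
  rw [frame_apply, map_zero, Splitting.pt_zero_core]

/-- The inverse of the trivialization of the dual given by a smooth splitting. -/
def dualInv (p : K.Tot × (A.F × B.dual.F)) : D.dual.Tot :=
  ⟨⟨p.1.proj, A.coSymm m₀ p.1.proj p.2.1⟩,
    (s.spl p.1.proj).dpt _ p.1.snd (B.dual.coSymm m₀ p.1.proj p.2.2)⟩

/-- On the frame vector `(v, φ)` the functional takes the value `y₂ v + φ(κ)`, with `κ` in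
coordinates and `y₂` the component in `B*`; this is smooth in all variables. -/
theorem contMDiffAt_dualInv {p : K.Tot × (A.F × B.dual.F)} (h : p.1.proj ∈ s.dom) :
    ContMDiffAt (K.model.prod 𝓘(ℝ, A.F × B.dual.F)) D.dual.model ∞ s.dualInv p := by
  have hm : ContMDiffAt (K.model.prod 𝓘(ℝ, A.F × B.dual.F)) I ∞
      (fun q : K.Tot × (A.F × B.dual.F) => q.1.proj) p :=
    (contMDiffAt_proj K.E).comp p contMDiffAt_fst
  have h2 : ContMDiffAt (K.model.prod 𝓘(ℝ, A.F × B.dual.F)) 𝓘(ℝ, A.F × B.dual.F) ∞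
      (fun q : K.Tot × (A.F × B.dual.F) => q.2) p := contMDiffAt_snd
  have h21 : ContMDiffAt (K.model.prod 𝓘(ℝ, A.F × B.dual.F)) 𝓘(ℝ, A.F) ∞
      (fun q : K.Tot × (A.F × B.dual.F) => q.2.1) p :=
    contDiff_fst.contMDiff.contMDiffAt.comp p h2
  have h22 : ContMDiffAt (K.model.prod 𝓘(ℝ, A.F × B.dual.F)) 𝓘(ℝ, B.dual.F) ∞
      (fun q : K.Tot × (A.F × B.dual.F) => q.2.2) p :=
    contDiff_snd.contMDiff.contMDiffAt.comp p h2
  have ha : ContMDiffAt (K.model.prod 𝓘(ℝ, A.F × B.dual.F)) A.model ∞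
      (fun q : K.Tot × (A.F × B.dual.F) =>
        (⟨q.1.proj, A.coSymm m₀ q.1.proj q.2.1⟩ : A.Tot)) p :=
    SmoothVB.contMDiffWithinAt_frame_apply hm h21 (fun q => (A.coSymm m₀ q.1.proj).toLinearMap)
      fun w => SmoothVB.contMDiffWithinAt_coSymm w (s.memA h) hm
  refine SmoothVB.contMDiffWithinAt_dual_of_frame (V := D) (Set.mem_univ _) ha
    (fun q => s.frame _) (s.frame_bijective h) (fun w => s.contMDiffWithinAt_frame ha h w)
    fun w => ?_
  obtain ⟨v, φ⟩ := w
  have hk := ((SmoothVB.contMDiffWithinAt_iff_co (V := K) (x₀ := m₀) (s.memK h)).1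
    (contMDiffAt_fst (I := K.model) (J := 𝓘(ℝ, A.F × B.dual.F)) (n := ∞) (p := p))).2
  have h3 : ContMDiffAt (K.model.prod 𝓘(ℝ, A.F × B.dual.F)) 𝓘(ℝ, ℝ) ∞
      (fun q : K.Tot × (A.F × B.dual.F) => q.2.2 v + φ (K.co m₀ q.1.proj q.1.snd)) p :=
    (h22.clm_apply contMDiffAt_const).add (φ.contMDiff.contMDiffAt.comp p hk)
  refine ContMDiffAt.congr_of_eventuallyEq h3 ?_
  filter_upwards [s.eventually_mem hm.continuousAt h] with q hq
  refine ((s.spl q.1.proj).dpt_pt _ _ _ _ _).trans ?_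
  have e1 := SmoothVB.coSymm_dual (s.memB hq) q.2.2 (B.coSymm m₀ q.1.proj v)
  rw [SmoothVB.co_coSymm (s.memB hq)] at e1
  exact congrArg₂ (· + ·) e1 (SmoothVB.coSymm_dual (s.memK hq) φ q.1.snd)

theorem dualInv_left (τ : ∀ m, S.Splitting m) {m : M} (h : m ∈ s.dom) {a : A.E m}
    (Φ : D.dual.E ⟨m, a⟩) :
    s.dualInv (⟨m, (τ m).dualK Φ⟩, (A.co m₀ m a, B.dual.co m₀ m ((s.spl m).dualB Φ))) =
      ⟨⟨m, a⟩, Φ⟩ := by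
  have hA := SmoothVB.coSymm_co (s.memA h) a
  have hB := SmoothVB.coSymm_co (V := B.dual) (x₀ := m₀) (x := m)
    (by rw [SmoothVB.base_dual]; exact s.memB h) ((s.spl m).dualB Φ)
  change (⟨⟨m, A.coSymm m₀ m (A.co m₀ m a)⟩, (s.spl m).dpt _ ((τ m).dualK Φ)
    (B.dual.coSymm m₀ m (B.dual.co m₀ m ((s.spl m).dualB Φ)))⟩ : D.dual.Tot) = _
  rw [hB, hA, (τ m).dualK_eq (s.spl m), (s.spl m).dpt_dual]

theorem dualInv_right (τ : ∀ m, S.Splitting m) {m : M} (h : m ∈ s.dom) (κ : K.E m)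
    (y : A.F × B.dual.F) :
    (⟨m, (τ m).dualK (s.dualInv (⟨m, κ⟩, y)).snd⟩ : K.Tot) = ⟨m, κ⟩ ∧
      A.co m₀ m (s.dualInv (⟨m, κ⟩, y)).proj.snd = y.1 ∧
      B.dual.co m₀ m ((s.spl m).dualB (s.dualInv (⟨m, κ⟩, y)).snd) = y.2 := by
  have hB := SmoothVB.co_coSymm (V := B.dual) (x₀ := m₀) (x := m)
    (by rw [SmoothVB.base_dual]; exact s.memB h) y.2
  refine ⟨congrArg (TotalSpace.mk m) ?_, SmoothVB.co_coSymm (s.memA h) y.1, ?_⟩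
  · exact ((τ m).dualK_eq (s.spl m) _).trans ((s.spl m).dualK_dpt _ _ _)
  · exact (congrArg (B.dual.co m₀ m) ((s.spl m).dualB_dpt _ _ _)).trans hB

/-- The trivialization of `D*_A → K` given by a smooth splitting. -/
def dualTriv (τ : ∀ m, S.Splitting m) {G : Type*} [NormedAddCommGroup G] [NormedSpace ℝ G]
    (ι : (A.F × B.dual.F) ≃L[ℝ] G) :
    Trivialization G
      (fun Φ : D.dual.Tot => (⟨Φ.proj.proj, (τ Φ.proj.proj).dualK Φ.snd⟩ : K.Tot)) where
  toFun Φ := (⟨Φ.proj.proj, (τ Φ.proj.proj).dualK Φ.snd⟩,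
    ι (A.co m₀ Φ.proj.proj Φ.proj.snd,
      B.dual.co m₀ Φ.proj.proj ((s.spl Φ.proj.proj).dualB Φ.snd)))
  invFun p := s.dualInv (p.1, ι.symm p.2)
  source := {Φ | Φ.proj.proj ∈ s.dom}
  target := {κ : K.Tot | κ.proj ∈ s.dom} ×ˢ Set.univ
  baseSet := {κ : K.Tot | κ.proj ∈ s.dom}
  map_source' Φ h := ⟨h, trivial⟩
  map_target' p h := h.1
  left_inv' := by
    rintro ⟨⟨m, a⟩, Φ⟩ h
    rw [ι.symm_apply_apply]
    exact s.dualInv_left τ h Φ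
  right_inv' := by
    rintro ⟨⟨m, κ⟩, x⟩ ⟨h, -⟩
    obtain ⟨y, rfl⟩ := ι.surjective x
    rw [ι.symm_apply_apply]
    obtain ⟨h1, h2, h3⟩ := s.dualInv_right τ h κ y
    exact Prod.ext h1 (congrArg ι (Prod.ext h2 h3))
  open_source := s.isOpen.preimage ((FiberBundle.continuous_proj A.F A.E).comp
    (FiberBundle.continuous_proj D.dual.F D.dual.E))
  open_target := (s.isOpen.preimage (FiberBundle.continuous_proj K.F K.E)).prod isOpen_univ
  open_baseSet := s.isOpen.preimage (FiberBundle.continuous_proj K.F K.E)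
  continuousOn_toFun := fun Φ h => by
    have h1 := (s.contMDiffAt_dualK τ h).continuousAt
    have h2 := (s.contMDiffAt_dualB h).continuousAt
    have h3 := ((SmoothVB.contMDiffWithinAt_iff_co (V := A) (x₀ := m₀) (s.memA h)).1
      (contMDiffAt_proj (n := ∞) (IB := A.model) D.dual.E (p := Φ))).2.continuousWithinAt
    rw [continuousWithinAt_univ] at h3
    exact (h1.prodMk (ι.continuous.continuousAt.comp (h3.prodMk h2))).continuousWithinAt
  continuousOn_invFun := fun p h => by
    have h1 := (s.contMDiffAt_dualInv (p := (p.1, ι.symm p.2)) h.1).continuousAt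
    exact (h1.comp (f := fun p : K.Tot × G => (p.1, ι.symm p.2)) (continuous_fst.prodMk
      (ι.symm.continuous.comp continuous_snd)).continuousAt).continuousWithinAt
  source_eq := rfl
  target_eq := rfl
  proj_toFun Φ h := rfl

end SmoothSplitting

end DVB

/-! ### The dual double vector bundle -/

namespace DVB

open Filter Topology

variable {EM : Type*} [NormedAddCommGroup EM] [NormedSpace ℝ EM]
    {HM : Type*} [TopologicalSpace HM] {I : ModelWithCorners ℝ EM HM}
    {M : Type*} [TopologicalSpace M] [ChartedSpace HM M]
    {A B K : SmoothVB I M} {D : SmoothVB A.model A.Tot} {S : DVB A B K D}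

theorem exists_dual_locTriv [IsManifold I ∞ M] (τ : ∀ m, S.Splitting m) (κ₀ : K.Tot) :
    ∃ (k : ℕ) (e : Trivialization (EuclideanSpace ℝ (Fin k))
      (fun Φ : D.dual.Tot => (⟨Φ.proj.proj, (τ Φ.proj.proj).dualK Φ.snd⟩ : K.Tot))),
    κ₀ ∈ e.baseSet ∧
    ContMDiffOn D.dual.model (K.model.prod (𝓡 k)) ∞ e e.source ∧
    ContMDiffOn (K.model.prod (𝓡 k)) D.dual.model ∞ e.toOpenPartialHomeomorph.symm e.target ∧
    (∀ {m : M} (κ : K.E m), (⟨m, κ⟩ : K.Tot) ∈ e.baseSet →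
      (e ⟨⟨m, 0⟩, (τ m).dpt 0 κ 0⟩).2 = 0) ∧
    (∀ {m : M} {a a' : A.E m} (Φ : D.dual.E ⟨m, a⟩) (Φ' : D.dual.E ⟨m, a'⟩),
      (τ m).dualK Φ = (τ m).dualK Φ' → (⟨m, (τ m).dualK Φ⟩ : K.Tot) ∈ e.baseSet →
      (e ⟨⟨m, a + a'⟩, (τ m).dualAdd Φ Φ'⟩).2 = (e ⟨⟨m, a⟩, Φ⟩).2 + (e ⟨⟨m, a'⟩, Φ'⟩).2) ∧
    (∀ {m : M} {a : A.E m} (r : ℝ) (Φ : D.dual.E ⟨m, a⟩),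
      (⟨m, (τ m).dualK Φ⟩ : K.Tot) ∈ e.baseSet →
      (e ⟨⟨m, r • a⟩, (τ m).dualSMul r Φ⟩).2 = r • (e ⟨⟨m, a⟩, Φ⟩).2) := by
  obtain ⟨s⟩ := S.nonempty_smoothSplitting κ₀.proj
  let ι : (A.F × B.dual.F) ≃L[ℝ] EuclideanSpace ℝ (Fin (Module.finrank ℝ (A.F × B.dual.F))) :=
    ContinuousLinearEquiv.ofFinrankEq finrank_euclideanSpace_fin.symm
  have hι : ∀ {m : M} {a : A.E m} (Φ : D.dual.E ⟨m, a⟩), (s.dualTriv τ ι ⟨⟨m, a⟩, Φ⟩).2 =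
      ι (A.co κ₀.proj m a, B.dual.co κ₀.proj m ((s.spl m).dualB Φ)) := fun _ => rfl
  refine ⟨_, s.dualTriv τ ι, s.mem, fun Φ h => ?_, fun p h => ?_, fun {m} κ h => ?_,
    fun {m a a'} Φ Φ' hΦ h => ?_, fun {m a} r Φ h => ?_⟩
  · have h3 := ((SmoothVB.contMDiffWithinAt_iff_co (V := A) (x₀ := κ₀.proj) (s.memA h)).1
      (contMDiffAt_proj (n := ∞) (IB := A.model) D.dual.E (p := Φ))).2
    exact ((s.contMDiffAt_dualK τ h).prodMk (ι.contDiff.contMDiff.contMDiffAt.comp Φ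
      (ContMDiffAt.prodMk_space h3 (s.contMDiffAt_dualB h)))).contMDiffWithinAt
  · exact (ContMDiffAt.comp p (s.contMDiffAt_dualInv (p := (p.1, ι.symm p.2)) h.1)
      (contMDiffAt_fst.prodMk (ι.symm.contDiff.contMDiff.contMDiffAt.comp p
        contMDiffAt_snd))).contMDiffWithinAt
  -- All splittings agree over `a = 0`, where they give the zero section of `D → B`; so the `B*`
  -- component also vanishes in the local splitting.
  · have h1 : (s.spl m).dualB ((τ m).dpt 0 κ 0) = 0 := by
      refine ContinuousLinearMap.ext fun b => ?_
      obtain ⟨γ, hγ⟩ := (τ m).exists_pt_of_prB ((s.spl m).sec 0 b) ((s.spl m).prB_sec 0 b)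
      have hγ0 : γ = 0 := by
        have h2 := (s.spl m).zeroB_eq b
        rw [Splitting.pt_zero_core, hγ, (τ m).zeroB_eq] at h2
        exact ((τ m).pt_inj h2).2.symm
      rw [Splitting.dualB_apply, hγ, Splitting.dpt_pt, hγ0, zero_apply, zero_apply, zero_add]
    rw [hι, h1, map_zero, map_zero]
    exact map_zero ι
  · rw [(τ m).dualAdd_eq (s.spl m) Φ Φ' hΦ, hι, hι, hι, ← map_add, Prod.mk_add_mk, ← map_add,
      ← map_add, Splitting.dualAdd, Splitting.dualB_dpt]
  · rw [(τ m).dualSMul_eq (s.spl m) r Φ, hι, hι, ← map_smul, Prod.smul_mk, ← map_smul,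
      ← map_smul, Splitting.dualSMul, Splitting.dualB_dpt]

/-- Over the zero section of `A` a core functional takes on a frame vector the value of `β` on its
`B` component, which is smooth. -/
theorem contMDiff_dual_core [IsManifold I ∞ M] (τ : ∀ m, S.Splitting m) :
    ContMDiff B.dual.model D.dual.model ∞
      (fun β : B.dual.Tot => (⟨⟨β.proj, 0⟩, (τ β.proj).dpt 0 0 β.snd⟩ : D.dual.Tot)) := by
  intro β₀
  obtain ⟨s⟩ := S.nonempty_smoothSplitting β₀.proj
  have hp : ContMDiffAt B.dual.model I ∞ (fun β : B.dual.Tot => β.proj) β₀ :=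
    contMDiffAt_proj B.dual.E
  have hz : ContMDiffAt B.dual.model A.model ∞ (fun β : B.dual.Tot => (⟨β.proj, 0⟩ : A.Tot)) β₀ :=
    (contMDiff_zeroSection (n := ∞) (IB := I) ℝ A.E).contMDiffAt.comp β₀ hp
  refine SmoothVB.contMDiffWithinAt_dual_of_frame (V := D) (Set.mem_univ _) hz
    (fun β => s.frame _) (s.frame_bijective s.mem)
    (fun w => s.contMDiffWithinAt_frame hz s.mem w) fun w => ?_
  refine SmoothVB.contMDiffWithinAt_dual_apply (V := B) (Φ := fun β => β)
    (u := fun β => ⟨β.proj, B.coSymm β₀.proj β.proj w.1⟩) (Set.mem_univ _)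
    contMDiffWithinAt_id (SmoothVB.contMDiffWithinAt_coSymm w.1 (B.mem_base _) hp) fun β _ => ?_
  refine ⟨β.proj, β.snd, _, rfl, rfl, ?_⟩
  refine ((τ β.proj).dpt_zero_zero_apply β.snd _).trans ?_
  exact congrArg β.snd ((s.spl β.proj).prB_pt 0 _ _)

/-- The dual over `A` of a double vector bundle. -/
def dualDVB [IsManifold I ∞ M] (τ : ∀ m, S.Splitting m) : DVB A K B D.dual where
  prB {m a} := (τ m).dualK
  zeroB {m} κ := (τ m).dpt 0 κ 0
  addB {m a a'} Φ Φ' _ := (τ m).dualAdd Φ Φ'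
  smulB {m a} r Φ := (τ m).dualSMul r Φ
  prB_zeroB {m} κ := (τ m).dualK_dpt _ _ _
  prB_addB {m a a'} Φ Φ' _ := (τ m).dualK_dpt _ _ _
  prB_smulB {m a} r Φ := (τ m).dualK_dpt _ _ _
  locTriv κ₀ := by
    obtain ⟨k, e, h1, h2, h3, h4, h5, h6⟩ := exists_dual_locTriv τ κ₀
    exact ⟨k, e, h1, h2, h3, h4, h5, h6⟩
  addB_add {m a a'} d₁ d₂ d₃ d₄ h h' := by
    rw [Splitting.dualAdd, Splitting.dualAdd, Splitting.dualAdd, ← Splitting.dpt_add, map_add,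
      map_add, map_add]
    congr 1
    abel
  addB_smul {m _ _} r d d' h := by
    rw [Splitting.dualAdd, Splitting.dualAdd, ← Splitting.dpt_smul, map_smul, map_smul, map_smul,
      smul_add]
  smulB_add {m _} r d d' := by
    rw [Splitting.dualSMul, Splitting.dualSMul, Splitting.dualSMul, ← Splitting.dpt_add, map_add,
      map_add, smul_add]
  smulB_smul {m a} r s d := by
    rw [Splitting.dualSMul, Splitting.dualSMul, ← Splitting.dpt_smul, map_smul, map_smul,
      smul_comm]
  core {m} := (τ m).dptLin 0 ∘ₗ LinearMap.inr ℝ (K.E m) (B.dual.E m)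
  core_injective m β β' h :=
    ((τ m).dpt_inj (a := 0) (κ := 0) (κ' := 0) (β := β) (β' := β') h).2
  range_core m := by
    ext Φ
    rw [LinearMap.mem_range, LinearMap.mem_ker]
    constructor
    · rintro ⟨β, rfl⟩
      exact (τ m).dualK_dpt 0 0 β
    · intro h
      refine ⟨(τ m).dualB Φ, ?_⟩
      have := (τ m).dpt_dual Φ
      rw [h] at this
      exact this
  core_smooth := contMDiff_dual_core τ

theorem isDual_dualDVB [IsManifold I ∞ M] (τ : ∀ m, S.Splitting m) : S.IsDual (dualDVB τ) where
  proj {m _} Φ γ := (τ m).dualK_apply Φ γ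
  add {m _ _} Φ Φ' h d d' hd := (τ m).dualAdd_apply Φ Φ' h d d' hd
  smul {m _} r Φ d := (τ m).dualSMul_apply r Φ d
  core {m} β d := (τ m).dpt_zero_zero_apply β d

end DVB

/-! ### An involution in a splitting -/

namespace InvolutiveDVB

open Filter Topology DVB

variable {EM : Type*} [NormedAddCommGroup EM] [NormedSpace ℝ EM]
    {HM : Type*} [TopologicalSpace HM] {I : ModelWithCorners ℝ EM HM}
    {M : Type*} [TopologicalSpace M] [ChartedSpace HM M]
    {Q B : SmoothVB I M} {D : SmoothVB Q.model Q.Tot} (S : InvolutiveDVB Q B D)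

/-- The involution, with values in the fibre over a point equal to `π₂(d)`. -/
def invTo {m : M} {q p : Q.E m} (d : D.E ⟨m, q⟩) (h : S.prB d = p) : D.E ⟨m, p⟩ :=
  cast (by rw [h]) (S.inv d)

variable {S} {m : M}

theorem mk_invTo {q p : Q.E m} (d : D.E ⟨m, q⟩) (h : S.prB d = p) :
    (⟨⟨m, p⟩, S.invTo d h⟩ : D.Tot) = ⟨⟨m, S.prB d⟩, S.inv d⟩ := by
  subst h; rfl

theorem invTo_eq_iff {q p : Q.E m} (d : D.E ⟨m, q⟩) (h : S.prB d = p) (x : D.E ⟨m, p⟩) :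
    S.invTo d h = x ↔ (⟨⟨m, S.prB d⟩, S.inv d⟩ : D.Tot) = ⟨⟨m, p⟩, x⟩ := by
  rw [← mk_invTo d h, TotalSpace.mk_inj]

theorem prB_invTo {q p : Q.E m} (d : D.E ⟨m, q⟩) (h : S.prB d = p) :
    S.prB (S.invTo d h) = q := by
  subst h; exact S.prB_inv d

theorem invTo_invTo {q p : Q.E m} (d : D.E ⟨m, q⟩) (h : S.prB d = p) :
    S.invTo (S.invTo d h) (prB_invTo d h) = d := by
  subst h
  rw [invTo_eq_iff]
  exact S.inv_inv d

theorem invTo_add {q p p' : Q.E m} (d d' : D.E ⟨m, q⟩) (h : S.prB d = p) (h' : S.prB d' = p') :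
    S.invTo (d + d') (p := p + p') (by rw [map_add, h, h']) =
      S.addB (S.invTo d h) (S.invTo d' h') ((prB_invTo d h).trans (prB_invTo d' h').symm) := by
  subst h h'
  rw [invTo_eq_iff]
  exact S.inv_add d d'

theorem invTo_smul {q p : Q.E m} (r : ℝ) (d : D.E ⟨m, q⟩) (h : S.prB d = p) :
    S.invTo (r • d) (p := r • p) (by rw [map_smul, h]) = S.smulB r (S.invTo d h) := by
  subst h
  rw [invTo_eq_iff]
  exact S.inv_smul r d

theorem invTo_addB {q q' p : Q.E m} (d : D.E ⟨m, q⟩) (d' : D.E ⟨m, q'⟩) (h : S.prB d = p)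
    (h' : S.prB d' = p) :
    S.invTo (S.addB d d' (h.trans h'.symm)) ((S.prB_addB d d' _).trans h) =
      S.invTo d h + S.invTo d' h' := by
  rw [invTo_eq_iff]
  exact S.inv_addB d d' _ _ _ (mk_invTo d h).symm (mk_invTo d' h').symm

theorem invTo_core (β : B.dual.E m) : S.invTo (S.core β) (S.prB_core β) = S.core (-β) := by
  rw [invTo_eq_iff]
  exact S.inv_core β

theorem invTo_congr {q p p' : Q.E m} (σ : S.Splitting m) {d : D.E ⟨m, q⟩} {γ : B.dual.E m}
    (hp : p = p') (h : S.prB d = p) (h' : S.prB d = p') (hd : S.invTo d h = σ.pt p q γ) :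
    S.invTo d h' = σ.pt p' q γ := by
  subst hp; exact hd

/-- Since `𝓘` turns `+₁` into `+₂`, the core component `γ` of `𝓘(0_q)` satisfies `γ = γ + γ`. -/
theorem invTo_zero (σ : S.Splitting m) (q : Q.E m) :
    S.invTo (0 : D.E ⟨m, q⟩) (map_zero S.prB) = σ.pt 0 q 0 := by
  obtain ⟨γ, hγ⟩ := σ.exists_pt_of_prB _ (prB_invTo (0 : D.E ⟨m, q⟩) (map_zero S.prB))
  have h1 := invTo_add (0 : D.E ⟨m, q⟩) 0 (map_zero S.prB) (map_zero S.prB)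
  have h2 : S.addB (S.invTo (0 : D.E ⟨m, q⟩) (map_zero S.prB)) (S.invTo (0 : D.E ⟨m, q⟩)
      (map_zero S.prB)) rfl = σ.pt (0 + 0) q (γ + γ) :=
    (addB_congr hγ hγ _ (by rw [σ.prB_pt])).trans (σ.addB_pt _ _ _ _ _ _)
  have h3 := invTo_congr σ (add_zero (0 : Q.E m)) _ (by rw [add_zero, map_zero]) (h1.trans h2)
  have h4 : S.invTo (0 + 0 : D.E ⟨m, q⟩) (p := 0) (by rw [add_zero, map_zero]) =
      S.invTo (0 : D.E ⟨m, q⟩) (map_zero S.prB) := by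
    congr 1; rw [add_zero]
  rw [h4, hγ] at h3
  have h5 := (σ.pt_inj h3).2
  rw [hγ, left_eq_add.1 h5]

theorem invTo_coreA (σ : S.Splitting m) (q : Q.E m) (β : B.dual.E m) :
    S.invTo (S.coreA q β) (prB_coreA q β) = σ.pt 0 q (-β) := by
  have key : ∀ {q q' p : Q.E m} (_ : q = q') (hc : D.E ⟨m, q⟩ = D.E ⟨m, q'⟩) (d : D.E ⟨m, q⟩)
      (h : S.prB d = p) (h' : S.prB (cast hc d) = p), S.invTo (cast hc d) h' = S.invTo d h := by
    rintro q _ p rfl hc d h h'; rfl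
  refine (key (add_zero q) _ _ ((S.prB_addB _ _ _).trans (map_zero S.prB)) _).trans ?_
  rw [invTo_addB _ _ (map_zero S.prB) (S.prB_core β), invTo_zero σ, invTo_core, σ.core_eq,
    ← σ.pt_add, add_zero, zero_add]

/-- The component of the involution in a splitting. -/
def form (σ : S.Splitting m) (q p : Q.E m) : B.dual.E m :=
  (σ.exists_pt_of_prB _ (prB_invTo (σ.sec q p) (σ.prB_sec q p))).choose

theorem invTo_sec (σ : S.Splitting m) (q p : Q.E m) :
    S.invTo (σ.sec q p) (σ.prB_sec q p) = σ.pt p q (form σ q p) :=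
  (σ.exists_pt_of_prB _ (prB_invTo (σ.sec q p) (σ.prB_sec q p))).choose_spec

/-- The normal form of an involution. Writing the element as `σ.sec q p +₁ (0_q +₂ γ̄)`, the second
summand goes to `(0, q, -γ)`, because the core morphism is `-id`. -/
theorem invTo_pt (σ : S.Splitting m) (q p : Q.E m) (γ : B.dual.E m) :
    S.invTo (σ.pt q p γ) (σ.prB_pt q p γ) = σ.pt p q (form σ q p - γ) := by
  have h1 := invTo_add (σ.sec q p) (S.coreA q γ) (σ.prB_sec q p) (prB_coreA q γ)
  have h2 := h1.trans ((addB_congr (invTo_sec σ q p) (invTo_coreA σ q γ) _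
    (by rw [σ.prB_pt, σ.prB_pt])).trans (σ.addB_pt _ _ _ _ _ _))
  rw [← sub_eq_add_neg] at h2
  exact invTo_congr σ (add_zero p) _ (σ.prB_pt q p γ) h2

/-- Applying `invTo_pt` twice to `(q, p, 0)` returns core component `form σ p q - form σ q p`, which
is zero because `𝓘² = id`. -/
theorem form_symm (σ : S.Splitting m) (q p : Q.E m) : form σ q p = form σ p q := by
  have key : ∀ (x : D.E ⟨m, p⟩) (hx : S.prB x = q) (γ : B.dual.E m), x = σ.pt p q γ →
      S.invTo x hx = σ.pt q p (form σ p q - γ) := by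
    rintro x hx γ rfl; exact invTo_pt σ p q γ
  have h1 := invTo_invTo (σ.sec q p) (σ.prB_sec q p)
  rw [key _ _ _ (invTo_sec σ q p), ← σ.pt_zero_core] at h1
  exact (sub_eq_zero.1 (σ.pt_inj h1).2).symm

theorem form_add (σ : S.Splitting m) (q p p' : Q.E m) :
    form σ q (p + p') = form σ q p + form σ q p' := by
  have h1 := invTo_add (σ.sec q p) (σ.sec q p') (σ.prB_sec q p) (σ.prB_sec q p')
  have h2 := h1.trans ((addB_congr (invTo_sec σ q p) (invTo_sec σ q p') _
    (by rw [σ.prB_pt, σ.prB_pt])).trans (σ.addB_pt _ _ _ _ _ _))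
  have h3 : S.invTo (σ.sec q p + σ.sec q p') (p := p + p')
      (by rw [map_add, σ.prB_sec, σ.prB_sec]) = S.invTo (σ.sec q (p + p')) (σ.prB_sec q _) := by
    congr 1; rw [map_add]
  rw [h3, invTo_sec] at h2
  exact (σ.pt_inj h2).2

theorem form_smul (σ : S.Splitting m) (q : Q.E m) (r : ℝ) (p : Q.E m) :
    form σ q (r • p) = r • form σ q p := by
  have h1 := invTo_smul r (σ.sec q p) (σ.prB_sec q p)
  rw [invTo_sec, σ.smulB_pt] at h1
  have h3 : S.invTo (r • σ.sec q p) (p := r • p) (by rw [map_smul, σ.prB_sec]) =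
      S.invTo (σ.sec q (r • p)) (σ.prB_sec q _) := by
    congr 1; rw [map_smul]
  rw [h3, invTo_sec] at h1
  exact (σ.pt_inj h1).2

theorem form_zero (σ : S.Splitting m) (q : Q.E m) : form σ q 0 = 0 := by
  have := form_smul σ q 0 0
  rwa [zero_smul, zero_smul] at this

/-- The dual pairing in a splitting. -/
theorem dpt_add_dpt_invTo (σ : S.Splitting m) {q q' : Q.E m} (κ : B.E m) (β β' : Q.dual.E m)
    (d : D.E ⟨m, q⟩) (h : S.prB d = q') :
    σ.dpt q κ β d + σ.dpt q' κ β' (S.invTo d h) = β q' + β' q + form σ q q' κ := by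
  obtain ⟨p, γ, rfl⟩ := σ.exists_eq_pt d
  have hp : p = q' := by rw [← h, σ.prB_pt]
  subst hp
  -- The core component of `d` enters as `γ κ` and as `-γ κ` and cancels; this is why the pairing
  -- does not depend on `d`.
  rw [invTo_pt, Splitting.dpt_pt, Splitting.dpt_pt, sub_apply]
  abel

end InvolutiveDVB

/-! ### The metric dual to an involution -/

namespace InvolutiveDVB

open Filter Topology DVB

variable {EM : Type*} [NormedAddCommGroup EM] [NormedSpace ℝ EM]
    {HM : Type*} [TopologicalSpace HM] {I : ModelWithCorners ℝ EM HM}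
    {M : Type*} [TopologicalSpace M] [ChartedSpace HM M]
    {Q B : SmoothVB I M} {D : SmoothVB Q.model Q.Tot} {S : InvolutiveDVB Q B D}

/-- The metric on the dual of an involutive double vector bundle. -/
def dualPair (τ : ∀ m, S.Splitting m) {m : M} {q q' : Q.E m} (e : D.dual.E ⟨m, q⟩)
    (e' : D.dual.E ⟨m, q'⟩) : ℝ :=
  e ((τ m).sec q q') + e' (S.invTo ((τ m).sec q q') ((τ m).prB_sec q q'))

theorem dualPair_dpt (τ : ∀ m, S.Splitting m) {m : M} (q q' : Q.E m) (κ : B.E m)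
    (β β' : Q.dual.E m) :
    dualPair τ ((τ m).dpt q κ β) ((τ m).dpt q' κ β') = β q' + β' q + form (τ m) q q' κ :=
  dpt_add_dpt_invTo (τ m) κ β β' _ _

theorem dualPair_eq (τ : ∀ m, S.Splitting m) {m : M} {q q' : Q.E m} (e : D.dual.E ⟨m, q⟩)
    (e' : D.dual.E ⟨m, q'⟩) (h : (τ m).dualK e = (τ m).dualK e') (d : D.E ⟨m, q⟩)
    (hd : S.prB d = q') : dualPair τ e e' = e d + e' (S.invTo d hd) := by
  obtain ⟨κ, β, rfl⟩ := (τ m).exists_dpt e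
  obtain ⟨κ', β', rfl⟩ := (τ m).exists_dpt e'
  rw [Splitting.dualK_dpt, Splitting.dualK_dpt] at h
  subst h
  rw [dualPair_dpt, dpt_add_dpt_invTo]

/-- The pairing `dualPair` as a function on the product of the total spaces. -/
def dualPairTot (τ : ∀ m, S.Splitting m) (z : D.dual.Tot × D.dual.Tot) : ℝ :=
  Classical.epsilon fun c => ∃ (m : M) (q q' : Q.E m) (e : D.dual.E ⟨m, q⟩)
    (e' : D.dual.E ⟨m, q'⟩), z = (⟨⟨m, q⟩, e⟩, ⟨⟨m, q'⟩, e'⟩) ∧ c = dualPair τ e e'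

/-- `dualPair` is typed only for elements over one point of `M`. There the pair of total space
elements determines all the data, hence the chosen value. -/
theorem dualPairTot_mk (τ : ∀ m, S.Splitting m) {m : M} {q q' : Q.E m} (e : D.dual.E ⟨m, q⟩)
    (e' : D.dual.E ⟨m, q'⟩) :
    dualPairTot τ (⟨⟨m, q⟩, e⟩, ⟨⟨m, q'⟩, e'⟩) = dualPair τ e e' := by
  obtain ⟨m₁, q₁, q₁', e₁, e₁', h, hc⟩ := Classical.epsilon_spec
    (p := fun c => ∃ (m₁ : M) (q₁ q₁' : Q.E m₁) (e₁ : D.dual.E ⟨m₁, q₁⟩)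
      (e₁' : D.dual.E ⟨m₁, q₁'⟩), (((⟨⟨m, q⟩, e⟩, ⟨⟨m, q'⟩, e'⟩) : D.dual.Tot × D.dual.Tot) =
        (⟨⟨m₁, q₁⟩, e₁⟩, ⟨⟨m₁, q₁'⟩, e₁'⟩)) ∧ c = dualPair τ e₁ e₁')
    ⟨_, m, q, q', e, e', rfl, rfl⟩
  refine Eq.trans hc ?_
  cases h
  rfl

/-- By `dualPair_eq` any `d` over the two base points computes the pairing. A smooth frame provides
one depending smoothly on the pair, and then `e d` and `e' (𝓘 d)` are smooth. -/
theorem contMDiffOn_dualPairTot [IsManifold I ∞ M] (τ : ∀ m, S.Splitting m) :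
    ContMDiffOn (D.dual.model.prod D.dual.model) 𝓘(ℝ, ℝ) ∞ (dualPairTot τ)
      {z | (⟨z.1.proj.proj, (τ z.1.proj.proj).dualK z.1.snd⟩ : B.Tot) =
        ⟨z.2.proj.proj, (τ z.2.proj.proj).dualK z.2.snd⟩} := by
  intro z₀ hz₀
  obtain ⟨s⟩ := S.nonempty_smoothSplitting z₀.1.proj.proj
  set m₀ := z₀.1.proj.proj
  let J := D.dual.model.prod D.dual.model
  let dom : Set (D.dual.Tot × D.dual.Tot) := {z | z.1.proj.proj ∈ s.dom}
  have hbase : ContMDiff J Q.model ∞ (fun z : D.dual.Tot × D.dual.Tot => z.1.proj) :=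
    (contMDiff_proj D.dual.E).comp contMDiff_fst
  have hbase' : ContMDiff J Q.model ∞ (fun z : D.dual.Tot × D.dual.Tot => z.2.proj) :=
    (contMDiff_proj D.dual.E).comp contMDiff_snd
  have hdom : dom ∈ 𝓝 z₀ := (s.isOpen.preimage
    ((FiberBundle.continuous_proj Q.F Q.E).comp hbase.continuous)).mem_nhds s.mem
  refine (contMDiffWithinAt_inter hdom).1 ?_
  set t : Set (D.dual.Tot × D.dual.Tot) := {z | (⟨z.1.proj.proj, (τ z.1.proj.proj).dualK z.1.snd⟩ :
    B.Tot) = ⟨z.2.proj.proj, (τ z.2.proj.proj).dualK z.2.snd⟩} ∩ dom with ht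
  have hz₀t : z₀ ∈ t := ⟨hz₀, s.mem⟩
  have hm₀ : z₀.2.proj.proj ∈ Q.base m₀ := by
    have : z₀.2.proj.proj = m₀ := (congrArg TotalSpace.proj hz₀).symm
    rw [this]; exact Q.mem_base _
  let d : ∀ z : D.dual.Tot × D.dual.Tot, D.E z.1.proj := fun z =>
    s.frame z.1.proj (Q.co m₀ z.2.proj.proj z.2.proj.snd, 0)
  have hco : ContMDiffWithinAt J 𝓘(ℝ, Q.F) ∞
      (fun z : D.dual.Tot × D.dual.Tot => Q.co m₀ z.2.proj.proj z.2.proj.snd) t z₀ :=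
    ((SmoothVB.contMDiffWithinAt_iff_co (V := Q) (x₀ := m₀)
      (f := fun z : D.dual.Tot × D.dual.Tot => z.2.proj) (y₀ := z₀) (s := t) hm₀).1
      hbase'.contMDiffAt.contMDiffWithinAt).2
  have hd : ContMDiffWithinAt J D.model ∞ (fun z => (⟨z.1.proj, d z⟩ : D.Tot)) t z₀ :=
    SmoothVB.contMDiffWithinAt_frame_apply hbase.contMDiffAt.contMDiffWithinAt
      (hco.prodMk_space contMDiffWithinAt_const) (fun z => s.frame z.1.proj)
      fun w => s.contMDiffWithinAt_frame hbase.contMDiffAt.contMDiffWithinAt s.mem w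
  have hId : ContMDiffWithinAt J D.model ∞
      (fun z => (⟨⟨z.1.proj.proj, S.prB (d z)⟩, S.inv (d z)⟩ : D.Tot)) t z₀ :=
    (S.inv_smooth ⟨z₀.1.proj, d z₀⟩).comp_contMDiffWithinAt z₀ hd
  have h1 : ContMDiffWithinAt J 𝓘(ℝ, ℝ) ∞
      (fun z : D.dual.Tot × D.dual.Tot => z.1.snd (d z)) t z₀ :=
    SmoothVB.contMDiffWithinAt_dual_apply (V := D) hz₀t
      contMDiff_fst.contMDiffAt.contMDiffWithinAt hd
      fun z _ => ⟨z.1.proj, z.1.snd, d z, rfl, rfl, rfl⟩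
  -- The term `e' (𝓘 d)` is well typed only where `d` lies over the base point of `e'`; the
  -- difference is defined everywhere and equals it on `t`.
  have h2 : ContMDiffWithinAt J 𝓘(ℝ, ℝ) ∞
      (fun z : D.dual.Tot × D.dual.Tot => dualPairTot τ z - z.1.snd (d z)) t z₀ := by
    refine SmoothVB.contMDiffWithinAt_dual_apply (V := D) hz₀t
      contMDiff_snd.contMDiffAt.contMDiffWithinAt hId ?_
    rintro ⟨⟨⟨m, q⟩, e⟩, ⟨⟨m', q'⟩, e'⟩⟩ ⟨hz, hm⟩
    obtain ⟨k1, k2⟩ := TotalSpace.mk.inj hz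
    dsimp only at k1
    subst k1
    have hκ : (τ m).dualK e = (τ m).dualK e' := eq_of_heq k2
    have hdz : S.prB (d (⟨⟨m, q⟩, e⟩, ⟨⟨m, q'⟩, e'⟩)) = q' := by
      refine ((s.spl m).prB_pt q _ _).trans ?_
      exact SmoothVB.coSymm_co (s.memA hm) q'
    refine ⟨⟨m, q'⟩, e', S.invTo (d (⟨⟨m, q⟩, e⟩, ⟨⟨m, q'⟩, e'⟩)) hdz, rfl,
      (mk_invTo _ hdz).symm, ?_⟩
    dsimp only
    rw [dualPairTot_mk, dualPair_eq τ e e' hκ _ hdz, add_sub_cancel_left]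
  exact (h1.add h2).congr (fun z _ => (add_sub_cancel _ _).symm) (add_sub_cancel _ _).symm

/-- The metric double vector bundle dual to an involutive double vector bundle. -/
def dualMetric [IsManifold I ∞ M] (τ : ∀ m, S.Splitting m) : MetricDVB Q B D.dual where
  toDVB := dualDVB τ
  pair e e' _ := dualPair τ e e'
  pair_smooth := ⟨dualPairTot τ, contMDiffOn_dualPairTot τ, fun e e' _ => dualPairTot_mk τ e e'⟩
  pair_symm {m q q'} e e' h := by
    have hT := isDual_dualDVB τ
    obtain ⟨κ, β, rfl⟩ := (τ m).exists_dpt e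
    obtain ⟨κ', β', rfl⟩ := (τ m).exists_dpt e'
    rw [(τ m).prB_dpt hT, (τ m).prB_dpt hT] at h
    subst h
    rw [dualPair_dpt, dualPair_dpt, form_symm]
    abel
  pair_addB {m q₁ q₂ q'} e₁ e₂ e' h₁ h₂ := by
    have hT := isDual_dualDVB τ
    obtain ⟨κ, β, rfl⟩ := (τ m).exists_dpt e'
    obtain ⟨κ₁, β₁, rfl⟩ := (τ m).exists_dpt e₁
    obtain ⟨κ₂, β₂, rfl⟩ := (τ m).exists_dpt e₂
    rw [(τ m).prB_dpt hT, (τ m).prB_dpt hT] at h₁ h₂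
    subst h₁ h₂
    rw [(τ m).addB_dpt hT, dualPair_dpt, dualPair_dpt, dualPair_dpt, form_symm,
      form_symm (τ m) q₁, form_symm (τ m) q₂, form_add, map_add, add_apply, add_apply]
    abel
  pair_smulB {m q q'} r e e' h := by
    have hT := isDual_dualDVB τ
    obtain ⟨κ, β, rfl⟩ := (τ m).exists_dpt e
    obtain ⟨κ', β', rfl⟩ := (τ m).exists_dpt e'
    rw [(τ m).prB_dpt hT, (τ m).prB_dpt hT] at h
    subst h
    rw [(τ m).smulB_dpt hT, dualPair_dpt, dualPair_dpt, form_symm, form_symm (τ m) q, form_smul,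
      map_smul, smul_apply, smul_apply, mul_add, mul_add]
    rfl
  pair_nondeg {m q} e he := by
    have hT := isDual_dualDVB τ
    obtain ⟨κ, β, rfl⟩ := (τ m).exists_dpt e
    -- Testing with `q' = 0` gives `β' q = 0` for all `β'`, so `q = 0`; testing with `β' = 0` then
    -- gives `β = 0`.
    have he' : ∀ (q' : Q.E m) (β' : Q.dual.E m), β q' + β' q + form (τ m) q q' κ = 0 := by
      intro q' β'
      rw [← dualPair_dpt]
      exact he ((τ m).dpt q' κ β') (by rw [(τ m).prB_dpt hT, (τ m).prB_dpt hT])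
    have hq : q = 0 := SmoothVB.ext_dual fun β' => by
      have := he' 0 β'
      rw [form_zero, map_zero, zero_apply, zero_add, add_zero] at this
      rw [this, map_zero]
    subst hq
    have hβ : β = 0 := ContinuousLinearMap.ext fun q' => by
      have := he' q' 0
      rwa [form_symm, form_zero, zero_apply, zero_apply, add_zero, add_zero] at this
    rw [hβ, (τ m).prB_dpt hT]
    rfl
  pair_add {m q q'} e₁ e₂ f₁ f₂ h₁ h₂ := by
    have hT := isDual_dualDVB τ
    obtain ⟨κ₁, β₁, rfl⟩ := (τ m).exists_dpt e₁
    obtain ⟨κ₂, β₂, rfl⟩ := (τ m).exists_dpt e₂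
    obtain ⟨κ₁', β₁', rfl⟩ := (τ m).exists_dpt f₁
    obtain ⟨κ₂', β₂', rfl⟩ := (τ m).exists_dpt f₂
    rw [(τ m).prB_dpt hT, (τ m).prB_dpt hT] at h₁ h₂
    subst h₁ h₂
    rw [← Splitting.dpt_add, ← Splitting.dpt_add, dualPair_dpt, dualPair_dpt, dualPair_dpt,
      map_add, add_apply, add_apply]
    abel
  pair_smul {m q q'} r e f h := by
    have hT := isDual_dualDVB τ
    obtain ⟨κ, β, rfl⟩ := (τ m).exists_dpt e
    obtain ⟨κ', β', rfl⟩ := (τ m).exists_dpt f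
    rw [(τ m).prB_dpt hT, (τ m).prB_dpt hT] at h
    subst h
    rw [← Splitting.dpt_smul, ← Splitting.dpt_smul, dualPair_dpt, dualPair_dpt, map_smul,
      smul_apply, smul_apply, mul_add, mul_add]
    rfl
  pair_core {m q} e t := by
    have hT := isDual_dualDVB τ
    obtain ⟨κ, β, rfl⟩ := (τ m).exists_dpt e
    rw [((τ m).dual hT).coreB_eq, (τ m).dual_pt, (τ m).prB_dpt hT, dualPair_dpt, form_zero,
      map_zero, zero_apply, zero_add, add_zero]

theorem isDualMetric_dualMetric [IsManifold I ∞ M] (τ : ∀ m, S.Splitting m) :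
    S.IsDualMetric (dualMetric τ) where
  isDual := isDual_dualDVB τ
  pair_eq {_ _} d e₁ e₂ h := dualPair_eq τ e₁ e₂ h d rfl

theorem exists_prB_eq [IsManifold I ∞ M] (S : DVB Q Q B D) {m : M} (q p : Q.E m) :
    ∃ d : D.E ⟨m, q⟩, S.prB d = p := by
  obtain ⟨s⟩ := S.nonempty_smoothSplitting m
  exact ⟨(s.spl m).sec q p, (s.spl m).prB_sec q p⟩

theorem IsDualMetric.unique [IsManifold I ∞ M] {T T' : MetricDVB Q B D.dual}
    (hT : S.IsDualMetric T) (hT' : S.IsDualMetric T') : T = T' := by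
  have h1 : T.toDVB = T'.toDVB :=
    hT.isDual.unique (fun m => (S.nonempty_smoothSplitting m).some.spl m) hT'.isDual
  have h2 : ∀ {m : M} {q q' : Q.E m} (e : D.dual.E ⟨m, q⟩) (e' : D.dual.E ⟨m, q'⟩) (h h'),
      T.pair e e' h = T'.pair e e' h' := by
    intro m q q' e e' h h'
    obtain ⟨d, rfl⟩ := exists_prB_eq S.toDVB q q'
    rw [hT.pair_eq d, hT'.pair_eq d]
  cases T
  cases T'
  dsimp only at h1 h2
  subst h1
  congr 1
  funext m q q' e e' h
  exact h2 e e' h h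

end InvolutiveDVB

/-! ### The involution dual to a metric -/

namespace MetricDVB

open Filter Topology DVB

variable {EM : Type*} [NormedAddCommGroup EM] [NormedSpace ℝ EM]
    {HM : Type*} [TopologicalSpace HM] {I : ModelWithCorners ℝ EM HM}
    {M : Type*} [TopologicalSpace M] [ChartedSpace HM M]
    {Q B : SmoothVB I M} {E : SmoothVB Q.model Q.Tot} {T : MetricDVB Q B E} {m : M}

theorem pair_congr {q₁ q₂ q₁' q₂' : Q.E m} {e₁ : E.E ⟨m, q₁⟩} {e₂ : E.E ⟨m, q₂⟩}
    {e₁' : E.E ⟨m, q₁'⟩} {e₂' : E.E ⟨m, q₂'⟩} (h₁ : (⟨⟨m, q₁⟩, e₁⟩ : E.Tot) = ⟨⟨m, q₁'⟩, e₁'⟩)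
    (h₂ : (⟨⟨m, q₂⟩, e₂⟩ : E.Tot) = ⟨⟨m, q₂'⟩, e₂'⟩) (h : T.prB e₁ = T.prB e₂)
    (h' : T.prB e₁' = T.prB e₂') : T.pair e₁ e₂ h = T.pair e₁' e₂' h' := by
  cases h₁
  cases h₂
  rfl

theorem pair_core_right (σ : T.Splitting m) {q : Q.E m} (b : B.E m) (e : E.E ⟨m, q⟩)
    (t : Q.dual.E m) (h : T.prB e = T.prB (σ.pt 0 b t)) :
    T.pair e (σ.pt 0 b t) h = t q := by
  have hb := h
  rw [σ.prB_pt] at hb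
  subst hb
  rw [← T.pair_core e t]
  exact pair_congr rfl (by rw [σ.coreB_eq]) _ _

/-- Over `b` the right argument is `(q', b, 0) +_B (0, b, t)`, and the second summand is a core
translate, whose pairing is prescribed by `pair_core`. -/
theorem pair_pt_right (σ : T.Splitting m) {q q' : Q.E m} (b : B.E m) (e : E.E ⟨m, q⟩)
    (t : Q.dual.E m) (h : T.prB e = b) :
    T.pair e (σ.pt q' b t) (h.trans (σ.prB_pt _ _ _).symm) =
      T.pair e (σ.pt q' b 0) (h.trans (σ.prB_pt _ _ _).symm) + t q := by
  have h1 := T.pair_addB (σ.pt q' b 0) (σ.pt 0 b t) e (by rw [σ.prB_pt, h]) (by rw [σ.prB_pt, h])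
  rw [T.pair_symm (σ.pt 0 b t), pair_core_right σ b e t, T.pair_symm (σ.pt q' b 0)] at h1
  rw [← h1, T.pair_symm]
  refine pair_congr ?_ rfl _ _
  rw [σ.addB_pt, add_zero, zero_add]

/-- The component of the metric in a splitting. -/
def form (σ : T.Splitting m) (q q' : Q.E m) : B.dual.E m :=
  LinearMap.toContinuousLinearMap (F' := ℝ)
    { toFun := fun b => T.pair (σ.pt q b 0) (σ.pt q' b 0) (by rw [σ.prB_pt, σ.prB_pt])
      map_add' := fun b b' => by
        rw [← T.pair_add]
        exact pair_congr (by rw [← σ.pt_add, add_zero]) (by rw [← σ.pt_add, add_zero]) _ _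
      map_smul' := fun r b => by
        rw [RingHom.id_apply, smul_eq_mul, ← T.pair_smul]
        exact pair_congr (by rw [← σ.pt_smul, smul_zero]) (by rw [← σ.pt_smul, smul_zero]) _ _ }

theorem form_apply (σ : T.Splitting m) (q q' : Q.E m) (b : B.E m) :
    form σ q q' b = T.pair (σ.pt q b 0) (σ.pt q' b 0) (by rw [σ.prB_pt, σ.prB_pt]) := rfl

/-- The normal form of a linear metric: the core components are removed on both sides with the help
of symmetry. -/
theorem pair_pt (σ : T.Splitting m) (q q' : Q.E m) (b : B.E m) (t t' : Q.dual.E m)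
    (h : T.prB (σ.pt q b t) = T.prB (σ.pt q' b t')) :
    T.pair (σ.pt q b t) (σ.pt q' b t') h = t q' + t' q + form σ q q' b := by
  rw [pair_pt_right σ b _ t' (σ.prB_pt _ _ _), T.pair_symm,
    pair_pt_right σ b _ t (σ.prB_pt _ _ _), T.pair_symm, form_apply]
  abel

theorem form_symm (σ : T.Splitting m) (q q' : Q.E m) : form σ q q' = form σ q' q :=
  ContinuousLinearMap.ext fun b => by rw [form_apply, form_apply, T.pair_symm]

theorem form_add (σ : T.Splitting m) (q p p' : Q.E m) :
    form σ q (p + p') = form σ q p + form σ q p' := by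
  refine ContinuousLinearMap.ext fun b => ?_
  rw [form_symm, form_symm σ q p, form_symm σ q p', add_apply, form_apply, form_apply, form_apply,
    ← T.pair_addB]
  refine pair_congr ?_ rfl _ _
  rw [σ.addB_pt, add_zero]

theorem form_smul (σ : T.Splitting m) (q : Q.E m) (r : ℝ) (p : Q.E m) :
    form σ q (r • p) = r • form σ q p := by
  refine ContinuousLinearMap.ext fun b => ?_
  rw [form_symm, form_symm σ q p, smul_apply, form_apply, form_apply, smul_eq_mul, ← T.pair_smulB]
  refine pair_congr ?_ rfl _ _
  rw [σ.smulB_pt, smul_zero]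

theorem form_zero (σ : T.Splitting m) (q : Q.E m) : form σ q 0 = 0 := by
  have := form_smul σ q 0 0
  rwa [zero_smul, zero_smul] at this

/-- The involution on the dual of a metric double vector bundle. -/
def dualInv (τ : ∀ m, T.Splitting m) {q : Q.E m} (d : E.dual.E ⟨m, q⟩) :
    E.dual.E ⟨m, (τ m).dualK d⟩ :=
  (τ m).dpt _ q (form (τ m) q ((τ m).dualK d) - (τ m).dualB d)

theorem dualInv_dpt (τ : ∀ m, T.Splitting m) (q p : Q.E m) (β : B.dual.E m) :
    (⟨⟨m, (τ m).dualK ((τ m).dpt q p β)⟩, dualInv τ ((τ m).dpt q p β)⟩ : E.dual.Tot) =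
      ⟨⟨m, p⟩, (τ m).dpt p q (form (τ m) q p - β)⟩ := by
  rw [dualInv, (τ m).dualB_dpt, (τ m).dualK_dpt]

/-- The core component `γ` of `x` contributes `γ` evaluated at the projection of `d` to both terms
on the right and cancels, so the canonical pairing is independent of `x`. -/
theorem dualInv_apply (τ : ∀ m, T.Splitting m) {q : Q.E m} (d : E.dual.E ⟨m, q⟩)
    (e : E.E ⟨m, (τ m).dualK d⟩) (x : E.E ⟨m, q⟩) (h : T.prB e = T.prB x) :
    dualInv τ d e = T.pair e x h - d x := by
  have hd := (τ m).dpt_dual d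
  obtain ⟨b, t, rfl⟩ := (τ m).exists_eq_pt e
  obtain ⟨b', γ, rfl⟩ := (τ m).exists_eq_pt x
  have hb := h
  rw [Splitting.prB_pt, Splitting.prB_pt] at hb
  subst hb
  have hx : d ((τ m).pt q b γ) = (τ m).dualB d b + γ ((τ m).dualK d) :=
    (congrArg (fun Φ => Φ ((τ m).pt q b γ)) hd).symm.trans ((τ m).dpt_pt _ _ _ _ _)
  rw [hx, dualInv, Splitting.dpt_pt, pair_pt, form_symm, sub_apply]
  abel

/-- Tested on a smooth frame: by `dualInv_apply`, with `x` a frame vector over the base point of `d`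
having the same `B` component, the values are a metric pairing of frame vectors minus a value of
`d`. -/
theorem contMDiff_dualInv [IsManifold I ∞ M] (τ : ∀ m, T.Splitting m) :
    ContMDiff E.dual.model E.dual.model ∞
      (fun d : E.dual.Tot =>
        (⟨⟨d.proj.proj, (τ d.proj.proj).dualK d.snd⟩, dualInv τ d.snd⟩ : E.dual.Tot)) := by
  intro d₀
  obtain ⟨s⟩ := T.nonempty_smoothSplitting d₀.proj.proj
  have hb := s.contMDiffAt_dualK τ (Φ₀ := d₀) s.mem
  obtain ⟨P, hP, hPe⟩ := T.pair_smooth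
  refine SmoothVB.contMDiffWithinAt_dual_of_frame (V := E) (Set.mem_univ _) hb
    (fun d => s.frame _) (s.frame_bijective s.mem)
    (fun w => s.contMDiffWithinAt_frame hb s.mem w) fun w => ?_
  have h1 := s.contMDiffAt_apply_frame (Φ₀ := d₀) s.mem (w.1, 0)
  have h2 := s.contMDiffWithinAt_frame hb s.mem w
  have h3 := s.contMDiffWithinAt_frame (contMDiffAt_proj (n := ∞) (IB := Q.model) E.dual.E
    (p := d₀)) s.mem (w.1, 0)
  have hpr : ∀ d : E.dual.Tot, T.prB (s.frame ⟨d.proj.proj, (τ d.proj.proj).dualK d.snd⟩ w) =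
      T.prB (s.frame d.proj (w.1, 0)) := fun d => by
    refine ((s.spl d.proj.proj).prB_pt _ _ _).trans ?_
    exact ((s.spl d.proj.proj).prB_pt _ _ _).symm
  have h4 := (hP (⟨⟨d₀.proj.proj, (τ d₀.proj.proj).dualK d₀.snd⟩, s.frame _ w⟩,
    ⟨d₀.proj, s.frame d₀.proj (w.1, 0)⟩) (congrArg (TotalSpace.mk d₀.proj.proj) (hpr d₀))).comp d₀ (h2.prodMk h3) fun d _ => congrArg (TotalSpace.mk d.proj.proj) (hpr d)
  refine (h4.sub h1).congr (fun d _ => ?_) ?_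
  · refine (dualInv_apply τ d.snd _ _ (hpr d)).trans (congrArg (· - _) (hPe _ _ _).symm)
  · refine (dualInv_apply τ d₀.snd _ _ (hpr d₀)).trans (congrArg (· - _) (hPe _ _ _).symm)

theorem mk_dpt_congr (σ : T.Splitting m) {p p' κ κ' : Q.E m} {β β' : B.dual.E m} (hp : p = p')
    (hκ : κ = κ') (hβ : β = β') :
    (⟨⟨m, p⟩, σ.dpt p κ β⟩ : E.dual.Tot) = ⟨⟨m, p'⟩, σ.dpt p' κ' β'⟩ := by
  rw [hp, hκ, hβ]

theorem dualK_dualInv (τ : ∀ m, T.Splitting m) {q : Q.E m} (d : E.dual.E ⟨m, q⟩) :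
    (τ m).dualK (dualInv τ d) = q := (τ m).dualK_dpt _ _ _

theorem dualB_dualInv (τ : ∀ m, T.Splitting m) {q : Q.E m} (d : E.dual.E ⟨m, q⟩) :
    (τ m).dualB (dualInv τ d) = form (τ m) q ((τ m).dualK d) - (τ m).dualB d :=
  (τ m).dualB_dpt _ _ _

/-- The involutive double vector bundle dual to a metric double vector bundle. -/
def dualInvolutive [IsManifold I ∞ M] (τ : ∀ m, T.Splitting m) : InvolutiveDVB Q B E.dual where
  toDVB := dualDVB τ
  inv d := dualInv τ d
  prB_inv {m q} d := dualK_dualInv τ d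
  inv_inv {m q} d := by
    -- The map `(q, p, β) ↦ (p, q, form q p - β)` squares to the identity because the form is
    -- symmetric.
    have h : (τ m).dpt q ((τ m).dualK d) (form (τ m) ((τ m).dualK d) q -
        (form (τ m) q ((τ m).dualK d) - (τ m).dualB d)) = d := by
      rw [form_symm, sub_sub_cancel, Splitting.dpt_dual]
    exact (dualInv_dpt τ _ _ _).trans (congrArg (TotalSpace.mk _) h)
  inv_smooth := contMDiff_dualInv τ
  inv_add {m q} d d' := by
    refine mk_dpt_congr (τ m) (map_add _ _ _) (dualK_dualInv τ d).symm ?_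
    refine Eq.trans ?_ (congrArg₂ (· + ·) (dualB_dualInv τ d) (dualB_dualInv τ d')).symm
    rw [map_add, map_add, form_add]
    abel
  inv_smul {m q} r d := by
    refine mk_dpt_congr (τ m) (map_smul _ _ _) (dualK_dualInv τ d).symm ?_
    refine Eq.trans ?_ (congrArg (r • ·) (dualB_dualInv τ d)).symm
    rw [map_smul, map_smul, form_smul, smul_sub]
  inv_addB {m q q' p} d d' h x x' hx hx' := by
    obtain ⟨κ, β, rfl⟩ := (τ m).exists_dpt d
    obtain ⟨κ', β', rfl⟩ := (τ m).exists_dpt d'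
    have e1 := (dualInv_dpt τ q κ β).symm.trans hx
    have e2 := (dualInv_dpt τ q' κ' β').symm.trans hx'
    cases e1
    cases e2
    rw [← Splitting.dpt_add]
    refine mk_dpt_congr (τ m) (((τ m).dualK_dpt _ _ _).trans ((τ m).dualK_dpt _ _ _)) rfl ?_
    change form (τ m) (q + q') ((τ m).dualK ((τ m).dualAdd _ _)) -
      (τ m).dualB ((τ m).dualAdd _ _) = _
    rw [Splitting.dualAdd, Splitting.dualK_dpt, Splitting.dualK_dpt, Splitting.dualB_dpt,
      Splitting.dualB_dpt, Splitting.dualB_dpt, form_symm, form_add, form_symm (τ m) q,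
      form_symm (τ m) q']
    abel
  inv_smulB {m q} r d := by
    rw [dualInv]
    refine (mk_dpt_congr (τ m) ((τ m).dualK_dpt _ _ _) rfl ?_).trans
      (congrArg (TotalSpace.mk _) ((τ m).dpt_smul _ r _ _))
    change form (τ m) (r • q) ((τ m).dualK ((τ m).dualSMul r d)) -
      (τ m).dualB ((τ m).dualSMul r d) = _
    rw [Splitting.dualSMul, Splitting.dualK_dpt, Splitting.dualB_dpt, form_symm, form_smul,
      form_symm (τ m) q, smul_sub]
  inv_core {m} β := by
    refine (dualInv_dpt τ 0 0 β).trans ?_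
    rw [form_zero, zero_sub]
    rfl

theorem isDualInvolutive_dualInvolutive [IsManifold I ∞ M] (τ : ∀ m, T.Splitting m) :
    T.IsDualInvolutive (dualInvolutive τ) where
  isDual := isDual_dualDVB τ
  inv_eq {m q} d e := ⟨⟨(τ m).sec q (T.prB e), (τ m).prB_sec _ _⟩, fun x h =>
    dualInv_apply τ d e x h.symm⟩

/-- `IsCanonicalPairing` includes the existence of an auxiliary element, so every value of the
involution is forced. -/
theorem IsDualInvolutive.unique [IsManifold I ∞ M] {S S' : InvolutiveDVB Q B E.dual}
    (hS : T.IsDualInvolutive S) (hS' : T.IsDualInvolutive S') : S = S' := by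
  have h1 : S.toDVB = S'.toDVB :=
    hS.isDual.unique (fun m => (T.nonempty_smoothSplitting m).some.spl m) hS'.isDual
  obtain ⟨S, inv, k1, k2, k3, k4, k5, k6, k7, k8⟩ := S
  obtain ⟨S', inv', k1', k2', k3', k4', k5', k6', k7', k8'⟩ := S'
  dsimp only at h1
  subst h1
  have h2 : @inv = @inv' := by
    funext m q d
    refine ContinuousLinearMap.ext fun e => ?_
    obtain ⟨⟨x, hx⟩, h⟩ := hS.inv_eq d e
    exact (h x hx).trans ((hS'.inv_eq d e).2 x hx).symm
  subst h2
  rfl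

end MetricDVB

/-! ### Biduals: the two constructions are inverse to each other -/

section

variable {EM : Type*} [NormedAddCommGroup EM] [NormedSpace ℝ EM]
    {HM : Type*} [TopologicalSpace HM] {I : ModelWithCorners ℝ EM HM}
    {M : Type*} [TopologicalSpace M] [ChartedSpace HM M]

/-- A choice of splittings over all points of the base. -/
def DVB.splitting [IsManifold I ∞ M] {A B K : SmoothVB I M} {D : SmoothVB A.model A.Tot}
    (S : DVB A B K D) (m : M) : S.Splitting m := (S.nonempty_smoothSplitting m).some.spl m

/-- The canonical map of a double vector bundle into its bidual over `A` is an isomorphism. -/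
theorem DVB.isIso_ev [IsManifold I ∞ M] {A B K : SmoothVB I M} {D : SmoothVB A.model A.Tot}
    {S : DVB A B K D} {T : DVB A K B D.dual} {U : DVB A B K D.dual.dual}
    (τ : ∀ m, S.Splitting m) (hT : S.IsDual T) (hU : T.IsDual U) :
    S.IsIso U (fun {_} => D.ev) where
  diffeo := SmoothVB.exists_diffeomorph_ev
  add := SmoothVB.ev_add
  smul := SmoothVB.ev_smul
  prB {m a} d := by
    obtain ⟨b, γ, rfl⟩ := (τ m).exists_eq_pt d
    rw [(τ m).ev_pt hT, Splitting.prB_dpt _ hU, Splitting.prB_pt]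
  addB {m a a'} d d' h h' := by
    obtain ⟨b, γ, rfl⟩ := (τ m).exists_eq_pt d
    obtain ⟨b', γ', rfl⟩ := (τ m).exists_eq_pt d'
    have hb : b = b' := by rwa [Splitting.prB_pt, Splitting.prB_pt] at h
    subst hb
    -- The proof argument of `addB` mentions both summands, so they are replaced by variables before
    -- being substituted together.
    have key : ∀ (x : D.dual.dual.E ⟨m, a⟩) (x' : D.dual.dual.E ⟨m, a'⟩)
        (hx : U.prB x = U.prB x'), x = ((τ m).dual hT).dpt a b γ →
        x' = ((τ m).dual hT).dpt a' b γ' →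
        U.addB x x' hx = ((τ m).dual hT).dpt (a + a') b (γ + γ') := by
      rintro _ _ hx rfl rfl
      exact Splitting.addB_dpt _ hU _ _ _ _ _ _
    rw [Splitting.addB_pt, (τ m).ev_pt hT,
      key _ _ h' ((τ m).ev_pt hT _ _ _) ((τ m).ev_pt hT _ _ _)]
  smulB {m a} r d := by
    obtain ⟨b, γ, rfl⟩ := (τ m).exists_eq_pt d
    rw [Splitting.smulB_pt, (τ m).ev_pt hT, (τ m).ev_pt hT, Splitting.smulB_dpt _ hU]
  core {m} γ := by
    rw [(τ m).core_eq, (τ m).ev_pt hT, Splitting.core_dual_eq _ hU]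

variable {Q B : SmoothVB I M}

theorem MetricDVB.IsDualInvolutive.invTo_apply {E : SmoothVB Q.model Q.Tot}
    {T : MetricDVB Q B E} {S : InvolutiveDVB Q B E.dual} (hS : T.IsDualInvolutive S) {m : M}
    {q p : Q.E m} (d : E.dual.E ⟨m, q⟩) (h : S.prB d = p) (e : E.E ⟨m, p⟩) (x : E.E ⟨m, q⟩)
    (hx : T.prB e = T.prB x) : S.invTo d h e = T.pair e x hx - d x := by
  subst h
  exact (hS.inv_eq d e).2 x hx.symm

/-- With `x` over `q` and of the same projection as `e`, the value at `e` is `⟨e, x⟩ - x d`, where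
`⟨x, e⟩ = x d + e (𝓘 d)`; the terms `x d` cancel. -/
theorem InvolutiveDVB.inv_ev [IsManifold I ∞ M] {D : SmoothVB Q.model Q.Tot}
    {S : InvolutiveDVB Q B D} {T : MetricDVB Q B D.dual} {S' : InvolutiveDVB Q B D.dual.dual}
    (hT : S.IsDualMetric T) (hS' : T.IsDualInvolutive S') {m : M} {q : Q.E m} (d : D.E ⟨m, q⟩)
    (h : S'.prB (D.ev d) = S.prB d) :
    (⟨⟨m, S'.prB (D.ev d)⟩, S'.inv (D.ev d)⟩ : D.dual.dual.Tot) =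
      ⟨⟨m, S.prB d⟩, D.ev (S.inv d)⟩ := by
  refine (InvolutiveDVB.invTo_eq_iff (D.ev d) h _).1 (ContinuousLinearMap.ext fun e => ?_)
  obtain ⟨s⟩ := T.nonempty_smoothSplitting m
  have hx : T.prB e = T.prB ((s.spl m).sec q (T.prB e)) := ((s.spl m).prB_sec _ _).symm
  rw [hS'.invTo_apply (D.ev d) h e _ hx, T.pair_symm, hT.pair_eq d]
  exact add_sub_cancel_left _ _

/-- With `d` over `q` and `q'`, the new metric is `d e + (𝓘 d) e'`, where `(𝓘 d) e' = ⟨e', e⟩ - d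
e`. -/
theorem MetricDVB.pair_ev [IsManifold I ∞ M] {E : SmoothVB Q.model Q.Tot}
    {T : MetricDVB Q B E} {S : InvolutiveDVB Q B E.dual} {T' : MetricDVB Q B E.dual.dual}
    (hS : T.IsDualInvolutive S) (hT' : S.IsDualMetric T') {m : M} {q q' : Q.E m}
    (e : E.E ⟨m, q⟩) (e' : E.E ⟨m, q'⟩) (h : T.prB e = T.prB e')
    (h' : T'.prB (E.ev e) = T'.prB (E.ev e')) :
    T'.pair (E.ev e) (E.ev e') h' = T.pair e e' h := by
  obtain ⟨d, rfl⟩ := InvolutiveDVB.exists_prB_eq S.toDVB q q'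
  rw [hT'.pair_eq d, T.pair_symm]
  refine (congrArg (d e + ·) ((hS.inv_eq d e').2 e h)).trans ?_
  exact add_sub_cancel _ _

end

end

theorem proposition3p11 {n : ℕ} {M : Type*} [TopologicalSpace M]
    [ChartedSpace (EuclideanSpace ℝ (Fin n)) M] [IsManifold (𝓡 n) ∞ M]
    (Q B : SmoothVB (𝓡 n) M) :
    -- (1) an involutive double vector bundle defines a metric double vector bundle
    (∀ (D : SmoothVB Q.model Q.Tot) (S : InvolutiveDVB Q B D),
      (∃! T : MetricDVB Q B D.dual, S.IsDualMetric T) ∧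
      ∀ (m : M) (q₁ q₂ : Q.E m), ∃ d : D.E ⟨m, q₁⟩, S.prB d = q₂) ∧
    -- (2) a metric double vector bundle defines an involutive double vector bundle
    (∀ (E : SmoothVB Q.model Q.Tot) (T : MetricDVB Q B E),
      ∃! S : InvolutiveDVB Q B E.dual, T.IsDualInvolutive S) ∧
    -- (3) the two constructions are inverse to each other, up to the canonical identification of
    -- a vector bundle over `Q` with its bidual
    (∀ (D : SmoothVB Q.model Q.Tot) (S : InvolutiveDVB Q B D) (T : MetricDVB Q B D.dual)
      (S' : InvolutiveDVB Q B D.dual.dual), S.IsDualMetric T → T.IsDualInvolutive S' →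
      S.toDVB.IsIso S'.toDVB (fun {_} => D.ev) ∧
      ∀ {m : M} {q : Q.E m} (d : D.E ⟨m, q⟩),
        (⟨⟨m, S'.prB (D.ev d)⟩, S'.inv (D.ev d)⟩ : D.dual.dual.Tot) =
          ⟨⟨m, S.prB d⟩, D.ev (S.inv d)⟩) ∧
    (∀ (E : SmoothVB Q.model Q.Tot) (T : MetricDVB Q B E) (S : InvolutiveDVB Q B E.dual)
      (T' : MetricDVB Q B E.dual.dual), T.IsDualInvolutive S → S.IsDualMetric T' →
      T.toDVB.IsIso T'.toDVB (fun {_} => E.ev) ∧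
      ∀ {m : M} {q q' : Q.E m} (e : E.E ⟨m, q⟩) (e' : E.E ⟨m, q'⟩) (h : T.prB e = T.prB e')
        (h' : T'.prB (E.ev e) = T'.prB (E.ev e')),
        T'.pair (E.ev e) (E.ev e') h' = T.pair e e' h) := by
  refine ⟨fun D S => ⟨⟨InvolutiveDVB.dualMetric (S := S) S.toDVB.splitting,
      InvolutiveDVB.isDualMetric_dualMetric _, fun T hT =>
        hT.unique (InvolutiveDVB.isDualMetric_dualMetric _)⟩,
      fun m q₁ q₂ => InvolutiveDVB.exists_prB_eq S.toDVB q₁ q₂⟩,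
    fun E T => ⟨MetricDVB.dualInvolutive (T := T) T.toDVB.splitting,
      MetricDVB.isDualInvolutive_dualInvolutive _, fun S hS =>
        hS.unique (MetricDVB.isDualInvolutive_dualInvolutive _)⟩,
    fun D S T S' hT hS' => ?_, fun E T S T' hS hT' => ?_⟩
  · have h := DVB.isIso_ev S.toDVB.splitting hT.isDual hS'.isDual
    exact ⟨h, fun d => InvolutiveDVB.inv_ev hT hS' d (h.prB d)⟩
  · exact ⟨DVB.isIso_ev T.toDVB.splitting hS.isDual hT'.isDual,
      fun e e' h h' => MetricDVB.pair_ev hS hT' e e' h h'⟩
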